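/- Let $A$ be a finite-dimensional algebra over a field, let $\mathscr{A}=A\text{-mod}$ be the category of finitely generated left $A$-modules, and let $\mathscr{C}$ be a full additive subcategory of $\mathscr{A}$, closed under direct summands, such that every $M\in\mathscr{A}$ has a right $\mathscr{C}$-approximation (that is, $\mathscr{C}$ is contravariantly finite: there is $f\colon C\to M$ with $C\in\mathscr{C}$ through which every map from an object of $\mathscr{C}$ to $M$ factors) and every right $\mathscr{C}$-approximation is epic ($\mathscr{C}$ is admissible). A complex $X^\bullet$ is called $\mathscr{C}$-acyclic, or $\operatorname{Hom}(\mathscr{C},-)$-exact, if $\operatorname{Hom}_{\mathscr{A}}(C,X^\bullet)$ is acyclic for all $C\in\mathscr{C}$; $\operatorname{Hom}(-,\mathscr{C})$-exactness is defined dually. Let $\mathscr{G}(\mathscr{C})$ be the full subcategory of the modules $M\cong\operatorname{Im}(C^{-1}\to C^0)$ for some acyclic complex $\cdots\to C^{-1}\to C^0\to C^1\to\cdots$ with terms in $\mathscr{C}$ that is both $\operatorname{Hom}(\mathscr{C},-)$-exact and $\operatorname{Hom}(-,\mathscr{C})$-exact, and let $\varepsilon$ be the class of $\operatorname{Hom}(\mathscr{C},-)$-exact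 complexes $0\to L\to M\to N\to 0$ with $L,M,N\in\mathscr{G}(\mathscr{C})$. The $\mathscr{C}$-proper $\mathscr{G}(\mathscr{C})$-dimension of a module $M$ is the least $n\ge 0$ for which there is a $\operatorname{Hom}(\mathscr{C},-)$-exact complex $0\to G^{-n}\to\cdots\to G^0\to M\to 0$ with all $G^i\in\mathscr{G}(\mathscr{C})$ ($\infty$ if there is none), and that of $\mathscr{A}$ is the supremum over all $M\in\mathscr{A}$. Let $D^b_{\mathscr{C}}(\mathscr{A})$ be the Verdier quotient of the bounded homotopy category $K^b(\mathscr{A})$ by the $\mathscr{C}$-acyclic complexes, let $D_{\mathscr{C}\text{-sg}}(\mathscr{A})=D^b_{\mathscr{C}}(\mathscr{A})/K^b(\mathscr{C})$ be the Verdier quotient by the full triangulated subcategory $K^b(\mathscr{C})$, and let $\theta\colon\mathscr{G}(\mathscr{C})\hookrightarrow\mathscr{A}\to K^b(\mathscr{A})\to D^b_{\mathscr{C}}(\mathscr{A})\to D_{\mathscr{C}\text{-sg}}(\mathscr{A})$ be the natural functor, where a module is regarded as a complex concentrated in degree $0$. If the $\mathscr{C}$-proper $\mathscr{G}(\mathscr{C})$-dimension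 of $\mathscr{A}$ is finite, then $(\mathscr{G}(\mathscr{C}),\varepsilon)$ is a Frobenius category, its stable category $\underline{\mathscr{G}(\mathscr{C})}$ (the quotient of $\mathscr{G}(\mathscr{C})$ by the morphisms that factor through $\varepsilon$-projective objects) is a triangulated category with Happel's shift and distinguished triangles, and $\theta$ induces a triangle equivalence $\theta'\colon\underline{\mathscr{G}(\mathscr{C})}\to D_{\mathscr{C}\text{-sg}}(\mathscr{A})$. -/

import Mathlib

open CategoryTheory Limits Pretriangulated Opposite ZeroObject

universe v u w

noncomputable section

/-! ### Finite-dimensional modules over a finite-dimensional algebra -/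

/-- The category `A`-mod of finitely generated left modules over a finite-dimensional
algebra `A` over the field `k`. -/
def FDModuleCat (k : Type w) (A : Type u) [Field k] [Ring A] [Algebra k A]
    [FiniteDimensional k A] : Type (u + 1) :=
  FGModuleCat.{u} A

instance (k : Type w) (A : Type u) [Field k] [Ring A] [Algebra k A] [FiniteDimensional k A] :
    Category.{u} (FDModuleCat k A) :=
  inferInstanceAs (Category.{u} (FGModuleCat.{u} A))

instance (k : Type w) (A : Type u) [Field k] [Ring A] [Algebra k A] [FiniteDimensional k A] :
    Abelian (FDModuleCat k A) :=
  haveI : IsNoetherianRing A := IsNoetherianRing.of_finite k A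
  inferInstanceAs (Abelian (FGModuleCat.{u} A))

namespace RelSing

/-! ### Exact categories, Frobenius categories, stable categories -/

section Exact

variable {B : Type u} [Category.{v} B] [Preadditive B]

/-- Admissible monics with respect to a class `ε` of short complexes. -/
def IsInflation (ε : ObjectProperty (ShortComplex B)) {X Y : B} (i : X ⟶ Y) : Prop :=
  ∃ (Z : B) (p : Y ⟶ Z) (h : i ≫ p = 0), ε (ShortComplex.mk i p h)

/-- Admissible epics with respect to a class `ε` of short complexes. -/
def IsDeflation (ε : ObjectProperty (ShortComplex B)) {Y Z : B} (p : Y ⟶ Z) : Prop :=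
  ∃ (X : B) (i : X ⟶ Y) (h : i ≫ p = 0), ε (ShortComplex.mk i p h)

/-- The axioms of a (Quillen) exact category for the class `ε` of conflations. -/
structure IsExactStructure (ε : ObjectProperty (ShortComplex B)) : Prop where
  of_iso {S T : ShortComplex B} (e : S ≅ T) (hS : ε S) : ε T
  isKernel (S : ShortComplex B) (hS : ε S) : Nonempty (IsLimit (KernelFork.ofι S.f S.zero))
  isCokernel (S : ShortComplex B) (hS : ε S) : Nonempty (IsColimit (CokernelCofork.ofπ S.g S.zero))
  id_inflation (X : B) : IsInflation ε (𝟙 X)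
  id_deflation (X : B) : IsDeflation ε (𝟙 X)
  comp_inflation {X Y Z : B} (f : X ⟶ Y) (g : Y ⟶ Z) (hf : IsInflation ε f)
    (hg : IsInflation ε g) : IsInflation ε (f ≫ g)
  comp_deflation {X Y Z : B} (f : X ⟶ Y) (g : Y ⟶ Z) (hf : IsDeflation ε f)
    (hg : IsDeflation ε g) : IsDeflation ε (f ≫ g)
  pushout_inflation {X Y X' : B} (i : X ⟶ Y) (f : X ⟶ X') (hi : IsInflation ε i) :
    ∃ (Y' : B) (f' : Y ⟶ Y') (i' : X' ⟶ Y'), IsPushout i f f' i' ∧ IsInflation ε i'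
  pullback_deflation {Y Z Z' : B} (p : Y ⟶ Z) (f : Z' ⟶ Z) (hp : IsDeflation ε p) :
    ∃ (Y' : B) (f' : Y' ⟶ Y) (p' : Y' ⟶ Z'), IsPullback f' p' p f ∧ IsDeflation ε p'

/-- Projective objects relative to `ε`. -/
def IsRelProjective (ε : ObjectProperty (ShortComplex B)) (P : B) : Prop :=
  ∀ ⦃Y Z : B⦄ (p : Y ⟶ Z) (_ : IsDeflation ε p) (f : P ⟶ Z), ∃ g : P ⟶ Y, g ≫ p = f

/-- Injective objects relative to `ε`. -/
def IsRelInjective (ε : ObjectProperty (ShortComplex B)) (I : B) : Prop :=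
  ∀ ⦃X Y : B⦄ (i : X ⟶ Y) (_ : IsInflation ε i) (f : X ⟶ I), ∃ g : Y ⟶ I, i ≫ g = f

/-- `(B, ε)` is a Frobenius category: an exact category with enough projectives and
enough injectives in which the projective and the injective objects coincide. -/
structure IsFrobenius (ε : ObjectProperty (ShortComplex B)) : Prop where
  exact : IsExactStructure ε
  enough_projectives (X : B) : ∃ (P : B) (p : P ⟶ X), IsRelProjective ε P ∧ IsDeflation ε p
  enough_injectives (X : B) : ∃ (I : B) (i : X ⟶ I), IsRelInjective ε I ∧ IsInflation ε i
  projective_iff_injective (X : B) : IsRelProjective ε X ↔ IsRelInjective ε X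

/-- Two morphisms are stably equal if their difference factors through a projective object. -/
def stableRel (ε : ObjectProperty (ShortComplex B)) : HomRel B := fun X Y f g =>
  ∃ (P : B) (a : X ⟶ P) (b : P ⟶ Y), IsRelProjective ε P ∧ f - g = a ≫ b

/-- The stable category of `(B, ε)`. -/
abbrev StableCategory (ε : ObjectProperty (ShortComplex B)) : Type u :=
  CategoryTheory.Quotient (stableRel ε)

/-- The canonical functor to the stable category. -/
abbrev stableQuotient (ε : ObjectProperty (ShortComplex B)) : B ⥤ StableCategory ε :=
  CategoryTheory.Quotient.functor (stableRel ε)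

lemma isRelProjective_biprod {ε : ObjectProperty (ShortComplex B)} [HasBinaryBiproducts B]
    {P Q : B} (hP : IsRelProjective ε P) (hQ : IsRelProjective ε Q) :
    IsRelProjective ε (P ⊞ Q) := by
  intro Y Z p hp f
  obtain ⟨g₁, h₁⟩ := hP p hp (biprod.inl ≫ f)
  obtain ⟨g₂, h₂⟩ := hQ p hp (biprod.inr ≫ f)
  exact ⟨biprod.desc g₁ g₂, by ext <;> simp [h₁, h₂]⟩

lemma isRelProjective_zero (ε : ObjectProperty (ShortComplex B)) [HasZeroObject B] :
    IsRelProjective ε (0 : B) :=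
  fun _ _ _ _ _ => ⟨0, (isZero_zero B).eq_of_src _ _⟩

lemma stableRel_add (ε : ObjectProperty (ShortComplex B)) [HasBinaryBiproducts B]
    ⦃X Y : B⦄ (f₁ f₂ g₁ g₂ : X ⟶ Y) (hf : stableRel ε f₁ f₂) (hg : stableRel ε g₁ g₂) :
    stableRel ε (f₁ + g₁) (f₂ + g₂) := by
  obtain ⟨P, a, b, hP, h⟩ := hf
  obtain ⟨Q, c, d, hQ, h'⟩ := hg
  refine ⟨P ⊞ Q, biprod.lift a c, biprod.desc b d, isRelProjective_biprod hP hQ, ?_⟩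
  rw [biprod.lift_desc, ← h, ← h']
  abel

instance (ε : ObjectProperty (ShortComplex B)) [HasZeroObject B] [HasBinaryBiproducts B] :
    Congruence (stableRel ε) where
  comp_left := by
    rintro X Y Z f g g' ⟨P, a, b, hP, h⟩
    exact ⟨P, f ≫ a, b, hP, by rw [← Preadditive.comp_sub, h, Category.assoc]⟩
  comp_right := by
    rintro X Y Z f f' g ⟨P, a, b, hP, h⟩
    exact ⟨P, a, b ≫ g, hP, by rw [← Preadditive.sub_comp, h, Category.assoc]⟩
  equivalence :=
    { refl := fun _ => ⟨0, 0, 0, isRelProjective_zero ε, by simp⟩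
      symm := by
        rintro f g ⟨P, a, b, hP, h⟩
        exact ⟨P, -a, b, hP, by rw [Preadditive.neg_comp, ← h, neg_sub]⟩
      trans := by
        rintro f g k ⟨P, a, b, hP, h⟩ ⟨Q, c, d, hQ, h'⟩
        refine ⟨P ⊞ Q, biprod.lift a c, biprod.desc b d, isRelProjective_biprod hP hQ, ?_⟩
        rw [biprod.lift_desc, ← h, ← h']
        abel }

instance (ε : ObjectProperty (ShortComplex B)) [HasZeroObject B] [HasBinaryBiproducts B] :
    Preadditive (StableCategory ε) :=
  CategoryTheory.Quotient.preadditive _ (stableRel_add ε)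

instance (ε : ObjectProperty (ShortComplex B)) [HasZeroObject B] [HasBinaryBiproducts B] :
    (stableQuotient ε).Additive :=
  CategoryTheory.Quotient.functor_additive _ (stableRel_add ε)

instance (ε : ObjectProperty (ShortComplex B)) [HasZeroObject B] [HasBinaryBiproducts B] :
    HasZeroObject (StableCategory ε) :=
  ⟨(stableQuotient ε).obj 0, (stableQuotient ε).map_isZero (isZero_zero B)⟩

/-- The assertion that a given shift and a given class of distinguished triangles on the stable
category of `(B, ε)` are Happel's. The shift `X⟦1⟧` is the cokernel `Y` of an inflation of `X`
into an injective object `I`: every conflation `X ⟶ I ⟶ Y` with `I` injective comes with an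
isomorphism `Y ≅ X⟦1⟧` in the stable category, naturally in the conflation. The distinguished
triangles are those isomorphic to a standard triangle `X ⟶ M ⟶ Z ⟶ X⟦1⟧`, which is obtained from
a morphism `u : X ⟶ M` and such a conflation `X ⟶ I ⟶ Y` as
```
  X ⟶ I ⟶ Y
 u|    |b   ‖
  M ⟶ Z ⟶ Y
    v   w
```
where the left square is a push-out. -/
structure HappelTriangulation (ε : ObjectProperty (ShortComplex B))
    [HasZeroObject B] [HasBinaryBiproducts B] [HasShift (StableCategory ε) ℤ]
    [∀ n : ℤ, (shiftFunctor (StableCategory ε) n).Additive]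
    [Pretriangulated (StableCategory ε)] where
  suspIso (S : ShortComplex B) (hS : ε S) (hI : IsRelInjective ε S.X₂) :
    (stableQuotient ε).obj S.X₃ ≅ ((stableQuotient ε).obj S.X₁)⟦(1 : ℤ)⟧
  suspIso_naturality (S S' : ShortComplex B) (hS : ε S) (hI : IsRelInjective ε S.X₂)
    (hS' : ε S') (hI' : IsRelInjective ε S'.X₂) (φ : S ⟶ S') :
    (stableQuotient ε).map φ.τ₃ ≫ (suspIso S' hS' hI').hom =
      (suspIso S hS hI).hom ≫ ((stableQuotient ε).map φ.τ₁)⟦(1 : ℤ)⟧'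
  distinguished_iff (T : Triangle (StableCategory ε)) :
    T ∈ distTriang (StableCategory ε) ↔
      ∃ (S : ShortComplex B) (hS : ε S) (hI : IsRelInjective ε S.X₂) (M Z : B)
        (u : S.X₁ ⟶ M) (v : M ⟶ Z) (b : S.X₂ ⟶ Z) (w : Z ⟶ S.X₃),
        IsPushout S.f u b v ∧ b ≫ w = S.g ∧ v ≫ w = 0 ∧
        Nonempty (T ≅ Triangle.mk ((stableQuotient ε).map u) ((stableQuotient ε).map v)
          ((stableQuotient ε).map w ≫ (suspIso S hS hI).hom))

end Exact

/-- A functor between pretriangulated categories is a triangle equivalence if it is an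
equivalence of categories which, for a suitable commutation with the shifts, preserves
distinguished triangles. -/
def IsTriangleEquivalence {C D : Type*} [Category* C] [Category* D]
    [HasZeroObject C] [HasZeroObject D] [Preadditive C] [Preadditive D]
    [HasShift C ℤ] [HasShift D ℤ] [∀ n : ℤ, (shiftFunctor C n).Additive]
    [∀ n : ℤ, (shiftFunctor D n).Additive] [Pretriangulated C] [Pretriangulated D]
    (F : C ⥤ D) : Prop :=
  F.IsEquivalence ∧ ∃ _ : F.CommShift ℤ, F.IsTriangulated

/-! ### Verdier quotients -/

section Verdier

variable {T : Type u} [Category.{v} T] [HasZeroObject T] [HasShift T ℤ] [Preadditive T]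
  [∀ n : ℤ, (shiftFunctor T n).Additive] [Pretriangulated T] [IsTriangulated T]

/-- The Verdier quotient of the triangulated category `T` by the triangulated subcategory `P`:
the localization at the morphisms whose cone belongs to `P`. -/
def VerdierQuotient (P : ObjectProperty T) [P.IsTriangulated] : Type _ := P.trW.Localization

variable (P : ObjectProperty T) [P.IsTriangulated]

instance : Category (VerdierQuotient P) := inferInstanceAs (Category P.trW.Localization)

/-- The quotient functor. -/
def VerdierQuotient.Q : T ⥤ VerdierQuotient P := P.trW.Q

instance : (VerdierQuotient.Q P).IsLocalization P.trW :=
  inferInstanceAs (P.trW.Q.IsLocalization P.trW)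

instance : Preadditive (VerdierQuotient P) := inferInstanceAs (Preadditive P.trW.Localization)

instance : HasZeroObject (VerdierQuotient P) :=
  inferInstanceAs (HasZeroObject P.trW.Localization)

instance : HasShift (VerdierQuotient P) ℤ := inferInstanceAs (HasShift P.trW.Localization ℤ)

instance (n : ℤ) : (shiftFunctor (VerdierQuotient P) n).Additive :=
  inferInstanceAs (shiftFunctor P.trW.Localization n).Additive

instance : Pretriangulated (VerdierQuotient P) :=
  inferInstanceAs (Pretriangulated P.trW.Localization)

instance : IsTriangulated (VerdierQuotient P) :=
  inferInstanceAs (IsTriangulated P.trW.Localization)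

instance : (VerdierQuotient.Q P).CommShift ℤ := inferInstanceAs (P.trW.Q.CommShift ℤ)

instance : (VerdierQuotient.Q P).Additive := inferInstanceAs P.trW.Q.Additive

instance : (VerdierQuotient.Q P).IsTriangulated := inferInstanceAs P.trW.Q.IsTriangulated

end Verdier

section Abelian

variable {𝒜 : Type u} [Category.{v} 𝒜] [Abelian 𝒜]

/-! ### Approximations, relative acyclicity and relative dimension -/

/-- `f : C ⟶ M` is a right `𝒞`-approximation of `M`. -/
def IsRightApproximation (𝒞 : ObjectProperty 𝒜) {C M : 𝒜} (f : C ⟶ M) : Prop :=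
  𝒞 C ∧ ∀ ⦃C' : 𝒜⦄ (_ : 𝒞 C') (g : C' ⟶ M), ∃ h : C' ⟶ C, h ≫ f = g

/-- Every object has a right `𝒞`-approximation. -/
def IsContravariantlyFinite (𝒞 : ObjectProperty 𝒜) : Prop :=
  ∀ M : 𝒜, ∃ (C : 𝒜) (f : C ⟶ M), IsRightApproximation 𝒞 f

/-- Every right `𝒞`-approximation is an epimorphism. -/
def IsAdmissible (𝒞 : ObjectProperty 𝒜) : Prop :=
  ∀ ⦃C M : 𝒜⦄ (f : C ⟶ M), IsRightApproximation 𝒞 f → Epi f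

/-- `K` is `Hom(𝒞, -)`-exact, that is, `𝒞`-acyclic. -/
def IsHomFromExact (𝒞 : ObjectProperty 𝒜) (K : CochainComplex 𝒜 ℤ) : Prop :=
  ∀ C : 𝒜, 𝒞 C →
    (((preadditiveCoyoneda.obj (op C)).mapHomologicalComplex (ComplexShape.up ℤ)).obj K).Acyclic

/-- `K` is `Hom(-, 𝒞)`-exact. -/
def IsHomToExact (𝒞 : ObjectProperty 𝒜) (K : CochainComplex 𝒜 ℤ) : Prop :=
  ∀ C : 𝒜, 𝒞 C →
    (((preadditiveYoneda.obj C).mapHomologicalComplex (ComplexShape.up ℤ).symm).obj K.op).Acyclic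

/-- There is a `Hom(𝒞, -)`-exact complex `0 ⟶ D⁻ⁿ ⟶ ⋯ ⟶ D⁰ ⟶ M ⟶ 0` with all `Dⁱ` in `𝒟`.
The object `M` is put in degree `1`. -/
def HasProperResolutionOfLength (𝒞 𝒟 : ObjectProperty 𝒜) (M : 𝒜) (n : ℕ) : Prop :=
  ∃ K : CochainComplex 𝒜 ℤ, IsHomFromExact 𝒞 K ∧ Nonempty (K.X 1 ≅ M) ∧
    (∀ i : ℤ, -(n : ℤ) ≤ i → i ≤ 0 → 𝒟 (K.X i)) ∧
    (∀ i : ℤ, i < -(n : ℤ) ∨ 1 < i → IsZero (K.X i))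

/-- The `𝒞`-proper `𝒟`-dimension of the object `M`. -/
def properDim (𝒞 𝒟 : ObjectProperty 𝒜) (M : 𝒜) : ℕ∞ :=
  ⨅ (n : ℕ) (_ : HasProperResolutionOfLength 𝒞 𝒟 M n), (n : ℕ∞)

/-- The `𝒞`-proper `𝒟`-dimension of the whole category. -/
def properGlobalDim (𝒞 𝒟 : ObjectProperty 𝒜) : ℕ∞ :=
  ⨆ M : 𝒜, properDim 𝒞 𝒟 M

/-! ### The Gorenstein category of `𝒞` -/

/-- The Gorenstein category `𝒢(𝒞)`. -/
def gorenstein (𝒞 : ObjectProperty 𝒜) : ObjectProperty 𝒜 := fun M =>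
  ∃ K : CochainComplex 𝒜 ℤ, (∀ i, 𝒞 (K.X i)) ∧ K.Acyclic ∧ IsHomFromExact 𝒞 K ∧
    IsHomToExact 𝒞 K ∧ Nonempty (M ≅ image (K.d (-1) 0))

/-- The class `ε` of all `Hom(𝒞, -)`-exact complexes `0 ⟶ L ⟶ M ⟶ N ⟶ 0` with terms
in `𝒢(𝒞)`. -/
def gorensteinConflations (𝒞 : ObjectProperty 𝒜) :
    ObjectProperty (ShortComplex (gorenstein 𝒞).FullSubcategory) := fun S =>
  ∀ C : 𝒜, 𝒞 C → ((S.map (gorenstein 𝒞).ι).map (preadditiveCoyoneda.obj (op C))).ShortExact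

lemma isHomFromExact_iff (𝒞 : ObjectProperty 𝒜) (K : CochainComplex 𝒜 ℤ) :
    IsHomFromExact 𝒞 K ↔ ∀ (C : 𝒜) (_ : 𝒞 C) (i j k : ℤ) (_ : i + 1 = j) (_ : j + 1 = k)
      (f : C ⟶ K.X j), f ≫ K.d j k = 0 → ∃ g : C ⟶ K.X i, g ≫ K.d i j = f := by
  refine forall_congr' fun C => forall_congr' fun hC => ?_
  rw [HomologicalComplex.acyclic_iff]
  constructor
  · intro h i j k hij hjk
    exact (ShortComplex.ab_exact_iff _).1
      ((HomologicalComplex.exactAt_iff' _ i j k (by simp; lia) (by simp; lia)).1 (h j))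
  · intro h j
    rw [HomologicalComplex.exactAt_iff' _ (j - 1) j (j + 1) (by simp) (by simp),
      ShortComplex.ab_exact_iff]
    exact h (j - 1) j (j + 1) (by lia) (by lia)

lemma isHomToExact_iff (𝒞 : ObjectProperty 𝒜) (K : CochainComplex 𝒜 ℤ) :
    IsHomToExact 𝒞 K ↔ ∀ (C : 𝒜) (_ : 𝒞 C) (i j k : ℤ) (_ : i + 1 = j) (_ : j + 1 = k)
      (f : K.X j ⟶ C), K.d i j ≫ f = 0 → ∃ g : K.X k ⟶ C, K.d j k ≫ g = f := by
  refine forall_congr' fun C => forall_congr' fun hC => ?_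
  rw [HomologicalComplex.acyclic_iff]
  constructor
  · intro h i j k hij hjk
    exact (ShortComplex.ab_exact_iff _).1
      ((HomologicalComplex.exactAt_iff' _ k j i (ComplexShape.prev_eq' _ hjk)
        (ComplexShape.next_eq' _ hij)).1 (h j))
  · intro h j
    rw [HomologicalComplex.exactAt_iff' _ (j + 1) j (j - 1)
      (ComplexShape.prev_eq' _ (show j + 1 = j + 1 from rfl))
      (ComplexShape.next_eq' _ (show j - 1 + 1 = j by lia)),
      ShortComplex.ab_exact_iff]
    exact h (j - 1) j (j + 1) (by lia) (by lia)

lemma acyclic_biprod {K L : CochainComplex 𝒜 ℤ} (hK : K.Acyclic) (hL : L.Acyclic) :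
    (K ⊞ L).Acyclic := by
  intro i
  rw [HomologicalComplex.exactAt_iff_isZero_homology]
  have := preservesBinaryBiproducts_of_preservesBiproducts
    (HomologicalComplex.homologyFunctor 𝒜 (ComplexShape.up ℤ) i)
  refine IsZero.of_iso ?_
    ((HomologicalComplex.homologyFunctor 𝒜 (ComplexShape.up ℤ) i).mapBiprod K L)
  rw [biprod_isZero_iff]
  exact ⟨(HomologicalComplex.exactAt_iff_isZero_homology _ _).1 (hK i),
    (HomologicalComplex.exactAt_iff_isZero_homology _ _).1 (hL i)⟩

lemma isHomFromExact_biprod {𝒞 : ObjectProperty 𝒜} {K L : CochainComplex 𝒜 ℤ}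
    (hK : IsHomFromExact 𝒞 K) (hL : IsHomFromExact 𝒞 L) : IsHomFromExact 𝒞 (K ⊞ L) := by
  rw [isHomFromExact_iff] at hK hL ⊢
  intro C hC i j k hij hjk f hf
  obtain ⟨g₁, h₁⟩ := hK C hC i j k hij hjk (f ≫ (biprod.fst : K ⊞ L ⟶ K).f j)
    (by rw [Category.assoc, HomologicalComplex.Hom.comm, reassoc_of% hf, zero_comp])
  obtain ⟨g₂, h₂⟩ := hL C hC i j k hij hjk (f ≫ (biprod.snd : K ⊞ L ⟶ L).f j)
    (by rw [Category.assoc, HomologicalComplex.Hom.comm, reassoc_of% hf, zero_comp])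
  refine ⟨g₁ ≫ (biprod.inl : K ⟶ K ⊞ L).f i + g₂ ≫ (biprod.inr : L ⟶ K ⊞ L).f i, ?_⟩
  rw [Preadditive.add_comp, Category.assoc, Category.assoc, HomologicalComplex.Hom.comm,
    HomologicalComplex.Hom.comm, reassoc_of% h₁, reassoc_of% h₂, ← Preadditive.comp_add,
    ← HomologicalComplex.comp_f, ← HomologicalComplex.comp_f, ← HomologicalComplex.add_f_apply,
    biprod.total, HomologicalComplex.id_f, Category.comp_id]

lemma isHomToExact_biprod {𝒞 : ObjectProperty 𝒜} {K L : CochainComplex 𝒜 ℤ}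
    (hK : IsHomToExact 𝒞 K) (hL : IsHomToExact 𝒞 L) : IsHomToExact 𝒞 (K ⊞ L) := by
  rw [isHomToExact_iff] at hK hL ⊢
  intro C hC i j k hij hjk f hf
  obtain ⟨g₁, h₁⟩ := hK C hC i j k hij hjk ((biprod.inl : K ⟶ K ⊞ L).f j ≫ f)
    (by rw [← HomologicalComplex.Hom.comm_assoc, hf, comp_zero])
  obtain ⟨g₂, h₂⟩ := hL C hC i j k hij hjk ((biprod.inr : L ⟶ K ⊞ L).f j ≫ f)
    (by rw [← HomologicalComplex.Hom.comm_assoc, hf, comp_zero])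
  refine ⟨(biprod.fst : K ⊞ L ⟶ K).f k ≫ g₁ + (biprod.snd : K ⊞ L ⟶ L).f k ≫ g₂, ?_⟩
  rw [Preadditive.comp_add, ← HomologicalComplex.Hom.comm_assoc,
    ← HomologicalComplex.Hom.comm_assoc, h₁, h₂, ← Category.assoc, ← Category.assoc,
    ← Preadditive.add_comp,
    ← HomologicalComplex.comp_f, ← HomologicalComplex.comp_f, ← HomologicalComplex.add_f_apply,
    biprod.total, HomologicalComplex.id_f, Category.id_comp]

instance (𝒞 : ObjectProperty 𝒜) : (gorenstein 𝒞).IsClosedUnderIsomorphisms where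
  of_iso := by
    rintro X Y e ⟨K, h₁, h₂, h₃, h₄, ⟨e'⟩⟩
    exact ⟨K, h₁, h₂, h₃, h₄, ⟨e.symm ≪≫ e'⟩⟩

lemma prop_biprod (P : ObjectProperty 𝒜) [P.IsClosedUnderBinaryProducts] {X Y : 𝒜}
    (hX : P X) (hY : P Y) : P (X ⊞ Y) :=
  P.prop_of_isLimit_binaryFan (BinaryBiproduct.isLimit X Y) hX hY

instance (𝒞 : ObjectProperty 𝒜) [𝒞.ContainsZero] [𝒞.IsClosedUnderIsomorphisms] :
    (gorenstein 𝒞).ContainsZero where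
  exists_zero := by
    have hz : IsZero (0 : CochainComplex 𝒜 ℤ) := isZero_zero _
    have hX (i : ℤ) : IsZero ((0 : CochainComplex 𝒜 ℤ).X i) :=
      (HomologicalComplex.eval 𝒜 (ComplexShape.up ℤ) i).map_isZero hz
    refine ⟨0, isZero_zero 𝒜, 0, fun i => 𝒞.prop_of_isZero (hX i), ?_, ?_, ?_, ⟨?_⟩⟩
    · intro i
      rw [HomologicalComplex.exactAt_iff_isZero_homology]
      exact (HomologicalComplex.homologyFunctor 𝒜 (ComplexShape.up ℤ) i).map_isZero hz
    · rw [isHomFromExact_iff]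
      intro C _ i j k _ _ f _
      exact ⟨0, (hX j).eq_of_tgt _ _⟩
    · rw [isHomToExact_iff]
      intro C _ i j k _ _ f _
      exact ⟨0, (hX j).eq_of_src _ _⟩
    · exact (isZero_zero 𝒜).iso (IsZero.of_mono (image.ι _) (hX 0))

lemma gorenstein_biprod (𝒞 : ObjectProperty 𝒜) [𝒞.IsClosedUnderIsomorphisms]
    [𝒞.IsClosedUnderBinaryProducts] {X Y : 𝒜} (hX : gorenstein 𝒞 X) (hY : gorenstein 𝒞 Y) :
    gorenstein 𝒞 (X ⊞ Y) := by
  obtain ⟨K, h₁, h₂, h₃, h₄, ⟨e⟩⟩ := hX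
  obtain ⟨L, h₁', h₂', h₃', h₄', ⟨e'⟩⟩ := hY
  refine ⟨K ⊞ L, fun i => 𝒞.prop_of_iso (HomologicalComplex.biprodXIso K L i).symm
    (prop_biprod 𝒞 (h₁ i) (h₁' i)), acyclic_biprod h₂ h₂', isHomFromExact_biprod h₃ h₃',
    isHomToExact_biprod h₄ h₄', ⟨biprod.mapIso e e' ≪≫ ?_⟩⟩
  have (f : K.X (-1) ⟶ image (K.d (-1) 0)) (g : L.X (-1) ⟶ image (L.d (-1) 0))
      [Epi f] [Epi g] : StrongEpi ((HomologicalComplex.biprodXIso K L (-1)).hom ≫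
        biprod.map f g) := by
    have : Epi (biprod.map f g) := inferInstance
    exact strongEpi_of_epi _
  refine image.isoStrongEpiMono ((HomologicalComplex.biprodXIso K L (-1)).hom ≫
      biprod.map (factorThruImage _) (factorThruImage _))
    (biprod.map (image.ι _) (image.ι _) ≫ (HomologicalComplex.biprodXIso K L 0).inv) ?_
  rw [← cancel_epi (HomologicalComplex.biprodXIso K L (-1)).inv]
  ext <;> simp

instance (𝒞 : ObjectProperty 𝒜) [𝒞.IsClosedUnderIsomorphisms]
    [𝒞.IsClosedUnderBinaryProducts] : (gorenstein 𝒞).IsClosedUnderBinaryProducts where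
  limitsOfShape_le := by
    rintro X ⟨p⟩
    let e : X ≅ p.diag.obj ⟨WalkingPair.left⟩ ⊞ p.diag.obj ⟨WalkingPair.right⟩ :=
      p.isLimit.conePointsIsoOfNatIso (BinaryBiproduct.isLimit _ _) (diagramIsoPair p.diag)
    exact (gorenstein 𝒞).prop_of_iso e.symm
      (gorenstein_biprod 𝒞 (p.prop_diag_obj _) (p.prop_diag_obj _))

instance (𝒞 : ObjectProperty 𝒜) [𝒞.IsClosedUnderIsomorphisms]
    [𝒞.IsClosedUnderBinaryProducts] : HasBinaryBiproducts (gorenstein 𝒞).FullSubcategory :=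
  HasBinaryBiproducts.of_hasBinaryProducts

/-! ### Bounded homotopy categories and relative derived categories -/

/-- The bounded complexes with terms in `P`, as objects of the homotopy category. -/
def boundedIn (P : ObjectProperty 𝒜) : ObjectProperty (HomotopyCategory 𝒜 (ComplexShape.up ℤ)) :=
  fun X => (∃ a b : ℤ, ∀ i : ℤ, i < a ∨ b < i → IsZero (X.as.X i)) ∧ ∀ i : ℤ, P (X.as.X i)

instance (P : ObjectProperty 𝒜) [P.ContainsZero] [P.IsClosedUnderIsomorphisms] :
    (boundedIn P).ContainsZero where
  exists_zero := by
    have hX (i : ℤ) : IsZero ((0 : CochainComplex 𝒜 ℤ).X i) :=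
      (HomologicalComplex.eval 𝒜 (ComplexShape.up ℤ) i).map_isZero (isZero_zero _)
    exact ⟨(HomotopyCategory.quotient _ _).obj 0, Functor.map_isZero _ (isZero_zero _),
      ⟨0, 0, fun i _ => hX i⟩, fun i => P.prop_of_isZero (hX i)⟩

instance (P : ObjectProperty 𝒜) : (boundedIn P).IsStableUnderShift ℤ where
  isStableUnderShiftBy n :=
    { le_shift := by
        intro X hX
        obtain ⟨K, rfl⟩ := X.quotient_obj_surjective
        obtain ⟨⟨a, b, h⟩, h'⟩ := hX
        rw [ObjectProperty.prop_shift_iff, HomotopyCategory.shift_quotient_obj]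
        exact ⟨⟨a - n, b - n, fun i hi => h (i + n) (by lia)⟩, fun i => h' (i + n)⟩ }

instance (P : ObjectProperty 𝒜) [P.ContainsZero] [P.IsClosedUnderIsomorphisms]
    [P.IsClosedUnderBinaryProducts] : (boundedIn P).IsTriangulatedClosed₃ where
  ext₃' T hT h₁ h₂ := by
    obtain ⟨⟨a₁, b₁, h₁⟩, h₁'⟩ := h₁
    obtain ⟨⟨a₂, b₂, h₂⟩, h₂'⟩ := h₂
    obtain ⟨f : T.obj₁.as ⟶ T.obj₂.as, hf⟩ :=
      (HomotopyCategory.quotient _ _).map_surjective T.mor₁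
    refine ⟨(HomotopyCategory.quotient _ _).obj (CochainComplex.mappingCone f), ⟨⟨min (a₁ - 1) a₂,
      max b₁ b₂, fun i hi => ?_⟩, fun i => ?_⟩,
      ⟨Triangle.π₃.mapIso (isoTriangleOfIso₁₂ T _ hT
        (HomotopyCategory.mappingCone_triangleh_distinguished f)
        (Iso.refl _) (Iso.refl _) ?_)⟩⟩
    · exact (CochainComplex.mappingCone.isZero_X_iff f i).2
        ⟨h₁ _ (by lia), h₂ _ (by lia)⟩
    · exact P.prop_of_iso (HomologicalComplex.homotopyCofiber.XIsoBiprod f i (i + 1) rfl).symm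
        (prop_biprod P (h₁' _) (h₂' _))
    · rw [← hf]
      exact (Category.comp_id _).trans (Category.id_comp _).symm

instance (P : ObjectProperty 𝒜) [P.ContainsZero] [P.IsClosedUnderIsomorphisms]
    [P.IsClosedUnderBinaryProducts] : (boundedIn P).IsTriangulated where
  toIsTriangulatedClosed₂ := .of_isTriangulatedClosed₃

instance : (⊤ : ObjectProperty 𝒜).IsClosedUnderBinaryProducts where
  limitsOfShape_le _ _ := trivial

variable (𝒜) in
/-- The bounded homotopy category `K^b(𝒜)`. -/
abbrev Kb : Type _ := (boundedIn (⊤ : ObjectProperty 𝒜)).FullSubcategory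

variable (𝒜) in
/-- The inclusion `K^b(𝒜) ⥤ K(𝒜)`. -/
abbrev Kb.ι : Kb 𝒜 ⥤ HomotopyCategory 𝒜 (ComplexShape.up ℤ) :=
  (boundedIn (⊤ : ObjectProperty 𝒜)).ι

variable (𝒜) in
/-- The functor `𝒜 ⥤ K^b(𝒜)` sending an object to the complex concentrated in degree `0`. -/
def Kb.single : 𝒜 ⥤ Kb 𝒜 :=
  (boundedIn (⊤ : ObjectProperty 𝒜)).lift (HomotopyCategory.singleFunctor 𝒜 0)
    (fun X => ⟨⟨0, 0, fun i hi => HomologicalComplex.isZero_single_obj_X (ComplexShape.up ℤ) 0 X i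
      (by lia)⟩, fun _ => trivial⟩)

/-- The `𝒞`-acyclic complexes, as objects of the homotopy category. -/
def acyclicIn (𝒞 : ObjectProperty 𝒜) :
    ObjectProperty (HomotopyCategory 𝒜 (ComplexShape.up ℤ)) :=
  fun X => IsHomFromExact 𝒞 X.as

lemma acyclicIn_eq (𝒞 : ObjectProperty 𝒜) : acyclicIn 𝒞 = fun X => ∀ C, 𝒞 C →
    (HomotopyCategory.subcategoryAcyclic AddCommGrpCat.{v}).inverseImage
      ((preadditiveCoyoneda.obj (op C)).mapHomotopyCategory (ComplexShape.up ℤ)) X := by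
  ext X
  obtain ⟨K, rfl⟩ := X.quotient_obj_surjective
  exact forall_congr' fun C => forall_congr' fun _ =>
    (HomotopyCategory.quotient_obj_mem_subcategoryAcyclic_iff_acyclic _).symm

instance (𝒞 : ObjectProperty 𝒜) : (acyclicIn 𝒞).IsClosedUnderIsomorphisms := by
  rw [acyclicIn_eq]
  exact ⟨fun e h C hC => ObjectProperty.prop_of_iso _ e (h C hC)⟩

instance (𝒞 : ObjectProperty 𝒜) : (acyclicIn 𝒞).IsTriangulated := by
  have h : (acyclicIn 𝒞).IsClosedUnderIsomorphisms := inferInstance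
  rw [acyclicIn_eq] at h ⊢
  exact
    { exists_zero := ⟨0, isZero_zero _, fun C _ => ObjectProperty.prop_zero _⟩
      isStableUnderShiftBy := fun n => ⟨fun X hX C hC => ObjectProperty.le_shift _ n _ (hX C hC)⟩
      toIsTriangulatedClosed₂ := .mk' fun T hT h₁ h₃ C hC =>
        ObjectProperty.ext_of_isTriangulatedClosed₂ _ T hT (h₁ C hC) (h₃ C hC) }

/-- The `𝒞`-acyclic complexes in `K^b(𝒜)`. -/
abbrev Kb.acyclic (𝒞 : ObjectProperty 𝒜) : ObjectProperty (Kb 𝒜) :=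
  (acyclicIn 𝒞).inverseImage (Kb.ι 𝒜)

/-- The bounded `𝒞`-derived category, the Verdier quotient of `K^b(𝒜)` by the
`𝒞`-acyclic complexes. -/
abbrev Db (𝒞 : ObjectProperty 𝒜) : Type _ := VerdierQuotient (Kb.acyclic 𝒞)

/-- The quotient functor `K^b(𝒜) ⥤ D^b_𝒞(𝒜)`. -/
abbrev Db.Q (𝒞 : ObjectProperty 𝒜) : Kb 𝒜 ⥤ Db 𝒞 := VerdierQuotient.Q (Kb.acyclic 𝒞)

/-- The strictly full subcategory `K^b(𝒞)` of `K^b(𝒜)`. -/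
abbrev Kb.sub (𝒞 : ObjectProperty 𝒜) : ObjectProperty (Kb 𝒜) :=
  (boundedIn 𝒞).isoClosure.inverseImage (Kb.ι 𝒜)

/-- Maps from bounded complexes in `𝒞` to `𝒞`-acyclic complexes are null-homotopic. -/
lemma nonempty_homotopy_zero {𝒞 : ObjectProperty 𝒜} {K L : CochainComplex 𝒜 ℤ}
    (hK : ∀ i, 𝒞 (K.X i)) {a b : ℤ} (hab : ∀ i : ℤ, i < a ∨ b < i → IsZero (K.X i))
    (hL : IsHomFromExact 𝒞 L) (f : K ⟶ L) : Nonempty (Homotopy f 0) := by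
  rw [isHomFromExact_iff] at hL
  have key (m : ℕ) : ∃ h : ∀ i j : ℤ, K.X i ⟶ L.X j, ∀ i : ℤ, b - m < i →
      f.f i = K.d i (i + 1) ≫ h (i + 1) i + h i (i - 1) ≫ L.d (i - 1) i := by
    induction m with
    | zero => exact ⟨0, fun i hi => (hab i (Or.inr (by simpa using hi))).eq_of_src _ _⟩
    | succ m ih =>
      obtain ⟨h, hh⟩ := ih
      obtain ⟨n, hn⟩ : ∃ n : ℤ, n = b - m := ⟨_, rfl⟩
      obtain ⟨ψ, hψ⟩ := hL (K.X n) (hK n) (n - 1) n (n + 1) (by lia) rfl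
        (f.f n - K.d n (n + 1) ≫ h (n + 1) n) (by
          have h₁ := hh (n + 1) (by lia)
          have h₂ : h (n + 1) (n + 1 - 1) ≫ L.d (n + 1 - 1) (n + 1) =
            h (n + 1) n ≫ L.d n (n + 1) := by
            rw [show n + 1 - 1 = n by lia]
          rw [h₂] at h₁
          rw [Preadditive.sub_comp, Category.assoc, HomologicalComplex.Hom.comm, h₁,
            Preadditive.comp_add, K.d_comp_d_assoc, zero_comp, zero_add, sub_self])
      refine ⟨Function.update h n (Function.update (h n) (n - 1) ψ), fun i hi => ?_⟩
      obtain rfl | hi' := eq_or_ne i n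
      · rw [Function.update_of_ne (by lia), Function.update_self, Function.update_self, hψ]
        abel
      · rw [Function.update_of_ne (by lia), Function.update_of_ne (by lia)]
        exact hh i (by push_cast at hi; lia)
  obtain ⟨h, hh⟩ := key (b - a + 1).toNat
  have hh' (i : ℤ) : f.f i = K.d i (i + 1) ≫ h (i + 1) i + h i (i - 1) ≫ L.d (i - 1) i := by
    by_cases hi : i < a
    · exact (hab i (Or.inl hi)).eq_of_src _ _
    · exact hh i (by lia)
  refine ⟨{ hom := fun i j => if j + 1 = i then h i j else 0, zero := ?_, comm := ?_ }⟩
  · intro i j hij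
    exact if_neg hij
  · intro i
    rw [dNext_eq _ (show (ComplexShape.up ℤ).Rel i (i + 1) from rfl),
      prevD_eq _ (show (ComplexShape.up ℤ).Rel (i - 1) i by simp), if_pos rfl,
      if_pos (by lia), HomologicalComplex.zero_f, add_zero, hh' i]

lemma Kb.sub_le_leftOrthogonal (𝒞 : ObjectProperty 𝒜) :
    Kb.sub 𝒞 ≤ (Kb.acyclic 𝒞).leftOrthogonal := by
  rintro X ⟨Y, ⟨⟨a, b, hab⟩, hY⟩, ⟨e⟩⟩ Z f hZ
  obtain ⟨g, hg⟩ := (HomotopyCategory.quotient _ _).map_surjective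
    (X := Y.as) (Y := Z.obj.as) (e.inv ≫ (Kb.ι 𝒜).map f)
  obtain ⟨h⟩ := nonempty_homotopy_zero hY hab hZ g
  have h0 := HomotopyCategory.eq_of_homotopy _ _ h
  rw [hg, Functor.map_zero] at h0
  apply (Kb.ι 𝒜).map_injective
  rw [Functor.map_zero, ← cancel_epi e.inv, comp_zero]
  exact h0

instance (𝒞 : ObjectProperty 𝒜) : ((Kb.sub 𝒞).ι ⋙ Db.Q 𝒞).Full where
  map_surjective {X Y} f := by
    obtain ⟨g, hg⟩ := (((Kb.sub_le_leftOrthogonal 𝒞) _ X.property).map_bijective_of_isTriangulated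
      (Db.Q 𝒞) Y.obj).2 f
    exact ⟨ObjectProperty.homMk g, hg⟩

/-- `K^b(𝒞)` viewed as a strictly full triangulated subcategory of `D^b_𝒞(𝒜)`. -/
abbrev Db.sub (𝒞 : ObjectProperty 𝒜) [𝒞.ContainsZero] [𝒞.IsClosedUnderIsomorphisms]
    [𝒞.IsClosedUnderBinaryProducts] : ObjectProperty (Db 𝒞) :=
  ((Kb.sub 𝒞).ι ⋙ Db.Q 𝒞).essImage

instance (𝒞 : ObjectProperty 𝒜) [𝒞.ContainsZero] [𝒞.IsClosedUnderIsomorphisms]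
    [𝒞.IsClosedUnderBinaryProducts] : (Db.sub 𝒞).IsTriangulated := by
  have : ((Kb.sub 𝒞).ι ⋙ Db.Q 𝒞).Full := inferInstance
  have : ((Kb.sub 𝒞).ι ⋙ Db.Q 𝒞).IsTriangulated := inferInstance
  exact ObjectProperty.instIsTriangulatedEssImageOfIsTriangulatedOfFull ((Kb.sub 𝒞).ι ⋙ Db.Q 𝒞)

/-- The `𝒞`-singularity category, the Verdier quotient `D^b_𝒞(𝒜) / K^b(𝒞)`. -/
abbrev Dsg (𝒞 : ObjectProperty 𝒜) [𝒞.ContainsZero] [𝒞.IsClosedUnderIsomorphisms]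
    [𝒞.IsClosedUnderBinaryProducts] : Type _ := VerdierQuotient (Db.sub 𝒞)

/-- The quotient functor `D^b_𝒞(𝒜) ⥤ D_{𝒞-sg}(𝒜)`. -/
abbrev Dsg.Q (𝒞 : ObjectProperty 𝒜) [𝒞.ContainsZero] [𝒞.IsClosedUnderIsomorphisms]
    [𝒞.IsClosedUnderBinaryProducts] : Db 𝒞 ⥤ Dsg 𝒞 := VerdierQuotient.Q (Db.sub 𝒞)

/-- The natural functor `θ : 𝒢(𝒞) ⥤ D_{𝒞-sg}(𝒜)`. -/
def theta (𝒞 : ObjectProperty 𝒜) [𝒞.ContainsZero] [𝒞.IsClosedUnderIsomorphisms]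
    [𝒞.IsClosedUnderBinaryProducts] : (gorenstein 𝒞).FullSubcategory ⥤ Dsg 𝒞 :=
  (gorenstein 𝒞).ι ⋙ Kb.single 𝒜 ⋙ Db.Q 𝒞 ⋙ Dsg.Q 𝒞

end Abelian

end RelSing

end

open RelSing

/-! Call a short exact sequence proper if maps from `𝒞` lift along its epimorphism, and coproper if
maps to `𝒞` extend along its monomorphism. Since every module receives an epic right
`𝒞`-approximation, properness is just exactness of all `Hom(C, -)`, and each module has a proper
cover from `𝒞`.

Frobenius structure. A class lies in the Gorenstein category as soon as each of its objects has a
syzygy and a cosyzygy in the class, along proper and coproper sequences (`le_gorenstein`): such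
sequences splice to a totally acyclic complex. A proper sequence ending in a Gorenstein object is
automatically coproper (`isCoproper_of_gorenstein`), a relative `Ext¹(𝒢, 𝒞) = 0`. Horseshoe
arguments then give closure under proper extensions (`gorenstein_of_isProper`), and with it the
exact structure, whose projectives and injectives are both the objects of `𝒞`.

Full faithfulness. In `D^b_𝒞` proper sequences become triangles, modules embed fully faithfully,
there are no maps `M⟦1⟧ ⟶ N` between modules, and Gorenstein objects have no positive extensions by
`𝒞`. Hence a Gorenstein object has no map to a bounded complex over `𝒞` in negative degrees
(`Db.hom_eq_zero_of_gorenstein`). On the other hand a map from a complex in `K^b(𝒞)` to `N⟦1⟧`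
factors through such a complex (`Db.exists_factorization`). So in a left fraction `M ⟶ Y ⟵ N` the
object `Y` can be replaced by one whose cone over `N` lies in negative degrees; then `M ⟶ Y` lifts
to `N`, which makes `θ` full. The same vanishing shows that `Hom(M, N⟦1⟧)` injects into the
singularity category. If `θ` kills `f : X ⟶ Y` and `X ⟶ Q ⟶ N` is a cosyzygy sequence, the extension
obtained by pushing it out along `f` is then zero already in `D^b_𝒞`, so `f` factors through `Q`.
The kernel of `θ` is thus exactly the stable relation (`theta_map_eq_iff`).

Density. The essential image of `θ` is a triangulated subcategory: (co)syzygies give shifts and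
push-outs give cones. A finite proper Gorenstein resolution puts each module into it
(`theta_essImage_single`), and dévissage by degree puts every bounded complex there.

Triangulation. The equivalence transports the triangulation of the singularity category to the
stable category. It is Happel's, because the push-out diagrams that define standard triangles go to
distinguished triangles (`Dsg.distinguished_pushout`), provided the suspension is identified by
minus the connecting morphism. -/

noncomputable section

namespace RelSing


/-! ### Proper short exact sequences: push-outs, pull-backs, compositions -/

section ProperSequences

variable {𝒜 : Type u} [Category.{v} 𝒜] [Abelian 𝒜]

/-- A short exact sequence is `𝒞`-proper if maps from objects of `𝒞` lift along its epimorphism. -/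
structure IsProper (𝒞 : ObjectProperty 𝒜) (S : ShortComplex 𝒜) : Prop where
  shortExact : S.ShortExact
  lift ⦃C : 𝒜⦄ (hC : 𝒞 C) (f : C ⟶ S.X₃) : ∃ g : C ⟶ S.X₂, g ≫ S.g = f

/-- A short complex is `𝒞`-coproper if maps to objects of `𝒞` extend along its first map. -/
def IsCoproper (𝒞 : ObjectProperty 𝒜) (S : ShortComplex 𝒜) : Prop :=
  ∀ ⦃C : 𝒜⦄ (_ : 𝒞 C) (f : S.X₁ ⟶ C), ∃ g : S.X₂ ⟶ C, S.f ≫ g = f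

variable {𝒞 : ObjectProperty 𝒜}

lemma IsProper.of_iso {S T : ShortComplex 𝒜} (e : S ≅ T) (hS : IsProper 𝒞 S) :
    IsProper 𝒞 T where
  shortExact := ShortComplex.shortExact_of_iso e hS.shortExact
  lift C hC f := by
    obtain ⟨g, hg⟩ := hS.lift hC (f ≫ e.inv.τ₃)
    refine ⟨g ≫ e.hom.τ₂, ?_⟩
    rw [Category.assoc, e.hom.comm₂₃, reassoc_of% hg, ← ShortComplex.comp_τ₃, e.inv_hom_id,
      ShortComplex.id_τ₃, Category.comp_id]

lemma IsCoproper.of_iso {S T : ShortComplex 𝒜} (e : S ≅ T) (hS : IsCoproper 𝒞 S) :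
    IsCoproper 𝒞 T := by
  intro C hC f
  obtain ⟨g, hg⟩ := hS hC (e.hom.τ₁ ≫ f)
  refine ⟨e.inv.τ₂ ≫ g, ?_⟩
  rw [← e.inv.comm₁₂_assoc, hg, ← Category.assoc, ← ShortComplex.comp_τ₁, e.inv_hom_id,
    ShortComplex.id_τ₁, Category.id_comp]

lemma IsProper.exists_lift {S : ShortComplex 𝒜} (hS : IsProper 𝒞 S) {T : 𝒜} (f : T ⟶ S.X₂)
    (hf : f ≫ S.g = 0) : ∃ g : T ⟶ S.X₁, g ≫ S.f = f := by
  have := hS.shortExact.mono_f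
  exact ⟨hS.shortExact.exact.lift f hf, hS.shortExact.exact.lift_f _ _⟩

lemma IsProper.exists_desc {S : ShortComplex 𝒜} (hS : IsProper 𝒞 S) {T : 𝒜} (f : S.X₂ ⟶ T)
    (hf : S.f ≫ f = 0) : ∃ g : S.X₃ ⟶ T, S.g ≫ g = f := by
  have := hS.shortExact.epi_g
  exact ⟨hS.shortExact.exact.desc f hf, hS.shortExact.exact.g_desc _ _⟩

lemma exact_of_exists_desc (S : ShortComplex 𝒜) [Epi S.g]
    (h : ∀ ⦃T : 𝒜⦄ (f : S.X₂ ⟶ T), S.f ≫ f = 0 → ∃ g : S.X₃ ⟶ T, S.g ≫ g = f) : S.Exact :=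
  S.exact_of_g_is_cokernel (CokernelCofork.IsColimit.ofπ _ _ (fun f hf => (h f hf).choose)
    (fun f hf => (h f hf).choose_spec)
    (fun f hf m hm => by rw [← cancel_epi S.g, hm, (h f hf).choose_spec]))

lemma exact_of_exists_lift (S : ShortComplex 𝒜) [Mono S.f]
    (h : ∀ ⦃T : 𝒜⦄ (f : T ⟶ S.X₂), f ≫ S.g = 0 → ∃ g : T ⟶ S.X₁, g ≫ S.f = f) : S.Exact :=
  S.exact_of_f_is_kernel (KernelFork.IsLimit.ofι _ _ (fun f hf => (h f hf).choose)
    (fun f hf => (h f hf).choose_spec)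
    (fun f hf m hm => by rw [← cancel_mono S.f, hm, (h f hf).choose_spec]))

/-- The push-out of a proper short exact sequence. -/
lemma IsProper.pushout {X Y Z X' Y' : 𝒜} {i : X ⟶ Y} {p : Y ⟶ Z} {hip : i ≫ p = 0}
    (hS : IsProper 𝒞 (ShortComplex.mk i p hip)) {u : X ⟶ X'} {b : Y ⟶ Y'} {v : X' ⟶ Y'}
    (sq : IsPushout i u b v) {w : Y' ⟶ Z} (hb : b ≫ w = p) (hv : v ≫ w = 0) :
    IsProper 𝒞 (ShortComplex.mk v w hv) := by
  have : Mono i := hS.shortExact.mono_f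
  have : Epi p := hS.shortExact.epi_g
  have : Mono v := (MorphismProperty.monomorphisms 𝒜).of_isPushout sq.flip
    (MorphismProperty.monomorphisms.infer_property i)
  have : Epi w := by
    have : Epi (b ≫ w) := by rwa [hb]
    exact epi_of_epi b w
  refine ⟨.mk' (exact_of_exists_desc _ ?_) ‹_› ‹_›, ?_⟩
  · intro T k hk
    dsimp at k hk ⊢
    obtain ⟨k', hk'⟩ := hS.exists_desc (b ≫ k) (by
      dsimp; rw [← Category.assoc, sq.w, Category.assoc, hk, comp_zero])
    refine ⟨k', sq.hom_ext ?_ ?_⟩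
    · rw [← Category.assoc, hb]; exact hk'
    · rw [← Category.assoc, hv, hk, zero_comp]
  · intro C hC f
    obtain ⟨g, hg⟩ := hS.lift hC f
    exact ⟨g ≫ b, by dsimp at hg ⊢; rw [Category.assoc, hb, hg]⟩

lemma biprod_lift_comp {X Y Z T : 𝒜} (a : X ⟶ Y) (b : X ⟶ Z) (k : Y ⊞ Z ⟶ T) :
    biprod.lift a b ≫ k = a ≫ biprod.inl ≫ k + b ≫ biprod.inr ≫ k := by
  rw [biprod.lift_eq, Preadditive.add_comp, Category.assoc, Category.assoc]

/-- The short exact sequence associated with a push-out of a proper monomorphism. -/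
lemma IsProper.pushout_biprod {X Y Z X' Y' : 𝒜} {i : X ⟶ Y} {p : Y ⟶ Z} {hip : i ≫ p = 0}
    (hS : IsProper 𝒞 (ShortComplex.mk i p hip)) {u : X ⟶ X'} {b : Y ⟶ Y'} {v : X' ⟶ Y'}
    (sq : IsPushout i u b v) {w : Y' ⟶ Z} (hb : b ≫ w = p) (hv : v ≫ w = 0)
    (zero : biprod.lift (-i) u ≫ biprod.desc b v = 0) :
    IsProper 𝒞 (ShortComplex.mk (biprod.lift (-i) u) (biprod.desc b v) zero) := by
  have hT := hS.pushout sq hb hv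
  have : Mono i := hS.shortExact.mono_f
  have : Mono (biprod.lift (-i) u) := by
    have : Mono (biprod.lift (-i) u ≫ biprod.fst) := by rw [biprod.lift_fst]; infer_instance
    exact mono_of_mono _ biprod.fst
  have : Epi (biprod.desc b v) := ⟨fun g h hgh => sq.hom_ext
    (by simpa using biprod.inl ≫= hgh) (by simpa using biprod.inr ≫= hgh)⟩
  refine ⟨.mk' (exact_of_exists_desc _ ?_) ‹_› ‹_›, ?_⟩
  · intro T k hk
    dsimp at k hk ⊢
    have hk' : i ≫ biprod.inl ≫ k = u ≫ biprod.inr ≫ k := by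
      rw [biprod_lift_comp, Preadditive.neg_comp, neg_add_eq_zero] at hk
      exact hk
    exact ⟨sq.desc _ _ hk', by ext <;> simp⟩
  · intro C hC f
    dsimp at f
    -- Lift the image of `f` in `Z` along `p`; the error `f - g ≫ b` dies in `Z`, so it comes from
    -- `X'`.
    obtain ⟨g, hg⟩ := hS.lift hC (f ≫ w)
    obtain ⟨l, hl⟩ := hT.exists_lift (f - g ≫ b) (by
      dsimp at hg ⊢; rw [Preadditive.sub_comp, Category.assoc, hb, hg, sub_self])
    exact ⟨biprod.lift g l, by dsimp at hl ⊢; rw [biprod.lift_desc, hl]; abel⟩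

/-- The pull-back of a proper short exact sequence. -/
lemma IsProper.pullback {X Y Z Y' Z' : 𝒜} {i : X ⟶ Y} {p : Y ⟶ Z} {hip : i ≫ p = 0}
    (hS : IsProper 𝒞 (ShortComplex.mk i p hip)) {z : Z' ⟶ Z} {a : Y' ⟶ Y} {q : Y' ⟶ Z'}
    (sq : IsPullback a q p z) {j : X ⟶ Y'} (ha : j ≫ a = i) (hj : j ≫ q = 0) :
    IsProper 𝒞 (ShortComplex.mk j q hj) := by
  have : Mono i := hS.shortExact.mono_f
  have : Epi p := hS.shortExact.epi_g
  have : Epi q := (MorphismProperty.epimorphisms 𝒜).of_isPullback sq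
    (MorphismProperty.epimorphisms.infer_property p)
  have : Mono j := by
    have : Mono (j ≫ a) := by rwa [ha]
    exact mono_of_mono j a
  refine ⟨.mk' (exact_of_exists_lift _ ?_) ‹_› ‹_›, ?_⟩
  · intro T k hk
    dsimp at k hk ⊢
    obtain ⟨k', hk'⟩ := hS.exists_lift (k ≫ a) (by
      dsimp; rw [Category.assoc, sq.w, reassoc_of% hk, zero_comp])
    refine ⟨k', sq.hom_ext ?_ ?_⟩
    · rw [Category.assoc, ha]; exact hk'
    · rw [Category.assoc, hj, hk, comp_zero]
  · intro C hC f
    obtain ⟨g, hg⟩ := hS.lift hC (f ≫ z)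
    exact ⟨sq.lift g f hg, sq.lift_snd _ _ _⟩

/-- The composition of two proper monomorphisms. -/
lemma IsProper.comp_mono {X Y Z A B : 𝒜} {i : X ⟶ Y} {p : Y ⟶ A} {hip : i ≫ p = 0}
    (hS : IsProper 𝒞 (ShortComplex.mk i p hip)) {j : Y ⟶ Z} {q : Z ⟶ B} {hjq : j ≫ q = 0}
    (hT : IsProper 𝒞 (ShortComplex.mk j q hjq)) :
    ∃ (W : 𝒜) (r : Z ⟶ W) (hr : (i ≫ j) ≫ r = 0) (s : A ⟶ W) (t : W ⟶ B) (hst : s ≫ t = 0),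
      IsProper 𝒞 (ShortComplex.mk (i ≫ j) r hr) ∧ IsProper 𝒞 (ShortComplex.mk s t hst) := by
  -- The cokernel of `i ≫ j` is the push-out of `j` along `p`, which also exhibits it as an
  -- extension of `B` by `A`.
  have sq := IsPushout.of_hasPushout j p
  let t : Limits.pushout j p ⟶ B := pushout.desc q 0 (by rw [hjq, comp_zero])
  have h₁ := hT.pushout sq (w := t) (pushout.inl_desc _ _ _) (pushout.inr_desc _ _ _)
  have : Mono i := hS.shortExact.mono_f
  have : Mono j := hT.shortExact.mono_f
  have : Epi p := hS.shortExact.epi_g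
  have : Epi (pushout.inl j p) := (MorphismProperty.epimorphisms 𝒜).of_isPushout sq
    (MorphismProperty.epimorphisms.infer_property p)
  refine ⟨_, pushout.inl j p, ?_, pushout.inr j p, t, _, ?_, h₁⟩
  · rw [Category.assoc, pushout.condition, reassoc_of% hip, zero_comp]
  · refine ⟨.mk' (exact_of_exists_desc _ ?_) (mono_comp i j) ‹_›, ?_⟩
    · intro T k hk
      dsimp at k hk ⊢
      obtain ⟨k', hk'⟩ := hS.exists_desc (j ≫ k) (by simpa using hk)
      exact ⟨pushout.desc k k' hk'.symm, pushout.inl_desc _ _ _⟩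
    · intro C hC f
      dsimp at f
      obtain ⟨g, hg⟩ := hT.lift hC (f ≫ t)
      obtain ⟨l, hl⟩ := h₁.exists_lift (f - g ≫ pushout.inl j p) (by
        dsimp at hg ⊢; rw [Preadditive.sub_comp, Category.assoc, pushout.inl_desc, hg, sub_self])
      obtain ⟨m, hm⟩ := hS.lift hC l
      dsimp at hl hm
      exact ⟨g + m ≫ j, by
        dsimp
        rw [Preadditive.add_comp, Category.assoc, pushout.condition, reassoc_of% hm, hl]; abel⟩

/-- The composition of two proper epimorphisms. -/
lemma IsProper.comp_epi {X Y Z V W : 𝒜} {i : X ⟶ Y} {p : Y ⟶ Z} {hip : i ≫ p = 0}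
    (hS : IsProper 𝒞 (ShortComplex.mk i p hip)) {j : V ⟶ Z} {q : Z ⟶ W} {hjq : j ≫ q = 0}
    (hT : IsProper 𝒞 (ShortComplex.mk j q hjq)) :
    ∃ (U : 𝒜) (r : U ⟶ Y) (hr : r ≫ p ≫ q = 0) (s : X ⟶ U) (t : U ⟶ V) (hst : s ≫ t = 0),
      IsProper 𝒞 (ShortComplex.mk r (p ≫ q) hr) ∧ IsProper 𝒞 (ShortComplex.mk s t hst) ∧
        s ≫ r = i := by
  -- The kernel of `p ≫ q` is the preimage under `p` of the kernel of `q`.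
  have sq := IsPullback.of_hasPullback p j
  let s : X ⟶ Limits.pullback p j := pullback.lift i 0 (by rw [hip, zero_comp])
  have h₁ := hS.pullback sq (j := s) (pullback.lift_fst _ _ _) (pullback.lift_snd _ _ _)
  have : Mono j := hT.shortExact.mono_f
  have : Epi q := hT.shortExact.epi_g
  have : Epi p := hS.shortExact.epi_g
  have : Mono (pullback.fst p j) := (MorphismProperty.monomorphisms 𝒜).of_isPullback sq.flip
    (MorphismProperty.monomorphisms.infer_property j)
  refine ⟨_, pullback.fst p j, ?_, s, pullback.snd p j, _, ?_, h₁, pullback.lift_fst _ _ _⟩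
  · rw [← Category.assoc, pullback.condition, Category.assoc, hjq, comp_zero]
  · refine ⟨.mk' (exact_of_exists_lift _ ?_) ‹_› (epi_comp p q), ?_⟩
    · intro T k hk
      dsimp at k hk ⊢
      obtain ⟨k', hk'⟩ := hT.exists_lift (k ≫ p) (by simpa using hk)
      exact ⟨pullback.lift k k' hk'.symm, pullback.lift_fst _ _ _⟩
    · intro C hC f
      obtain ⟨g, hg⟩ := hT.lift hC f
      obtain ⟨l, hl⟩ := hS.lift hC g
      exact ⟨l, by dsimp at hg hl ⊢; rw [reassoc_of% hl, hg]⟩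

lemma isProper_biprod_map_left {X Y Z : 𝒜} (W : 𝒜) {i : X ⟶ Y} {p : Y ⟶ Z} {hip : i ≫ p = 0}
    (hS : IsProper 𝒞 (ShortComplex.mk i p hip)) :
    IsProper 𝒞 (ShortComplex.mk (biprod.map (𝟙 W) i) (biprod.snd ≫ p) (by simp [hip])) := by
  have : Mono i := hS.shortExact.mono_f
  have : Epi p := hS.shortExact.epi_g
  refine ⟨.mk' (exact_of_exists_lift _ ?_) (by dsimp; infer_instance)
    (by dsimp; exact epi_comp _ _), ?_⟩
  · intro T k hk
    dsimp at k hk ⊢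
    obtain ⟨k', hk'⟩ := hS.exists_lift (k ≫ biprod.snd) (by simpa using hk)
    exact ⟨biprod.lift (k ≫ biprod.fst) k', by dsimp at hk'; ext <;> simp [hk']⟩
  · intro C hC f
    obtain ⟨g, hg⟩ := hS.lift hC f
    exact ⟨g ≫ biprod.inr, by dsimp at hg ⊢; simp [hg]⟩

lemma isProper_biprod_map_right {X Y Z : 𝒜} (W : 𝒜) {i : X ⟶ Y} {p : Y ⟶ Z} {hip : i ≫ p = 0}
    (hS : IsProper 𝒞 (ShortComplex.mk i p hip)) :
    IsProper 𝒞 (ShortComplex.mk (i ≫ biprod.inl) (biprod.map p (𝟙 W)) (by simp [reassoc_of% hip])) := by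
  have : Mono i := hS.shortExact.mono_f
  have : Epi p := hS.shortExact.epi_g
  refine ⟨.mk' (exact_of_exists_lift _ ?_) (by dsimp; exact mono_comp _ _)
    (by dsimp; infer_instance), ?_⟩
  · intro T k hk
    dsimp at k hk ⊢
    obtain ⟨k', hk'⟩ := hS.exists_lift (k ≫ biprod.fst) (by simpa using hk =≫ biprod.fst)
    have := hk =≫ biprod.snd
    refine ⟨k', ?_⟩
    dsimp at hk'
    ext
    · simp [hk']
    · simpa using this.symm
  · intro C hC f
    dsimp at f
    obtain ⟨g, hg⟩ := hS.lift hC (f ≫ biprod.fst)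
    exact ⟨biprod.lift g (f ≫ biprod.snd), by dsimp at hg ⊢; ext <;> simp [hg]⟩

lemma isProper_of_splitting {S : ShortComplex 𝒜} (s : S.Splitting) : IsProper 𝒞 S where
  shortExact := s.shortExact
  lift C _ f := ⟨f ≫ s.s, by simp⟩

end ProperSequences


/-! ### Relative exactness and the Gorenstein category -/

section Gorenstein

variable {𝒜 : Type u} [Category.{v} 𝒜] {𝒞 : ObjectProperty 𝒜}

lemma exists_epi_of_admissible (hfin : IsContravariantlyFinite 𝒞) (hadm : IsAdmissible 𝒞) (M : 𝒜) :
    ∃ (C : 𝒜) (f : C ⟶ M), 𝒞 C ∧ Epi f ∧ ∀ ⦃C' : 𝒜⦄ (_ : 𝒞 C') (g : C' ⟶ M),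
      ∃ h : C' ⟶ C, h ≫ f = g := by
  obtain ⟨C, f, hf⟩ := hfin M
  exact ⟨C, f, hf.1, hadm f hf, hf.2⟩

variable [Abelian 𝒜]

/-- Every object is the end of a proper short exact sequence with middle term in `𝒞`. -/
lemma exists_isProper (hfin : IsContravariantlyFinite 𝒞) (hadm : IsAdmissible 𝒞) (M : 𝒜) :
    ∃ (K C : 𝒜) (i : K ⟶ C) (p : C ⟶ M) (h : i ≫ p = 0), 𝒞 C ∧
      IsProper 𝒞 (ShortComplex.mk i p h) := by
  obtain ⟨C, p, hC, hp, hp'⟩ := exists_epi_of_admissible hfin hadm M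
  exact ⟨_, C, kernel.ι p, p, kernel.condition p, hC,
    .mk' (ShortComplex.exact_of_f_is_kernel _ (kernelIsKernel p)) inferInstance hp, hp'⟩

/-- Cover the kernel of a differential by an epimorphism from `𝒞`; relative exactness lifts it to
the preceding term, so the preceding term surjects onto the kernel. -/
lemma IsHomFromExact.acyclic (hfin : IsContravariantlyFinite 𝒞) (hadm : IsAdmissible 𝒞)
    {K : CochainComplex 𝒜 ℤ} (hK : IsHomFromExact 𝒞 K) : K.Acyclic := by
  rw [isHomFromExact_iff] at hK
  intro j
  rw [HomologicalComplex.exactAt_iff' _ (j - 1) j (j + 1) (by simp) (by simp),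
    ShortComplex.exact_iff_epi_kernel_lift]
  obtain ⟨C, f, hC, hf, -⟩ := exists_epi_of_admissible hfin hadm (kernel (K.d j (j + 1)))
  obtain ⟨g, hg⟩ := hK C hC (j - 1) j (j + 1) (by lia) rfl (f ≫ kernel.ι _) (by simp)
  have hg' : g ≫ kernel.lift (K.d j (j + 1)) (K.d (j - 1) j) (K.d_comp_d _ _ _) = f := by
    rw [← cancel_mono (kernel.ι _), Category.assoc, kernel.lift_ι, hg]
  exact @epi_of_epi_fac _ _ _ _ _ _ _ _ hf hg'

/-- Objects of `𝒞` cover everything, so testing with them detects monomorphisms, epimorphisms and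
exactness in the ambient category. -/
lemma isProper_iff_shortExact_map (hfin : IsContravariantlyFinite 𝒞) (hadm : IsAdmissible 𝒞)
    (S : ShortComplex 𝒜) : IsProper 𝒞 S ↔
      ∀ C : 𝒜, 𝒞 C → (S.map (preadditiveCoyoneda.obj (op C))).ShortExact := by
  constructor
  · intro hS C hC
    have := hS.shortExact.mono_f
    refine .mk' ?_ ?_ ?_
    · rw [ShortComplex.ab_exact_iff]
      exact fun f hf => hS.exists_lift f hf
    · rw [AddCommGrpCat.mono_iff_injective]
      exact fun f g h => (cancel_mono S.f).1 h
    · rw [AddCommGrpCat.epi_iff_surjective]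
      exact fun f => hS.lift hC f
  · intro h
    have hlift ⦃C : 𝒜⦄ (hC : 𝒞 C) (f : C ⟶ S.X₃) : ∃ g : C ⟶ S.X₂, g ≫ S.g = f :=
      (AddCommGrpCat.epi_iff_surjective _).1 (h C hC).epi_g f
    refine ⟨.mk' ?_ ?_ ?_, hlift⟩
    · rw [ShortComplex.exact_iff_epi_kernel_lift]
      obtain ⟨C, f, hC, hf, -⟩ := exists_epi_of_admissible hfin hadm (kernel S.g)
      obtain ⟨g, hg⟩ : ∃ g : C ⟶ S.X₁, g ≫ S.f = f ≫ kernel.ι _ :=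
        (ShortComplex.ab_exact_iff _).1 (h C hC).exact (f ≫ kernel.ι S.g) (by
          change (f ≫ kernel.ι S.g) ≫ S.g = 0
          simp)
      have hg' : g ≫ kernel.lift S.g S.f S.zero = f := by
        rw [← cancel_mono (kernel.ι _), Category.assoc, kernel.lift_ι, hg]
      exact epi_of_epi_fac hg'
    · refine Preadditive.mono_of_cancel_zero _ fun {T} k hk => ?_
      obtain ⟨C, f, hC, hf, -⟩ := exists_epi_of_admissible hfin hadm T
      rw [← cancel_epi f, comp_zero]
      apply (AddCommGrpCat.mono_iff_injective _).1 (h C hC).mono_f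
      change (f ≫ k) ≫ S.f = 0 ≫ S.f
      rw [Category.assoc, hk, comp_zero, zero_comp]
    · obtain ⟨C, f, hC, hf, -⟩ := exists_epi_of_admissible hfin hadm S.X₃
      obtain ⟨g, hg⟩ := hlift hC f
      exact epi_of_epi_fac hg

lemma gorensteinConflations_iff (hfin : IsContravariantlyFinite 𝒞) (hadm : IsAdmissible 𝒞)
    (S : ShortComplex (gorenstein 𝒞).FullSubcategory) :
    gorensteinConflations 𝒞 S ↔ IsProper 𝒞 (S.map (gorenstein 𝒞).ι) :=
  (isProper_iff_shortExact_map hfin hadm _).symm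

/-- Splicing a `ℤ`-indexed family of proper and coproper short exact sequences with middle terms
in `𝒞`. -/
lemma gorenstein_of_family (hfin : IsContravariantlyFinite 𝒞) (hadm : IsAdmissible 𝒞)
    (S : ℤ → ShortComplex 𝒜) (e : ∀ i, (S i).X₃ ≅ (S (i + 1)).X₁) (hS : ∀ i, 𝒞 (S i).X₂)
    (hp : ∀ i, IsProper 𝒞 (S i)) (hc : ∀ i, IsCoproper 𝒞 (S i)) (i : ℤ) (hi : i + 1 = 0) :
    gorenstein 𝒞 (S i).X₃ := by
  have hm (i) : Mono (S i).f := (hp i).shortExact.mono_f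
  have he (i) : Epi (S i).g := (hp i).shortExact.epi_g
  let K : CochainComplex 𝒜 ℤ := CochainComplex.of (fun i => (S i).X₂)
    (fun i => (S i).g ≫ (e i).hom ≫ (S (i + 1)).f) (fun i => by simp)
  have hd (i : ℤ) : K.d i (i + 1) = (S i).g ≫ (e i).hom ≫ (S (i + 1)).f :=
    CochainComplex.of_d (fun i => (S i).X₂) (fun i => (S i).g ≫ (e i).hom ≫ (S (i + 1)).f) i
  have h₁ : IsHomFromExact 𝒞 K := by
    rw [isHomFromExact_iff]
    rintro C hC i _ _ rfl rfl f hf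
    rw [hd, ← Category.assoc, ← Category.assoc] at hf
    replace hf := zero_of_comp_mono _ hf
    replace hf := zero_of_comp_mono _ hf
    obtain ⟨g, hg⟩ := (hp (i + 1)).exists_lift f hf
    obtain ⟨l, hl⟩ := (hp i).lift hC (g ≫ (e i).inv)
    exact ⟨l, by rw [hd, reassoc_of% hl, Iso.inv_hom_id_assoc, hg]⟩
  have h₂ : IsHomToExact 𝒞 K := by
    rw [isHomToExact_iff]
    rintro C hC i _ _ rfl rfl f hf
    rw [hd, Category.assoc, Category.assoc] at hf
    replace hf := zero_of_epi_comp _ hf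
    replace hf := zero_of_epi_comp _ hf
    obtain ⟨g, hg⟩ := (hp (i + 1)).exists_desc f hf
    obtain ⟨l, hl⟩ := hc (i + 1 + 1) hC ((e (i + 1)).inv ≫ g)
    exact ⟨l, by rw [hd, Category.assoc, Category.assoc, hl, Iso.hom_inv_id_assoc, hg]⟩
  -- The differential from degree `-1` to degree `0` factors as an epimorphism onto `(S (-1)).X₃`
  -- followed by a monomorphism, so this object is its image.
  obtain rfl : i = -1 := by lia
  refine ⟨K, hS, h₁.acyclic hfin hadm, h₁, h₂, ⟨?_⟩⟩
  have : StrongEpi (S (-1)).g := strongEpi_of_epi _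
  exact image.isoStrongEpiMono (S (-1)).g ((e (-1)).hom ≫ (S (-1 + 1)).f) (hd (-1)).symm

/-- `M` is a quotient of an object of `𝒞` with kernel in `𝒳`, via a proper and coproper sequence. -/
def HasSyzygyIn (𝒞 𝒳 : ObjectProperty 𝒜) (M : 𝒜) : Prop :=
  ∃ S : ShortComplex 𝒜, 𝒳 S.X₁ ∧ 𝒞 S.X₂ ∧ Nonempty (S.X₃ ≅ M) ∧ IsProper 𝒞 S ∧ IsCoproper 𝒞 S

/-- `M` embeds into an object of `𝒞` with cokernel in `𝒳`, via a proper and coproper sequence. -/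
def HasCosyzygyIn (𝒞 𝒳 : ObjectProperty 𝒜) (M : 𝒜) : Prop :=
  ∃ S : ShortComplex 𝒜, Nonempty (S.X₁ ≅ M) ∧ 𝒞 S.X₂ ∧ 𝒳 S.X₃ ∧ IsProper 𝒞 S ∧ IsCoproper 𝒞 S

/-- A class of objects which is closed under taking suitable syzygies and cosyzygies is contained
in the Gorenstein category. -/
lemma le_gorenstein (hfin : IsContravariantlyFinite 𝒞) (hadm : IsAdmissible 𝒞)
    (𝒳 : ObjectProperty 𝒜) (hl : ∀ M, 𝒳 M → HasSyzygyIn 𝒞 𝒳 M)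
    (hr : ∀ M, 𝒳 M → HasCosyzygyIn 𝒞 𝒳 M) : 𝒳 ≤ gorenstein 𝒞 := by
  intro M hM
  choose! L hL₁ hL₂ hL₃ hLp hLc using hl
  choose! R hR₁ hR₂ hR₃ hRp hRc using hr
  let MR : ℕ → 𝒜 := fun n => Nat.rec M (fun _ N => (R N).X₃) n
  let ML : ℕ → 𝒜 := fun n => Nat.rec M (fun _ N => (L N).X₁) n
  have hMR (n : ℕ) : 𝒳 (MR n) := by
    induction n with
    | zero => exact hM
    | succ n ih => exact hR₃ _ ih
  have hML (n : ℕ) : 𝒳 (ML n) := by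
    induction n with
    | zero => exact hM
    | succ n ih => exact hL₁ _ ih
  -- Cosyzygy sequences sit at the indices `≥ 0` and syzygy sequences at the negative ones, so `M`
  -- is the third term at `-1` and the first term at `0`.
  let S : ℤ → ShortComplex 𝒜
    | .ofNat n => R (MR n)
    | .negSucc n => L (ML n)
  have e : ∀ i, Nonempty ((S i).X₃ ≅ (S (i + 1)).X₁)
    | .ofNat n => ⟨((hR₁ _ (hMR (n + 1))).some).symm⟩
    | .negSucc 0 => ⟨(hL₃ _ hM).some ≪≫ (hR₁ _ hM).some.symm⟩
    | .negSucc (n + 1) => ⟨(hL₃ _ (hML (n + 1))).some⟩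
  refine (gorenstein 𝒞).prop_of_iso (hL₃ _ hM).some
    (gorenstein_of_family hfin hadm S (fun i => (e i).some) ?_ ?_ ?_ (.negSucc 0) rfl)
  · rintro (n | n)
    exacts [hR₂ _ (hMR n), hL₂ _ (hML n)]
  · rintro (n | n)
    exacts [hRp _ (hMR n), hLp _ (hML n)]
  · rintro (n | n)
    exacts [hRc _ (hMR n), hLc _ (hML n)]

/-- The images of the differentials of totally `𝒞`-acyclic complexes. -/
def IsTotallyAcyclicImage (𝒞 : ObjectProperty 𝒜) : ObjectProperty 𝒜 := fun M =>
  ∃ K : CochainComplex 𝒜 ℤ, (∀ i, 𝒞 (K.X i)) ∧ K.Acyclic ∧ IsHomFromExact 𝒞 K ∧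
    IsHomToExact 𝒞 K ∧ ∃ i j : ℤ, i + 1 = j ∧ Nonempty (image (K.d i j) ≅ M)

/-- A map from `𝒞` to the image of `K.d j k`, viewed in `K.X k`, is a cocycle; relative exactness at
`k` lifts it to `K.X j`. Exactness of the sequence is exactness of `K` at `j`. -/
lemma isProper_image {K : CochainComplex 𝒜 ℤ} (hK : K.Acyclic) (hK' : IsHomFromExact 𝒞 K)
    {i j k : ℤ} (hij : i + 1 = j) (hjk : j + 1 = k) :
    ∃ h : image.ι (K.d i j) ≫ factorThruImage (K.d j k) = 0,
      IsProper 𝒞 (ShortComplex.mk _ _ h) := by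
  have h : image.ι (K.d i j) ≫ factorThruImage (K.d j k) = 0 := by
    rw [← cancel_epi (factorThruImage (K.d i j)), ← cancel_mono (image.ι (K.d j k))]
    simp
  rw [isHomFromExact_iff] at hK'
  refine ⟨h, .mk' ?_ (by dsimp; infer_instance) (by dsimp; infer_instance), ?_⟩
  · let φ : ShortComplex.mk (K.d i j) (factorThruImage (K.d j k)) (by
        rw [← cancel_mono (image.ι (K.d j k))]; simp) ⟶ ShortComplex.mk _ _ h :=
      { τ₁ := factorThruImage (K.d i j), τ₂ := 𝟙 _, τ₃ := 𝟙 _ }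
    have : Epi φ.τ₁ := by dsimp [φ]; infer_instance
    have : IsIso φ.τ₂ := by dsimp [φ]; infer_instance
    have : Mono φ.τ₃ := by dsimp [φ]; infer_instance
    rw [← ShortComplex.exact_iff_of_epi_of_isIso_of_mono φ]
    let ψ : ShortComplex.mk (K.d i j) (factorThruImage (K.d j k)) (by
        rw [← cancel_mono (image.ι (K.d j k))]; simp) ⟶
        ShortComplex.mk (K.d i j) (K.d j k) (K.d_comp_d _ _ _) :=
      { τ₁ := 𝟙 _, τ₂ := 𝟙 _, τ₃ := image.ι _ }
    have : Epi ψ.τ₁ := by dsimp [ψ]; infer_instance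
    have : IsIso ψ.τ₂ := by dsimp [ψ]; infer_instance
    have : Mono ψ.τ₃ := by dsimp [ψ]; infer_instance
    rw [ShortComplex.exact_iff_of_epi_of_isIso_of_mono ψ]
    exact (HomologicalComplex.exactAt_iff' _ i j k (by simp; lia) (by simp; lia)).1 (hK j)
  · intro C hC f
    dsimp at f
    obtain ⟨g, hg⟩ := hK' C hC j k (k + 1) hjk rfl (f ≫ image.ι _) (by
      have : image.ι (K.d j k) ≫ K.d k (k + 1) = 0 := by
        rw [← cancel_epi (factorThruImage (K.d j k))]
        simp
      rw [Category.assoc, this, comp_zero])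
    exact ⟨g, by dsimp; rw [← cancel_mono (image.ι _), Category.assoc, image.fac, hg]⟩

/-- Precomposing with the epimorphism from `K.X i` turns a map on the image into a map killed by the
previous differential, which `Hom(-, 𝒞)`-exactness at `i` extends to `K.X j`. -/
lemma isCoproper_image {K : CochainComplex 𝒜 ℤ} (hK : IsHomToExact 𝒞 K)
    {i j k : ℤ} (hij : i + 1 = j)
    (h : image.ι (K.d i j) ≫ factorThruImage (K.d j k) = 0) :
    IsCoproper 𝒞 (ShortComplex.mk _ _ h) := by
  rw [isHomToExact_iff] at hK
  intro C hC f
  dsimp at f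
  obtain ⟨g, hg⟩ := hK C hC (i - 1) i j (by lia) hij (factorThruImage (K.d i j) ≫ f) (by
    have : K.d (i - 1) i ≫ factorThruImage (K.d i j) = 0 := by
      rw [← cancel_mono (image.ι (K.d i j))]
      simp
    rw [reassoc_of% this, zero_comp])
  refine ⟨g, ?_⟩
  dsimp
  rw [← cancel_epi (factorThruImage (K.d i j)), image.fac_assoc, hg]

lemma IsTotallyAcyclicImage.hasSyzygyIn {M : 𝒜} (hM : IsTotallyAcyclicImage 𝒞 M) :
    HasSyzygyIn 𝒞 (IsTotallyAcyclicImage 𝒞) M := by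
  obtain ⟨K, h₁, h₂, h₃, h₄, i, j, hij, e⟩ := hM
  obtain ⟨h, hp⟩ := isProper_image h₂ h₃ (show i - 1 + 1 = i by lia) hij
  exact ⟨_, ⟨K, h₁, h₂, h₃, h₄, i - 1, i, by lia, ⟨Iso.refl _⟩⟩, h₁ _, e, hp,
    isCoproper_image h₄ (by lia) h⟩

lemma IsTotallyAcyclicImage.hasCosyzygyIn {M : 𝒜} (hM : IsTotallyAcyclicImage 𝒞 M) :
    HasCosyzygyIn 𝒞 (IsTotallyAcyclicImage 𝒞) M := by
  obtain ⟨K, h₁, h₂, h₃, h₄, i, j, hij, e⟩ := hM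
  obtain ⟨h, hp⟩ := isProper_image h₂ h₃ hij (show j + 1 = j + 1 from rfl)
  exact ⟨_, e, h₁ _, ⟨K, h₁, h₂, h₃, h₄, j, j + 1, by lia, ⟨Iso.refl _⟩⟩, hp,
    isCoproper_image h₄ hij h⟩

/-- Frees the definition from the fixed degrees `-1` and `0`, so that neighbouring images of the
same complex serve as syzygies and cosyzygies. -/
lemma gorenstein_eq (hfin : IsContravariantlyFinite 𝒞) (hadm : IsAdmissible 𝒞) :
    gorenstein 𝒞 = IsTotallyAcyclicImage 𝒞 := by
  refine le_antisymm ?_ (le_gorenstein hfin hadm _ (fun _ h => h.hasSyzygyIn)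
    (fun _ h => h.hasCosyzygyIn))
  rintro M ⟨K, h₁, h₂, h₃, h₄, ⟨e⟩⟩
  exact ⟨K, h₁, h₂, h₃, h₄, -1, 0, rfl, ⟨e.symm⟩⟩

lemma HasSyzygyIn.exists_eq {𝒳 : ObjectProperty 𝒜} {M : 𝒜} (h : HasSyzygyIn 𝒞 𝒳 M) :
    ∃ (K P : 𝒜) (i : K ⟶ P) (p : P ⟶ M) (h : i ≫ p = 0), 𝒳 K ∧ 𝒞 P ∧
      IsProper 𝒞 (ShortComplex.mk i p h) ∧ IsCoproper 𝒞 (ShortComplex.mk i p h) := by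
  obtain ⟨S, h₁, h₂, ⟨e⟩, hp, hc⟩ := h
  let e' : S ≅ ShortComplex.mk S.f (S.g ≫ e.hom) (by simp) :=
    ShortComplex.isoMk (Iso.refl _) (Iso.refl _) e
  exact ⟨_, _, S.f, S.g ≫ e.hom, by simp, h₁, h₂, hp.of_iso e', hc.of_iso e'⟩

lemma HasCosyzygyIn.exists_eq {𝒳 : ObjectProperty 𝒜} {M : 𝒜} (h : HasCosyzygyIn 𝒞 𝒳 M) :
    ∃ (Q N : 𝒜) (i : M ⟶ Q) (p : Q ⟶ N) (h : i ≫ p = 0), 𝒞 Q ∧ 𝒳 N ∧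
      IsProper 𝒞 (ShortComplex.mk i p h) ∧ IsCoproper 𝒞 (ShortComplex.mk i p h) := by
  obtain ⟨S, ⟨e⟩, h₁, h₂, hp, hc⟩ := h
  let e' : S ≅ ShortComplex.mk (e.inv ≫ S.f) S.g (by simp) :=
    ShortComplex.isoMk e (Iso.refl _) (Iso.refl _)
  exact ⟨_, _, e.inv ≫ S.f, S.g, by simp, h₁, h₂, hp.of_iso e', hc.of_iso e'⟩

lemma gorenstein_exists_syzygy (hfin : IsContravariantlyFinite 𝒞) (hadm : IsAdmissible 𝒞)
    {M : 𝒜} (hM : gorenstein 𝒞 M) :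
    ∃ (K P : 𝒜) (i : K ⟶ P) (p : P ⟶ M) (h : i ≫ p = 0), gorenstein 𝒞 K ∧ 𝒞 P ∧
      IsProper 𝒞 (ShortComplex.mk i p h) ∧ IsCoproper 𝒞 (ShortComplex.mk i p h) := by
  rw [gorenstein_eq hfin hadm] at hM ⊢
  exact hM.hasSyzygyIn.exists_eq

lemma gorenstein_exists_cosyzygy (hfin : IsContravariantlyFinite 𝒞) (hadm : IsAdmissible 𝒞)
    {M : 𝒜} (hM : gorenstein 𝒞 M) :
    ∃ (Q N : 𝒜) (i : M ⟶ Q) (p : Q ⟶ N) (h : i ≫ p = 0), 𝒞 Q ∧ gorenstein 𝒞 N ∧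
      IsProper 𝒞 (ShortComplex.mk i p h) ∧ IsCoproper 𝒞 (ShortComplex.mk i p h) := by
  rw [gorenstein_eq hfin hadm] at hM ⊢
  exact hM.hasCosyzygyIn.exists_eq

/-- Every proper short exact sequence ending in an object of the Gorenstein category is
coproper. -/
lemma isCoproper_of_gorenstein (hfin : IsContravariantlyFinite 𝒞) (hadm : IsAdmissible 𝒞)
    {S : ShortComplex 𝒜} (hS : IsProper 𝒞 S) (h₃ : gorenstein 𝒞 S.X₃) : IsCoproper 𝒞 S := by
  obtain ⟨K, P, i, p, h, -, hP, hp, hc⟩ := gorenstein_exists_syzygy hfin hadm h₃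
  -- Compare with the syzygy sequence of `S.X₃`: `P` is in `𝒞`, so `p` lifts to `l`, and this
  -- induces `m` on kernels. The sequence `S` is then the push-out of the syzygy sequence along `m`,
  -- and the extension property passes to push-outs.
  obtain ⟨l, hl⟩ := hS.lift hP p
  obtain ⟨m, hm⟩ := hS.exists_lift (i ≫ l) (by rw [Category.assoc, hl, h])
  intro C hC f
  obtain ⟨g, hg⟩ := hc hC (m ≫ f)
  dsimp at g hg
  have := hp.shortExact.epi_g
  have := hS.shortExact.mono_f
  let q : S.X₁ ⊞ P ⟶ S.X₂ := biprod.desc S.f l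
  have hq : Epi q := by
    refine Preadditive.epi_of_cancel_zero _ fun {T} k hk => ?_
    have h₁ : S.f ≫ k = 0 := by simpa [q] using biprod.inl ≫= hk
    have h₂ : l ≫ k = 0 := by simpa [q] using biprod.inr ≫= hk
    obtain ⟨k', rfl⟩ := hS.exists_desc k h₁
    have : p ≫ k' = 0 := by rw [← hl, Category.assoc, h₂]
    rw [zero_of_epi_comp p this, comp_zero]
  -- The kernel of `q` consists of the pairs `(-m n, i n)` with `n` in `K`, on which `f` and `g`
  -- cancel because `i ≫ g = m ≫ f`.
  have hker : kernel.ι q ≫ biprod.desc f g = 0 := by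
    have h₁ : kernel.ι q ≫ biprod.fst ≫ S.f + kernel.ι q ≫ biprod.snd ≫ l = 0 := by
      rw [← kernel.condition q, ← Preadditive.comp_add]
      congr 1
      ext <;> simp [q]
    have h₂ : (kernel.ι q ≫ biprod.snd) ≫ p = 0 := by
      have := h₁ =≫ S.g
      rw [Preadditive.add_comp] at this
      simpa [hl] using this
    obtain ⟨n, hn⟩ := hp.exists_lift _ h₂
    dsimp at n hn
    have h₃ : kernel.ι q ≫ biprod.fst = - n ≫ m := by
      rw [← cancel_mono S.f, Preadditive.neg_comp, Category.assoc, Category.assoc, hm,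
        reassoc_of% hn, eq_neg_iff_add_eq_zero, h₁]
    have h₄ : biprod.desc f g = biprod.fst ≫ f + biprod.snd ≫ g := by ext <;> simp
    rw [h₄, Preadditive.comp_add, reassoc_of% h₃, ← reassoc_of% hn, hg]
    simp
  refine ⟨(Abelian.epiDesc q _ hker), ?_⟩
  have h₅ : S.f = biprod.inl ≫ q := by simp [q]
  rw [h₅, Category.assoc, Abelian.comp_epiDesc, biprod.inl_desc]

end Gorenstein


/-! ### Closure of the Gorenstein category under proper extensions -/

section Extensions

variable {𝒜 : Type u} [Category.{v} 𝒜] [Abelian 𝒜] {𝒞 : ObjectProperty 𝒜}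

/-- A short complex which splits identifies its middle term with a biproduct. -/
def biprodIsoOfSplitting {S : ShortComplex 𝒜} (s : S.Splitting) : S.X₂ ≅ S.X₁ ⊞ S.X₃ where
  hom := biprod.lift s.r S.g
  inv := biprod.desc S.f s.s
  hom_inv_id := by rw [biprod.lift_desc, s.id]
  inv_hom_id := by ext <;> simp

lemma IsProper.comp_iso {X Y Z Z' : 𝒜} {i : X ⟶ Y} {p : Y ⟶ Z} {hip : i ≫ p = 0}
    (hS : IsProper 𝒞 (ShortComplex.mk i p hip)) (e : Z ≅ Z') :
    IsProper 𝒞 (ShortComplex.mk i (p ≫ e.hom) (by rw [reassoc_of% hip, zero_comp])) :=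
  IsProper.of_iso (S := ShortComplex.mk i p hip) (ShortComplex.isoMk (Iso.refl _) (Iso.refl _) e (by simp) (by simp)) hS

lemma IsProper.iso_comp {X X' Y Z : 𝒜} {i : X ⟶ Y} {p : Y ⟶ Z} {hip : i ≫ p = 0}
    (hS : IsProper 𝒞 (ShortComplex.mk i p hip)) (e : X' ≅ X) :
    IsProper 𝒞 (ShortComplex.mk (e.hom ≫ i) p (by rw [Category.assoc, hip, comp_zero])) :=
  IsProper.of_iso (S := ShortComplex.mk i p hip)
    (ShortComplex.isoMk e.symm (Iso.refl _) (Iso.refl _) (by simp) (by simp)) hS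

/-- Extensions of objects of the Gorenstein category by proper short exact sequences. -/
def IsGorensteinExtension (𝒞 : ObjectProperty 𝒜) : ObjectProperty 𝒜 := fun M =>
  ∃ (L N : 𝒜) (f : L ⟶ M) (g : M ⟶ N) (h : f ≫ g = 0), gorenstein 𝒞 L ∧ gorenstein 𝒞 N ∧
    IsProper 𝒞 (ShortComplex.mk f g h)

/-- Let `U` be the preimage of `L` in `B`. A map from `A` to `𝒞` extends first over `U`, since `U /
A` is `L`, and then over `B`, since `B / U` is `N`. -/
lemma isCoproper_of_isGorensteinExtension (hfin : IsContravariantlyFinite 𝒞)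
    (hadm : IsAdmissible 𝒞) {A B M : 𝒜} {i : A ⟶ B} {p : B ⟶ M} {hip : i ≫ p = 0}
    (hS : IsProper 𝒞 (ShortComplex.mk i p hip)) (hM : IsGorensteinExtension 𝒞 M) :
    IsCoproper 𝒞 (ShortComplex.mk i p hip) := by
  obtain ⟨L, N, f, g, h, hL, hN, hM⟩ := hM
  obtain ⟨U, r, hr, s, t, hst, h₁, h₂, fac⟩ := hS.comp_epi hM
  intro C hC a
  obtain ⟨b, hb⟩ := isCoproper_of_gorenstein hfin hadm h₂ hL hC a
  obtain ⟨c, hc⟩ := isCoproper_of_gorenstein hfin hadm h₁ hN hC b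
  dsimp at hb hc ⊢
  exact ⟨c, by rw [← fac, Category.assoc, hc, hb]⟩

/-- Horseshoe: the pull-back of `M` along `P₂ ⟶ N` is an extension of `P₂` by `L`, split because
`P₂` is in `𝒞`. Covering its summand `L` by `P₁` gives `P₁ ⊞ P₂ ⟶ M`, whose kernel is an extension
of `K₂` by `K₁`. -/
lemma IsGorensteinExtension.hasSyzygyIn [𝒞.IsClosedUnderBinaryProducts]
    (hfin : IsContravariantlyFinite 𝒞) (hadm : IsAdmissible 𝒞) {M : 𝒜}
    (hM : IsGorensteinExtension 𝒞 M) : HasSyzygyIn 𝒞 (IsGorensteinExtension 𝒞) M := by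
  obtain ⟨L, N, f, g, h, hL, hN, hS⟩ := id hM
  obtain ⟨K₁, P₁, i₁, p₁, z₁, hK₁, hP₁, h₁, -⟩ := gorenstein_exists_syzygy hfin hadm hL
  obtain ⟨K₂, P₂, i₂, p₂, z₂, hK₂, hP₂, h₂, -⟩ := gorenstein_exists_syzygy hfin hadm hN
  have sq := IsPullback.of_hasPullback g p₂
  have hE := hS.pullback sq (j := pullback.lift f 0 (by rw [h, zero_comp]))
    (pullback.lift_fst _ _ _) (pullback.lift_snd _ _ _)
  have hE' := h₂.pullback sq.flip (j := pullback.lift 0 i₂ (by rw [z₂, zero_comp]))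
    (pullback.lift_snd _ _ _) (pullback.lift_fst _ _ _)
  obtain ⟨σ, hσ⟩ := hE.lift hP₂ (𝟙 _)
  have := hE.shortExact.mono_f
  let e := biprodIsoOfSplitting (ShortComplex.Splitting.ofExactOfSection _ hE.shortExact.exact σ hσ
    hE.shortExact.mono_f)
  have hT := (isProper_biprod_map_right P₂ h₁).comp_iso e.symm
  obtain ⟨U, r, hr, s, t, hst, k₁, k₂, -⟩ := hT.comp_epi hE'
  exact ⟨_, ⟨_, _, s, t, hst, hK₁, hK₂, k₂⟩, prop_biprod 𝒞 hP₁ hP₂, ⟨Iso.refl _⟩, k₁,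
    isCoproper_of_isGorensteinExtension hfin hadm k₁ hM⟩

/-- The dual horseshoe. The push-out of `M` along `L ⟶ Q₁` is an extension of `N` by `Q₁`; here the
splitting requires coproperness, available because `N` is Gorenstein. -/
lemma IsGorensteinExtension.hasCosyzygyIn [𝒞.IsClosedUnderBinaryProducts]
    (hfin : IsContravariantlyFinite 𝒞) (hadm : IsAdmissible 𝒞) {M : 𝒜}
    (hM : IsGorensteinExtension 𝒞 M) : HasCosyzygyIn 𝒞 (IsGorensteinExtension 𝒞) M := by
  obtain ⟨L, N, f, g, h, hL, hN, hS⟩ := hM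
  obtain ⟨Q₁, N₁, i₁, p₁, z₁, hQ₁, hN₁, h₁, -⟩ := gorenstein_exists_cosyzygy hfin hadm hL
  obtain ⟨Q₂, N₂, i₂, p₂, z₂, hQ₂, hN₂, h₂, -⟩ := gorenstein_exists_cosyzygy hfin hadm hN
  have sq := IsPushout.of_hasPushout f i₁
  have hE := hS.pushout sq (w := pushout.desc g 0 (by rw [h, comp_zero]))
    (pushout.inl_desc _ _ _) (pushout.inr_desc _ _ _)
  have hE' := h₁.pushout sq.flip (w := pushout.desc 0 p₁ (by rw [z₁, comp_zero]))
    (pushout.inr_desc _ _ _) (pushout.inl_desc _ _ _)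
  obtain ⟨ρ, hρ⟩ := isCoproper_of_gorenstein hfin hadm hE hN hQ₁ (𝟙 _)
  let e := biprodIsoOfSplitting (ShortComplex.Splitting.ofExactOfRetraction _ hE.shortExact.exact ρ hρ
    hE.shortExact.epi_g)
  have hT := (isProper_biprod_map_left Q₁ h₂).iso_comp e
  obtain ⟨W, r, hr, s, t, hst, k₁, k₂⟩ := hE'.comp_mono hT
  have hW : IsGorensteinExtension 𝒞 W := ⟨_, _, s, t, hst, hN₁, hN₂, k₂⟩
  exact ⟨_, ⟨Iso.refl _⟩, prop_biprod 𝒞 hQ₁ hQ₂, hW, k₁,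
    isCoproper_of_isGorensteinExtension hfin hadm k₁ hW⟩

/-- The Gorenstein category is closed under proper extensions. -/
lemma gorenstein_of_isProper [𝒞.IsClosedUnderBinaryProducts]
    (hfin : IsContravariantlyFinite 𝒞) (hadm : IsAdmissible 𝒞) {S : ShortComplex 𝒜}
    (hS : IsProper 𝒞 S) (h₁ : gorenstein 𝒞 S.X₁) (h₃ : gorenstein 𝒞 S.X₃) :
    gorenstein 𝒞 S.X₂ :=
  le_gorenstein hfin hadm (IsGorensteinExtension 𝒞) (fun _ h => h.hasSyzygyIn hfin hadm)
    (fun _ h => h.hasCosyzygyIn hfin hadm) _ ⟨_, _, _, _, S.zero, h₁, h₃, hS⟩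

end Extensions

/-! ### The Frobenius structure -/

section Frobenius

variable {𝒜 : Type u} [Category.{v} 𝒜] [Abelian 𝒜] {𝒞 : ObjectProperty 𝒜}

/-- Objects of `𝒞` belong to the Gorenstein category. -/
lemma le_gorenstein_self [𝒞.ContainsZero] [𝒞.IsClosedUnderIsomorphisms]
    (hfin : IsContravariantlyFinite 𝒞) (hadm : IsAdmissible 𝒞) : 𝒞 ≤ gorenstein 𝒞 := by
  have h0 {Z : 𝒜} (hZ : IsZero Z) : 𝒞 Z := 𝒞.prop_of_isZero hZ
  refine le_gorenstein hfin hadm 𝒞 (fun M hM => ?_) (fun M hM => ?_)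
  · let S := ShortComplex.mk (0 : 0 ⟶ M) (𝟙 M) (by simp)
    let s : S.Splitting := { r := 0, s := 𝟙 M, id := by simp [S] }
    exact ⟨S, h0 (isZero_zero _), hM, ⟨Iso.refl _⟩, isProper_of_splitting s,
      fun C _ f => ⟨0, (isZero_zero 𝒜).eq_of_src _ _⟩⟩
  · let S := ShortComplex.mk (𝟙 M) (0 : M ⟶ 0) (by simp)
    let s : S.Splitting := { r := 𝟙 M, s := 0, id := by simp [S] }
    exact ⟨S, ⟨Iso.refl _⟩, hM, h0 (isZero_zero _), isProper_of_splitting s,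
      fun C _ f => ⟨f, by simp [S]⟩⟩

lemma isInflation_of_isProper (hfin : IsContravariantlyFinite 𝒞) (hadm : IsAdmissible 𝒞)
    {X Y : (gorenstein 𝒞).FullSubcategory} (i : X ⟶ Y) {Z : 𝒜} {p : Y.obj ⟶ Z}
    (h : i.hom ≫ p = 0) (hp : IsProper 𝒞 (ShortComplex.mk i.hom p h)) (hZ : gorenstein 𝒞 Z) :
    IsInflation (gorensteinConflations 𝒞) i :=
  ⟨⟨Z, hZ⟩, ObjectProperty.homMk p, by ext; exact h,
    (gorensteinConflations_iff hfin hadm _).2 hp⟩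

lemma isDeflation_of_isProper (hfin : IsContravariantlyFinite 𝒞) (hadm : IsAdmissible 𝒞)
    {Y Z : (gorenstein 𝒞).FullSubcategory} (p : Y ⟶ Z) {X : 𝒜} {i : X ⟶ Y.obj}
    (h : i ≫ p.hom = 0) (hp : IsProper 𝒞 (ShortComplex.mk i p.hom h)) (hX : gorenstein 𝒞 X) :
    IsDeflation (gorensteinConflations 𝒞) p :=
  ⟨⟨X, hX⟩, ObjectProperty.homMk i, by ext; exact h,
    (gorensteinConflations_iff hfin hadm _).2 hp⟩

lemma IsInflation.exists_isProper (hfin : IsContravariantlyFinite 𝒞) (hadm : IsAdmissible 𝒞)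
    {X Y : (gorenstein 𝒞).FullSubcategory} {i : X ⟶ Y}
    (hi : IsInflation (gorensteinConflations 𝒞) i) :
    ∃ (Z : 𝒜) (p : Y.obj ⟶ Z) (h : i.hom ≫ p = 0), gorenstein 𝒞 Z ∧
      IsProper 𝒞 (ShortComplex.mk i.hom p h) := by
  obtain ⟨Z, p, h, hS⟩ := hi
  exact ⟨Z.obj, p.hom, by rw [← ObjectProperty.FullSubcategory.comp_hom, h]; rfl, Z.property,
    (gorensteinConflations_iff hfin hadm _).1 hS⟩

lemma IsDeflation.exists_isProper (hfin : IsContravariantlyFinite 𝒞) (hadm : IsAdmissible 𝒞)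
    {Y Z : (gorenstein 𝒞).FullSubcategory} {p : Y ⟶ Z}
    (hp : IsDeflation (gorensteinConflations 𝒞) p) :
    ∃ (X : 𝒜) (i : X ⟶ Y.obj) (h : i ≫ p.hom = 0), gorenstein 𝒞 X ∧
      IsProper 𝒞 (ShortComplex.mk i p.hom h) := by
  obtain ⟨X, i, h, hS⟩ := hp
  exact ⟨X.obj, i.hom, by rw [← ObjectProperty.FullSubcategory.comp_hom, h]; rfl, X.property,
    (gorensteinConflations_iff hfin hadm _).1 hS⟩

/-- All constructions are made in the ambient abelian category; closure under proper extensions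
keeps the resulting objects Gorenstein. -/
lemma isExactStructure_gorensteinConflations [𝒞.ContainsZero] [𝒞.IsClosedUnderBinaryProducts]
    [𝒞.IsClosedUnderIsomorphisms]
    (hfin : IsContravariantlyFinite 𝒞) (hadm : IsAdmissible 𝒞) :
    IsExactStructure (gorensteinConflations 𝒞) where
  of_iso {S T} e hS := by
    rw [gorensteinConflations_iff hfin hadm] at hS ⊢
    exact hS.of_iso ((gorenstein 𝒞).ι.mapShortComplex.mapIso e)
  isKernel S hS := by
    rw [gorensteinConflations_iff hfin hadm] at hS
    have : Mono S.f.hom := hS.shortExact.mono_f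
    have h {T : (gorenstein 𝒞).FullSubcategory} (f : T ⟶ S.X₂) (hf : f ≫ S.g = 0) :
        ∃ g : T ⟶ S.X₁, g ≫ S.f = f := by
      obtain ⟨g, hg⟩ := hS.exists_lift f.hom (by
        exact ObjectProperty.hom_ext_iff.1 hf)
      exact ⟨ObjectProperty.homMk g, by ext; exact hg⟩
    exact ⟨KernelFork.IsLimit.ofι _ _ (fun f hf => (h f hf).choose)
      (fun f hf => (h f hf).choose_spec) (fun f hf m hm => by
        ext
        rw [← cancel_mono S.f.hom]
        exact congr_arg InducedCategory.Hom.hom (hm.trans (h f hf).choose_spec.symm))⟩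
  isCokernel S hS := by
    rw [gorensteinConflations_iff hfin hadm] at hS
    have : Epi S.g.hom := hS.shortExact.epi_g
    have h {T : (gorenstein 𝒞).FullSubcategory} (f : S.X₂ ⟶ T) (hf : S.f ≫ f = 0) :
        ∃ g : S.X₃ ⟶ T, S.g ≫ g = f := by
      obtain ⟨g, hg⟩ := hS.exists_desc f.hom (by
        exact ObjectProperty.hom_ext_iff.1 hf)
      exact ⟨ObjectProperty.homMk g, by ext; exact hg⟩
    exact ⟨CokernelCofork.IsColimit.ofπ _ _ (fun f hf => (h f hf).choose)
      (fun f hf => (h f hf).choose_spec) (fun f hf m hm => by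
        ext
        rw [← cancel_epi S.g.hom]
        exact congr_arg InducedCategory.Hom.hom (hm.trans (h f hf).choose_spec.symm))⟩
  id_inflation X := by
    let S := ShortComplex.mk (𝟙 X.obj) (0 : X.obj ⟶ 0) (by simp)
    let s : S.Splitting := { r := 𝟙 _, s := 0, id := by simp [S] }
    exact isInflation_of_isProper hfin hadm _ S.zero (isProper_of_splitting s)
      (gorenstein 𝒞).prop_zero
  id_deflation X := by
    let S := ShortComplex.mk (0 : 0 ⟶ X.obj) (𝟙 X.obj) (by simp)
    let s : S.Splitting := { r := 0, s := 𝟙 _, id := by simp [S] }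
    exact isDeflation_of_isProper hfin hadm _ S.zero (isProper_of_splitting s)
      (gorenstein 𝒞).prop_zero
  comp_inflation {X Y Z} f g hf hg := by
    obtain ⟨A, p, z, hA, hp⟩ := hf.exists_isProper hfin hadm
    obtain ⟨B, q, z', hB, hq⟩ := hg.exists_isProper hfin hadm
    obtain ⟨W, r, hr, s, t, hst, h₁, h₂⟩ := hp.comp_mono hq
    exact isInflation_of_isProper hfin hadm (f ≫ g) hr h₁
      (gorenstein_of_isProper hfin hadm h₂ hA hB)
  comp_deflation {X Y Z} f g hf hg := by
    obtain ⟨A, p, z, hA, hp⟩ := hf.exists_isProper hfin hadm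
    obtain ⟨B, q, z', hB, hq⟩ := hg.exists_isProper hfin hadm
    obtain ⟨W, r, hr, s, t, hst, h₁, h₂, -⟩ := hp.comp_epi hq
    exact isDeflation_of_isProper hfin hadm (f ≫ g) hr h₁
      (gorenstein_of_isProper hfin hadm h₂ hA hB)
  pushout_inflation {X Y X'} i f hi := by
    obtain ⟨A, p, z, hA, hp⟩ := hi.exists_isProper hfin hadm
    have sq := IsPushout.of_hasPushout i.hom f.hom
    have h := hp.pushout sq (w := pushout.desc p 0 (by rw [z, comp_zero]))
      (pushout.inl_desc _ _ _) (pushout.inr_desc _ _ _)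
    let Y' : (gorenstein 𝒞).FullSubcategory :=
      ⟨pushout i.hom f.hom, gorenstein_of_isProper hfin hadm h X'.property hA⟩
    let f' : Y ⟶ Y' := ObjectProperty.homMk (pushout.inl i.hom f.hom)
    let i' : X' ⟶ Y' := ObjectProperty.homMk (pushout.inr i.hom f.hom)
    exact ⟨Y', f', i', IsPushout.of_map (gorenstein 𝒞).ι (by ext; exact sq.w) sq,
      isInflation_of_isProper hfin hadm i' _ h hA⟩
  pullback_deflation {Y Z Z'} p f hp := by
    obtain ⟨A, i, z, hA, hi⟩ := hp.exists_isProper hfin hadm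
    have sq := IsPullback.of_hasPullback p.hom f.hom
    have h := hi.pullback sq (j := pullback.lift i 0 (by rw [z, zero_comp]))
      (pullback.lift_fst _ _ _) (pullback.lift_snd _ _ _)
    let Y' : (gorenstein 𝒞).FullSubcategory :=
      ⟨pullback p.hom f.hom, gorenstein_of_isProper hfin hadm h hA Z'.property⟩
    let f' : Y' ⟶ Y := ObjectProperty.homMk (pullback.fst p.hom f.hom)
    let p' : Y' ⟶ Z' := ObjectProperty.homMk (pullback.snd p.hom f.hom)
    exact ⟨Y', f', p', IsPullback.of_map (gorenstein 𝒞).ι (by ext; exact sq.w) sq,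
      isDeflation_of_isProper hfin hadm p' _ h hA⟩

/-- Objects of `𝒞` are projective by properness. Conversely, the syzygy sequence of a projective
splits, so it is a retract of an object of `𝒞`. -/
lemma isRelProjective_iff [𝒞.ContainsZero] [𝒞.IsStableUnderRetracts]
    (hfin : IsContravariantlyFinite 𝒞) (hadm : IsAdmissible 𝒞)
    (X : (gorenstein 𝒞).FullSubcategory) :
    IsRelProjective (gorensteinConflations 𝒞) X ↔ 𝒞 X.obj := by
  constructor
  · intro hX
    obtain ⟨K, P, i, p, h, hK, hP, hp, -⟩ := gorenstein_exists_syzygy hfin hadm X.property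
    let P' : (gorenstein 𝒞).FullSubcategory := ⟨P, le_gorenstein_self hfin hadm _ hP⟩
    obtain ⟨s, hs⟩ := hX (Y := P') (ObjectProperty.homMk p)
      (isDeflation_of_isProper hfin hadm _ h hp hK) (𝟙 X)
    exact 𝒞.prop_of_retract ⟨s.hom, p, congr_arg InducedCategory.Hom.hom hs⟩ hP
  · intro hX Y Z p hp f
    obtain ⟨A, i, z, hA, hi⟩ := hp.exists_isProper hfin hadm
    obtain ⟨g, hg⟩ := hi.lift hX f.hom
    exact ⟨ObjectProperty.homMk g, by ext; exact hg⟩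

/-- Objects of `𝒞` are injective because conflations are automatically coproper; an injective is a
retract of the middle term of its cosyzygy sequence. -/
lemma isRelInjective_iff [𝒞.ContainsZero] [𝒞.IsStableUnderRetracts]
    (hfin : IsContravariantlyFinite 𝒞) (hadm : IsAdmissible 𝒞)
    (X : (gorenstein 𝒞).FullSubcategory) :
    IsRelInjective (gorensteinConflations 𝒞) X ↔ 𝒞 X.obj := by
  constructor
  · intro hX
    obtain ⟨Q, N, i, p, h, hQ, hN, hp, -⟩ := gorenstein_exists_cosyzygy hfin hadm X.property
    let Q' : (gorenstein 𝒞).FullSubcategory := ⟨Q, le_gorenstein_self hfin hadm _ hQ⟩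
    obtain ⟨s, hs⟩ := hX (Y := Q') (ObjectProperty.homMk i)
      (isInflation_of_isProper hfin hadm _ h hp hN) (𝟙 X)
    exact 𝒞.prop_of_retract ⟨i, s.hom, congr_arg InducedCategory.Hom.hom hs⟩ hQ
  · intro hX Y Z i hi f
    obtain ⟨A, p, z, hA, hp⟩ := hi.exists_isProper hfin hadm
    obtain ⟨g, hg⟩ := isCoproper_of_gorenstein hfin hadm hp hA hX f.hom
    exact ⟨ObjectProperty.homMk g, by ext; exact hg⟩

/-- The Gorenstein category is a Frobenius category. -/
theorem isFrobenius_gorensteinConflations [𝒞.ContainsZero] [𝒞.IsClosedUnderBinaryProducts]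
    [𝒞.IsStableUnderRetracts]
    (hfin : IsContravariantlyFinite 𝒞) (hadm : IsAdmissible 𝒞) :
    IsFrobenius (gorensteinConflations 𝒞) where
  exact := isExactStructure_gorensteinConflations hfin hadm
  enough_projectives X := by
    obtain ⟨K, P, i, p, h, hK, hP, hp, -⟩ := gorenstein_exists_syzygy hfin hadm X.property
    let P' : (gorenstein 𝒞).FullSubcategory := ⟨P, le_gorenstein_self hfin hadm _ hP⟩
    let p' : P' ⟶ X := ObjectProperty.homMk p
    exact ⟨P', p', (isRelProjective_iff hfin hadm _).2 hP,
      isDeflation_of_isProper hfin hadm p' h hp hK⟩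
  enough_injectives X := by
    obtain ⟨Q, N, i, p, h, hQ, hN, hp, -⟩ := gorenstein_exists_cosyzygy hfin hadm X.property
    let Q' : (gorenstein 𝒞).FullSubcategory := ⟨Q, le_gorenstein_self hfin hadm _ hQ⟩
    let i' : X ⟶ Q' := ObjectProperty.homMk i
    exact ⟨Q', i', (isRelInjective_iff hfin hadm _).2 hQ,
      isInflation_of_isProper hfin hadm i' h hp hN⟩
  projective_iff_injective X := by
    rw [isRelProjective_iff hfin hadm, isRelInjective_iff hfin hadm]

end Frobenius


/-! ### Distinguished triangles written with explicit components -/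

section Triangles

variable {T : Type u} [Category.{v} T] [HasZeroObject T] [HasShift T ℤ] [Preadditive T]
  [∀ n : ℤ, (shiftFunctor T n).Additive] [Pretriangulated T]

lemma mem_distTriang_of_iso {X Y Z X' Y' Z' : T} {f : X ⟶ Y} {g : Y ⟶ Z} {h : Z ⟶ X⟦(1 : ℤ)⟧}
    (hT : Triangle.mk f g h ∈ distTriang T) {f' : X' ⟶ Y'} {g' : Y' ⟶ Z'}
    {h' : Z' ⟶ X'⟦(1 : ℤ)⟧} (e₁ : X' ≅ X) (e₂ : Y' ≅ Y) (e₃ : Z' ≅ Z)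
    (comm₁ : f' ≫ e₂.hom = e₁.hom ≫ f) (comm₂ : g' ≫ e₃.hom = e₂.hom ≫ g)
    (comm₃ : h' ≫ e₁.hom⟦(1 : ℤ)⟧' = e₃.hom ≫ h) :
    Triangle.mk f' g' h' ∈ distTriang T :=
  isomorphic_distinguished _ hT _ (Triangle.isoMk _ _ e₁ e₂ e₃ comm₁ comm₂ comm₃)

lemma mem_distTriang_of_iso₃ {X Y Z Z' : T} {f : X ⟶ Y} {g : Y ⟶ Z} {h : Z ⟶ X⟦(1 : ℤ)⟧}
    (hT : Triangle.mk f g h ∈ distTriang T) {g' : Y ⟶ Z'}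
    {h' : Z' ⟶ X⟦(1 : ℤ)⟧} (e : Z ≅ Z') (hg : g ≫ e.hom = g') (hh : e.hom ≫ h' = h) :
    Triangle.mk f g' h' ∈ distTriang T :=
  mem_distTriang_of_iso hT (Iso.refl _) (Iso.refl _) e.symm (by simp) (by simp [← hg])
    (by simp [← hh])

variable {X Y Z : T} {f : X ⟶ Y} {g : Y ⟶ Z} {h : Z ⟶ X⟦(1 : ℤ)⟧}

lemma exists_hom₃_of_distTriang (hT : Triangle.mk f g h ∈ distTriang T) {X' Y' Z' : T}
    {f' : X' ⟶ Y'} {g' : Y' ⟶ Z'} {h' : Z' ⟶ X'⟦(1 : ℤ)⟧}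
    (hT' : Triangle.mk f' g' h' ∈ distTriang T) (a : X ⟶ X') (b : Y ⟶ Y')
    (comm : f ≫ b = a ≫ f') :
    ∃ c : Z ⟶ Z', g ≫ c = b ≫ g' ∧ h ≫ a⟦(1 : ℤ)⟧' = c ≫ h' :=
  complete_distinguished_triangle_morphism _ _ hT hT' a b comm

lemma exists_hom₂_of_distTriang (hT : Triangle.mk f g h ∈ distTriang T) {X' Y' Z' : T}
    {f' : X' ⟶ Y'} {g' : Y' ⟶ Z'} {h' : Z' ⟶ X'⟦(1 : ℤ)⟧}
    (hT' : Triangle.mk f' g' h' ∈ distTriang T) (a : X ⟶ X') (c : Z ⟶ Z')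
    (comm : h ≫ a⟦(1 : ℤ)⟧' = c ≫ h') :
    ∃ b : Y ⟶ Y', f ≫ b = a ≫ f' ∧ g ≫ c = b ≫ g' :=
  complete_distinguished_triangle_morphism₂ _ _ hT hT' a c comm

lemma exists_desc₃_of_distTriang (hT : Triangle.mk f g h ∈ distTriang T) {W : T} (φ : Z ⟶ W)
    (hφ : g ≫ φ = 0) : ∃ ψ : X⟦(1 : ℤ)⟧ ⟶ W, φ = h ≫ ψ :=
  Triangle.yoneda_exact₃ _ hT φ hφ

lemma exists_desc₂_of_distTriang (hT : Triangle.mk f g h ∈ distTriang T) {W : T} (φ : Y ⟶ W)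
    (hφ : f ≫ φ = 0) : ∃ ψ : Z ⟶ W, φ = g ≫ ψ :=
  Triangle.yoneda_exact₂ _ hT φ hφ

lemma exists_lift₂_of_distTriang (hT : Triangle.mk f g h ∈ distTriang T) {W : T} (φ : W ⟶ Y)
    (hφ : φ ≫ g = 0) : ∃ ψ : W ⟶ X, φ = ψ ≫ f :=
  Triangle.coyoneda_exact₂ _ hT φ hφ

end Triangles

/-! ### Bounded complexes and triangles from proper sequences -/

section BoundedComplexes

variable {𝒜 : Type u} [Category.{v} 𝒜] [Abelian 𝒜] {𝒞 : ObjectProperty 𝒜}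

/-- The complex `K` vanishes outside the degrees between `a` and `b`. -/
def IsConcentrated (K : CochainComplex 𝒜 ℤ) (a b : ℤ) : Prop :=
  ∀ i : ℤ, i < a ∨ b < i → IsZero (K.X i)

variable (𝒜) in
/-- Bounded complexes. -/
def isBounded : ObjectProperty (CochainComplex 𝒜 ℤ) := fun K => ∃ a b : ℤ, IsConcentrated K a b

lemma isConcentrated_single (X : 𝒜) (n : ℤ) :
    IsConcentrated ((CochainComplex.singleFunctor 𝒜 n).obj X) n n :=
  fun i hi => HomologicalComplex.isZero_single_obj_X (ComplexShape.up ℤ) n X i (by lia)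

lemma isBounded_single (X : 𝒜) (n : ℤ) : isBounded 𝒜 ((CochainComplex.singleFunctor 𝒜 n).obj X) :=
  ⟨n, n, isConcentrated_single X n⟩

variable (𝒜) in
/-- The category of bounded complexes. -/
abbrev BoundedComplex : Type _ := (isBounded 𝒜).FullSubcategory

variable (𝒜) in
/-- The quotient functor from bounded complexes to the bounded homotopy category. -/
def BoundedComplex.toKb : BoundedComplex 𝒜 ⥤ Kb 𝒜 :=
  (boundedIn (⊤ : ObjectProperty 𝒜)).lift ((isBounded 𝒜).ι ⋙ HomotopyCategory.quotient _ _)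
    (fun K => ⟨K.property, fun _ => trivial⟩)

variable (𝒞) in
/-- The functor from bounded complexes to the bounded relative derived category. -/
abbrev BoundedComplex.toDb : BoundedComplex 𝒜 ⥤ Db 𝒞 := BoundedComplex.toKb 𝒜 ⋙ Db.Q 𝒞

variable (𝒜) in
/-- The complexes concentrated in a single degree, as bounded complexes. -/
def BoundedComplex.single (n : ℤ) : 𝒜 ⥤ BoundedComplex 𝒜 :=
  (isBounded 𝒜).lift (CochainComplex.singleFunctor 𝒜 n) (fun X => isBounded_single X n)

variable (𝒞) in
/-- The functor `𝒜 ⥤ D^b_𝒞(𝒜)`. -/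
abbrev Db.single : 𝒜 ⥤ Db 𝒞 := Kb.single 𝒜 ⋙ Db.Q 𝒞

lemma BoundedComplex.toKb_map_surjective {K L : BoundedComplex 𝒜}
    (f : (toKb 𝒜).obj K ⟶ (toKb 𝒜).obj L) : ∃ g : K ⟶ L, (toKb 𝒜).map g = f := by
  obtain ⟨g, hg⟩ := (HomotopyCategory.quotient 𝒜 (ComplexShape.up ℤ)).map_surjective
    (X := K.obj) (Y := L.obj) ((Kb.ι 𝒜).map f)
  exact ⟨ObjectProperty.homMk g, (Kb.ι 𝒜).map_injective hg⟩

lemma BoundedComplex.toKb_obj_surjective (X : Kb 𝒜) :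
    ∃ K : BoundedComplex 𝒜, (toKb 𝒜).obj K = X :=
  ⟨⟨X.obj.as, X.property.1⟩, rfl⟩

lemma BoundedComplex.toKb_map_eq_zero {K L : BoundedComplex 𝒜}
    (h : ∀ i, IsZero (K.obj.X i) ∨ IsZero (L.obj.X i)) (f : (toKb 𝒜).obj K ⟶ (toKb 𝒜).obj L) :
    f = 0 := by
  obtain ⟨g, rfl⟩ := toKb_map_surjective f
  have : g.hom = 0 := by
    ext i
    obtain h | h := h i
    · exact h.eq_of_src _ _
    · exact h.eq_of_tgt _ _
  obtain rfl : g = 0 := by ext : 1; exact this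
  apply (Kb.ι 𝒜).map_injective
  exact (HomotopyCategory.quotient 𝒜 (ComplexShape.up ℤ)).map_zero _ _

lemma isBounded_shift {K : CochainComplex 𝒜 ℤ} (hK : isBounded 𝒜 K) (n : ℤ) :
    isBounded 𝒜 (K⟦n⟧) := by
  obtain ⟨a, b, h⟩ := hK
  exact ⟨a - n, b - n, fun i hi => h (i + n) (by lia)⟩

/-- The shift of a bounded complex. -/
abbrev BoundedComplex.shift (K : BoundedComplex 𝒜) (n : ℤ) : BoundedComplex 𝒜 :=
  ⟨K.obj⟦n⟧, isBounded_shift K.property n⟩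

/-- The functor to the bounded homotopy category is compatible with the shifts. -/
def BoundedComplex.toKbShiftIso (K : BoundedComplex 𝒜) (n : ℤ) :
    (toKb 𝒜).obj (K.shift n) ≅ ((toKb 𝒜).obj K)⟦n⟧ :=
  (Kb.ι 𝒜).preimageIso
    (((HomotopyCategory.quotient 𝒜 (ComplexShape.up ℤ)).commShiftIso n).app K.obj ≪≫
      (((Kb.ι 𝒜).commShiftIso n).app ((toKb 𝒜).obj K)).symm)

variable (𝒞) in
/-- The functor to the bounded relative derived category is compatible with the shifts. -/
def BoundedComplex.toDbShiftIso (K : BoundedComplex 𝒜) (n : ℤ) :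
    (toDb 𝒞).obj (K.shift n) ≅ ((toDb 𝒞).obj K)⟦n⟧ :=
  (Db.Q 𝒞).mapIso (K.toKbShiftIso n) ≪≫ ((Db.Q 𝒞).commShiftIso n).app _

/-- Complexes concentrated in one degree as shifts of complexes concentrated in degree `0`. -/
def BoundedComplex.shiftSingleIso (X : 𝒜) (n m : ℤ) (h : n + m = 0) :
    ((single 𝒜 0).obj X).shift n ≅ (single 𝒜 m).obj X :=
  (isBounded 𝒜).ι.preimageIso (((CochainComplex.singleFunctors 𝒜).shiftIso n m 0 h).app X)

variable (𝒞) in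
/-- The image in the bounded relative derived category of a complex concentrated in one degree. -/
def Db.singleIso (X : 𝒜) (n m : ℤ) (h : n + m = 0) :
    (BoundedComplex.toDb 𝒞).obj ((BoundedComplex.single 𝒜 m).obj X) ≅
      ((Db.single 𝒞).obj X)⟦n⟧ :=
  (BoundedComplex.toDb 𝒞).mapIso (BoundedComplex.shiftSingleIso X n m h).symm ≪≫
    BoundedComplex.toDbShiftIso 𝒞 _ n

/-- The relative quasi-isomorphisms. -/
lemma acyclicIn_trW_iff {K L : CochainComplex 𝒜 ℤ} (f : K ⟶ L) :
    (acyclicIn 𝒞).trW ((HomotopyCategory.quotient _ _).map f) ↔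
      IsHomFromExact 𝒞 (CochainComplex.mappingCone f) :=
  (acyclicIn 𝒞).trW_iff_of_distinguished _
    (HomotopyCategory.mappingCone_triangleh_distinguished f)

lemma Kb.acyclic_trW_iff {K L : BoundedComplex 𝒜} (f : K ⟶ L) :
    (Kb.acyclic 𝒞).trW ((BoundedComplex.toKb 𝒜).map f) ↔
      IsHomFromExact 𝒞 (CochainComplex.mappingCone f.hom) :=
  ((acyclicIn 𝒞).inverseImage_trW_iff (Kb.ι 𝒜) _).trans (acyclicIn_trW_iff f.hom)

/-- A degreewise proper short exact sequence of complexes induces a relative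
quasi-isomorphism from the mapping cone. -/
lemma isHomFromExact_mappingCone_descShortComplex (hfin : IsContravariantlyFinite 𝒞)
    (hadm : IsAdmissible 𝒞) (S : ShortComplex (CochainComplex 𝒜 ℤ))
    (hS : ∀ i, IsProper 𝒞 (S.map (HomologicalComplex.eval 𝒜 (ComplexShape.up ℤ) i))) :
    IsHomFromExact 𝒞
      (CochainComplex.mappingCone (CochainComplex.mappingCone.descShortComplex S)) := by
  intro C hC
  let F := preadditiveCoyoneda.obj (op C)
  -- After applying `Hom(C, -)` the sequence of complexes is short exact, so the cone of its first
  -- map is quasi-isomorphic to its third term; additive functors commute with mapping cones.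
  have hS' : (S.map (F.mapHomologicalComplex (ComplexShape.up ℤ))).ShortExact :=
    HomologicalComplex.shortExact_of_degreewise_shortExact _
      (fun i => (isProper_iff_shortExact_map hfin hadm _).1 (hS i) C hC)
  have h₁ := CochainComplex.mappingCone.quasiIso_descShortComplex hS'
  have h₂ : QuasiIso ((F.mapHomologicalComplex (ComplexShape.up ℤ)).map
      (CochainComplex.mappingCone.descShortComplex S)) := by
    rw [← CochainComplex.mappingCone.mapHomologicalComplexIso_hom_descShortComplex]
    have h₀ : QuasiIso (CochainComplex.mappingCone.mapHomologicalComplexIso S.f F).hom :=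
      quasiIso_of_isIso _
    exact (quasiIso_iff_comp_left _ _).2 h₁
  have h₃ := (HomotopyCategory.quotient_map_mem_quasiIso_iff _).2
    (HomologicalComplex.mem_quasiIso_iff _ |>.2 h₂)
  rw [HomotopyCategory.quasiIso_eq_trW_subcategoryAcyclic] at h₃
  have h₄ := ((HomotopyCategory.subcategoryAcyclic _).trW_iff_of_distinguished _
    (HomotopyCategory.mappingCone_triangleh_distinguished _)).1 h₃
  exact (HomotopyCategory.quotient_obj_mem_subcategoryAcyclic_iff_acyclic _).1
    (ObjectProperty.prop_of_iso _ ((HomotopyCategory.quotient _ _).mapIso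
      (CochainComplex.mappingCone.mapHomologicalComplexIso _ F).symm) h₄)

lemma isBounded_mappingCone {K L : CochainComplex 𝒜 ℤ} (hK : isBounded 𝒜 K)
    (hL : isBounded 𝒜 L) (f : K ⟶ L) : isBounded 𝒜 (CochainComplex.mappingCone f) := by
  obtain ⟨a₁, b₁, h₁⟩ := hK
  obtain ⟨a₂, b₂, h₂⟩ := hL
  exact ⟨min (a₁ - 1) a₂, max b₁ b₂, fun i hi =>
    (CochainComplex.mappingCone.isZero_X_iff f i).2 ⟨h₁ _ (by lia), h₂ _ (by lia)⟩⟩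

/-- The mapping cone triangle in the bounded homotopy category. -/
lemma exists_mappingCone_triangle {K L : BoundedComplex 𝒜} (f : K ⟶ L) :
    let M : BoundedComplex 𝒜 := ⟨CochainComplex.mappingCone f.hom,
      isBounded_mappingCone K.property L.property f.hom⟩
    let i : L ⟶ M := ObjectProperty.homMk (CochainComplex.mappingCone.inr f.hom)
    ∃ h, Triangle.mk ((BoundedComplex.toKb 𝒜).map f) ((BoundedComplex.toKb 𝒜).map i) h ∈
      distTriang (Kb 𝒜) := by
  intro M i
  -- Any cone taken in `K^b` becomes the mapping cone in `K`; the comparison lifts along the fully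
  -- faithful inclusion. Only the existence of the third map is needed.
  obtain ⟨Z, g, h, hT⟩ := distinguished_cocone_triangle ((BoundedComplex.toKb 𝒜).map f)
  let e := isoTriangleOfIso₁₂ _ _ ((Kb.ι 𝒜).map_distinguished _ hT)
    (HomotopyCategory.mappingCone_triangleh_distinguished f.hom) (Iso.refl _) (Iso.refl _)
    ((Category.comp_id _).trans (Category.id_comp _).symm)
  let e' : Z ≅ (BoundedComplex.toKb 𝒜).obj M := (Kb.ι 𝒜).preimageIso (Triangle.π₃.mapIso e)
  have he' : g ≫ e'.hom = (BoundedComplex.toKb 𝒜).map i := by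
    apply (Kb.ι 𝒜).map_injective
    rw [Functor.map_comp, show (Kb.ι 𝒜).map e'.hom = e.hom.hom₃ from (Kb.ι 𝒜).map_preimage _]
    exact e.hom.comm₂.trans (Category.id_comp _)
  exact ⟨e'.inv ≫ h, mem_distTriang_of_iso₃ hT e' he' (by simp)⟩

/-- A degreewise proper short exact sequence of bounded complexes gives a distinguished triangle
in the bounded relative derived category. -/
lemma exists_distinguished_of_isProper (hfin : IsContravariantlyFinite 𝒞)
    (hadm : IsAdmissible 𝒞) {K L M : BoundedComplex 𝒜} (f : K ⟶ L) (g : L ⟶ M)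
    (w : f.hom ≫ g.hom = 0)
    (hS : ∀ i, IsProper 𝒞 (ShortComplex.mk (f.hom.f i) (g.hom.f i)
      (by rw [← HomologicalComplex.comp_f, w, HomologicalComplex.zero_f]))) :
    ∃ δ, Triangle.mk ((BoundedComplex.toDb 𝒞).map f) ((BoundedComplex.toDb 𝒞).map g) δ ∈
      distTriang (Db 𝒞) := by
  obtain ⟨h, hT⟩ := exists_mappingCone_triangle f
  let N : BoundedComplex 𝒜 := ⟨CochainComplex.mappingCone f.hom,
      isBounded_mappingCone K.property L.property f.hom⟩
  let i : L ⟶ N := ObjectProperty.homMk (CochainComplex.mappingCone.inr f.hom)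
  let S := ShortComplex.mk f.hom g.hom w
  let s : N ⟶ M := ObjectProperty.homMk (CochainComplex.mappingCone.descShortComplex S)
  have hs : (Kb.acyclic 𝒞).trW ((BoundedComplex.toKb 𝒜).map s) :=
    (Kb.acyclic_trW_iff s).2
      (isHomFromExact_mappingCone_descShortComplex hfin hadm S (fun j => hS j))
  have : IsIso ((BoundedComplex.toDb 𝒞).map s) :=
    Localization.inverts (Db.Q 𝒞) (Kb.acyclic 𝒞).trW _ hs
  have his : (BoundedComplex.toDb 𝒞).map i ≫ (BoundedComplex.toDb 𝒞).map s =
      (BoundedComplex.toDb 𝒞).map g := by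
    rw [← Functor.map_comp]
    congr 1
    ext : 1
    exact CochainComplex.mappingCone.inr_descShortComplex S
  exact ⟨inv ((BoundedComplex.toDb 𝒞).map s) ≫ (Db.Q 𝒞).map h ≫
      ((Db.Q 𝒞).commShiftIso (1 : ℤ)).hom.app _,
    mem_distTriang_of_iso₃ ((Db.Q 𝒞).map_distinguished _ hT)
      (@asIso _ _ _ _ _ this) his (IsIso.hom_inv_id_assoc _ _)⟩

end BoundedComplexes


/-! ### Truncation and relative cohomology -/

section Truncation

variable {𝒜 : Type u} [Category.{v} 𝒜] [Abelian 𝒜] {𝒞 : ObjectProperty 𝒜}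

/-- The canonical truncation of a complex in degrees `≤ 0`. -/
lemma exists_truncation (X : CochainComplex 𝒜 ℤ) :
    ∃ (Z : CochainComplex 𝒜 ℤ) (ι : Z ⟶ X), (∀ i, Mono (ι.f i)) ∧ (∀ i < 0, IsIso (ι.f i)) ∧
      (∀ i > 0, IsZero (Z.X i)) ∧
      ∀ ⦃T : 𝒜⦄ (y : T ⟶ X.X 0), y ≫ X.d 0 1 = 0 → ∃ z : T ⟶ Z.X 0, z ≫ ι.f 0 = y := by
  have key (i : ℤ) : ∃ (Z : 𝒜) (ι : Z ⟶ X.X i), Mono ι ∧ (i < 0 → IsIso ι) ∧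
      (0 < i → IsZero Z) ∧ (i = 0 → ι ≫ X.d i (i + 1) = 0 ∧
        ∀ ⦃T : 𝒜⦄ (y : T ⟶ X.X i), y ≫ X.d i (i + 1) = 0 → ∃ z : T ⟶ Z, z ≫ ι = y) := by
    obtain hi | rfl | hi := lt_trichotomy i 0
    · exact ⟨_, 𝟙 _, inferInstance, fun _ => inferInstance, fun _ => by lia, fun _ => by lia⟩
    · exact ⟨_, kernel.ι (X.d 0 (0 + 1)), inferInstance, fun _ => by lia, fun _ => by lia,
        fun _ => ⟨kernel.condition _, fun T y hy => ⟨kernel.lift _ y hy, kernel.lift_ι _ _ _⟩⟩⟩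
    · exact ⟨0, 0, (isZero_zero 𝒜).mono _, fun _ => by lia, fun _ => isZero_zero 𝒜,
        fun _ => by lia⟩
  choose Z ι hmono hiso hzero hker using key
  have hd (i : ℤ) : ∃ d : Z i ⟶ Z (i + 1), d ≫ ι (i + 1) = ι i ≫ X.d i (i + 1) := by
    obtain hi | hi | hi := lt_trichotomy (i + 1) 0
    · have := hiso (i + 1) hi
      exact ⟨ι i ≫ X.d i (i + 1) ≫ inv (ι (i + 1)), by simp⟩
    · exact (hker (i + 1) hi).2 _ (by simp)
    · obtain rfl | hi' := eq_or_ne i 0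
      · exact ⟨0, by rw [(hker 0 rfl).1, zero_comp]⟩
      · exact ⟨0, (hzero i (by lia)).eq_of_src _ _⟩
  choose d hd using hd
  let K : CochainComplex 𝒜 ℤ := CochainComplex.of Z d (fun i => by
    rw [← cancel_mono (ι (i + 1 + 1)), Category.assoc, hd, reassoc_of% (hd i)]
    simp)
  have hK (i : ℤ) : K.d i (i + 1) = d i := CochainComplex.of_d Z d i
  let φ : K ⟶ X :=
    { f := ι
      comm' := by
        rintro i _ rfl
        exact (hd i).symm.trans (congr_arg (· ≫ ι (i + 1)) (hK i).symm) }
  exact ⟨K, φ, hmono, hiso, hzero, (hker 0 rfl).2⟩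

/-- An elementwise criterion for a morphism to be a relative quasi-isomorphism. -/
lemma isHomFromExact_mappingCone {K L : CochainComplex 𝒜 ℤ} (f : K ⟶ L)
    (h : ∀ (C : 𝒜) (_ : 𝒞 C) (i j k : ℤ) (_ : i + 1 = j) (_ : j + 1 = k) (x : C ⟶ K.X k)
      (y : C ⟶ L.X j), x ≫ K.d k (k + 1) = 0 → x ≫ f.f k = y ≫ L.d j k →
        ∃ (x' : C ⟶ K.X j) (y' : C ⟶ L.X i),
          x' ≫ K.d j k = x ∧ y = x' ≫ f.f j + y' ≫ L.d i j) :
    IsHomFromExact 𝒞 (CochainComplex.mappingCone f) := by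
  rw [isHomFromExact_iff]
  intro C hC i j k hij hjk c hc
  obtain ⟨x, y, rfl⟩ := CochainComplex.mappingCone.decomp_to f c k hjk
  rw [Preadditive.add_comp, Category.assoc, Category.assoc,
    CochainComplex.mappingCone.inl_v_d f k j (k + 1) (by lia) (by lia),
    CochainComplex.mappingCone.inr_f_d] at hc
  have h₁ := hc =≫ (CochainComplex.mappingCone.fst f).1.v k (k + 1) rfl
  have h₂ := hc =≫ (CochainComplex.mappingCone.snd f).v k k (add_zero k)
  simp only [Preadditive.comp_sub, Preadditive.add_comp, Preadditive.sub_comp, Category.assoc,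
    CochainComplex.mappingCone.inr_f_fst_v, CochainComplex.mappingCone.inl_v_fst_v, comp_zero,
    zero_comp, Category.comp_id, zero_sub, add_zero, neg_eq_zero,
    CochainComplex.mappingCone.inr_f_snd_v, CochainComplex.mappingCone.inl_v_snd_v,
    sub_zero] at h₁ h₂
  obtain ⟨x', y', h₃, h₄⟩ := h C hC i j k hij hjk x (-y) h₁
    (by rw [Preadditive.neg_comp, eq_neg_iff_add_eq_zero, h₂])
  obtain rfl : y = -(x' ≫ f.f j + y' ≫ L.d i j) := by rw [← h₄, neg_neg]
  refine ⟨-x' ≫ (CochainComplex.mappingCone.inl f).v j i (by lia) -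
    y' ≫ (CochainComplex.mappingCone.inr f).f i, ?_⟩
  rw [Preadditive.sub_comp, Preadditive.neg_comp, Category.assoc, Category.assoc,
    CochainComplex.mappingCone.inl_v_d f j i k (by lia) (by lia),
    CochainComplex.mappingCone.inr_f_d, Preadditive.comp_sub, reassoc_of% h₃]
  simp only [Preadditive.neg_comp, Preadditive.add_comp, Category.assoc]
  abel

/-- If a complex is relatively quasi-isomorphic to a complex in degrees `≤ 0`, its relative
cohomology vanishes in positive degrees. -/
lemma exists_lift_of_isHomFromExact_mappingCone {K L : CochainComplex 𝒜 ℤ} {f : K ⟶ L}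
    (hf : IsHomFromExact 𝒞 (CochainComplex.mappingCone f)) {C : 𝒜} (hC : 𝒞 C) {i j : ℤ}
    (hij : i + 1 = j) (hL : IsZero (L.X j)) (x : C ⟶ K.X j) (hx : x ≫ K.d j (j + 1) = 0) :
    ∃ y : C ⟶ K.X i, y ≫ K.d i j = x := by
  rw [isHomFromExact_iff] at hf
  -- Placed in the cone, `x` has degree `i` and is a cocycle because `L.X j` vanishes. The
  -- `K`-component of a cochain bounding it is the required preimage up to sign.
  obtain ⟨c, hc⟩ := hf C hC (i - 1) i j (by lia) hij
    (x ≫ (CochainComplex.mappingCone.inl f).v j i (by lia)) (by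
      rw [Category.assoc, CochainComplex.mappingCone.inl_v_d f j i (j + 1) (by lia) (by lia),
        Preadditive.comp_sub, reassoc_of% hx, zero_comp, sub_zero, hL.eq_of_tgt (f.f j) 0,
        zero_comp, comp_zero])
  refine ⟨-c ≫ (CochainComplex.mappingCone.fst f).1.v (i - 1) i (by lia), ?_⟩
  have := hc =≫ (CochainComplex.mappingCone.fst f).1.v i j hij
  simp only [Category.assoc, CochainComplex.mappingCone.inl_v_fst_v, Category.comp_id,
    CochainComplex.mappingCone.d_fst_v f (i - 1) i j (by lia) hij, Preadditive.comp_neg] at this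
  rw [Preadditive.neg_comp, Category.assoc, this]

/-- A complex whose relative cohomology vanishes in positive degrees is relatively
quasi-isomorphic to a complex in degrees `≤ 0`. -/
lemma exists_isHomFromExact_mappingCone (X : CochainComplex 𝒜 ℤ)
    (hX : ∀ (C : 𝒜) (_ : 𝒞 C) (i j : ℤ) (_ : i + 1 = j) (_ : 0 < j) (x : C ⟶ X.X j),
      x ≫ X.d j (j + 1) = 0 → ∃ y : C ⟶ X.X i, y ≫ X.d i j = x) :
    ∃ (Z : CochainComplex 𝒜 ℤ) (ι : Z ⟶ X), (∀ i > 0, IsZero (Z.X i)) ∧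
      (∀ i, IsZero (X.X i) → IsZero (Z.X i)) ∧
      IsHomFromExact 𝒞 (CochainComplex.mappingCone ι) := by
  obtain ⟨Z, ι, hmono, hiso, hzero, hker⟩ := exists_truncation X
  refine ⟨Z, ι, hzero, fun i hi => hi.of_mono (ι.f i), isHomFromExact_mappingCone ι ?_⟩
  rintro C hC i j k hij hjk x y hx hxy
  -- Below degree `0` the inclusion is an isomorphism, in degree `0` the element `y` is a cocycle
  -- and lies in the truncation, and above it `y` is a coboundary by `hX`.
  obtain hj | rfl | hj := lt_trichotomy j 0
  · have := hiso j hj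
    refine ⟨y ≫ inv (ι.f j), 0, ?_, by simp⟩
    rw [← cancel_mono (ι.f k), Category.assoc, ← ι.comm, Category.assoc, IsIso.inv_hom_id_assoc,
      hxy]
  · obtain rfl : k = 1 := by lia
    have h1 := hzero 1 (by lia)
    obtain ⟨z, hz⟩ := hker y (by rw [← hxy, h1.eq_of_tgt x 0, zero_comp])
    exact ⟨z, 0, h1.eq_of_tgt _ _, by simp [hz]⟩
  · obtain ⟨z, hz⟩ := hX C hC i j hij hj y (by
      subst hjk
      rw [← hxy, (hzero (j + 1) (by lia)).eq_of_tgt x 0, zero_comp])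
    exact ⟨0, z, (hzero k (by lia)).eq_of_tgt _ _, by simp [hz]⟩

end Truncation


/-! ### Morphisms between modules in the relative derived category -/

section DerivedHoms

variable {𝒜 : Type u} [Category.{v} 𝒜] [Abelian 𝒜] {𝒞 : ObjectProperty 𝒜}

lemma rightFraction_map_eq_zero {C D : Type*} [Category* C] [Category* D] [HasZeroMorphisms D]
    {W : MorphismProperty C} {X Y : C} (φ : W.RightFraction X Y) (F : C ⥤ D)
    (hF : W.IsInvertedBy F) (h : F.map φ.f = 0) : φ.map F hF = 0 := by
  have := hF _ φ.hs
  rw [← cancel_epi (F.map φ.s), MorphismProperty.RightFraction.map_s_comp_map, h, comp_zero]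

/-- There are no nonzero maps in `D^b_𝒞(𝒜)` from an object to a complex in positive degrees. -/
lemma Db.hom_eq_zero (M : 𝒜) (Y : BoundedComplex 𝒜) (hY : ∀ i ≤ 0, IsZero (Y.obj.X i))
    (φ : (Db.single 𝒞).obj M ⟶ (BoundedComplex.toDb 𝒞).obj Y) : φ = 0 := by
  obtain ⟨⟨s, hs, f⟩, hφ⟩ := Localization.exists_rightFraction (Db.Q 𝒞) (Kb.acyclic 𝒞).trW φ
  rename_i X'
  obtain ⟨X, rfl⟩ := BoundedComplex.toKb_obj_surjective X'
  obtain ⟨s', rfl⟩ := BoundedComplex.toKb_map_surjective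
    (L := (BoundedComplex.single 𝒜 0).obj M) s
  have hs' : IsHomFromExact 𝒞 (CochainComplex.mappingCone s'.hom) := (Kb.acyclic_trW_iff s').1 hs
  -- The source `X` of the fraction has no relative cohomology in positive degrees, so it may be
  -- replaced by its truncation `Z` in degrees `≤ 0`, which shares no degree with `Y`.
  obtain ⟨Z, ι, hZ, hZ', hι⟩ := exists_isHomFromExact_mappingCone (𝒞 := 𝒞) X.obj
    (fun C hC i j hij hj x hx => exists_lift_of_isHomFromExact_mappingCone hs' hC hij
      (isConcentrated_single M 0 j (by lia)) x hx)
  have hZb : isBounded 𝒜 Z := by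
    obtain ⟨a, b, hab⟩ := X.property
    exact ⟨a, b, fun i hi => hZ' i (hab i hi)⟩
  let t : (⟨Z, hZb⟩ : BoundedComplex 𝒜) ⟶ X := ObjectProperty.homMk ι
  have ht : (Kb.acyclic 𝒞).trW ((BoundedComplex.toKb 𝒜).map t) :=
    (Kb.acyclic_trW_iff t).2 hι
  have h₁ := Localization.inverts (Db.Q 𝒞) (Kb.acyclic 𝒞).trW _ ht
  have h₂ : (BoundedComplex.toKb 𝒜).map t ≫ f = 0 :=
    BoundedComplex.toKb_map_eq_zero (fun i => by
      by_cases hi : i ≤ 0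
      · exact Or.inr (hY i hi)
      · exact Or.inl (hZ i (by lia))) _
  have h₃ : (Db.Q 𝒞).map f = 0 := by
    rw [← cancel_epi ((Db.Q 𝒞).map ((BoundedComplex.toKb 𝒜).map t)), ← Functor.map_comp, h₂,
      Functor.map_zero, comp_zero]
  rw [hφ]
  exact rightFraction_map_eq_zero _ _ _ h₃

/-- There are no negative extensions in `D^b_𝒞(𝒜)`. -/
lemma Db.hom_shift_eq_zero (M N : 𝒜)
    (ψ : ((Db.single 𝒞).obj M)⟦(1 : ℤ)⟧ ⟶ (Db.single 𝒞).obj N) : ψ = 0 := by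
  -- Shifting by `-1` turns `ψ` into a map from `M` to `N` placed in degree `1`.
  apply (shiftFunctor (Db 𝒞) (-1 : ℤ)).map_injective
  rw [Functor.map_zero, ← cancel_epi ((shiftShiftNeg ((Db.single 𝒞).obj M) (1 : ℤ)).inv),
    ← cancel_mono (Db.singleIso 𝒞 N (-1) 1 (by lia)).inv, comp_zero, zero_comp]
  exact Db.hom_eq_zero _ _ (fun i hi => isConcentrated_single N 1 i (by lia)) _

lemma acyclicIn_le (hfin : IsContravariantlyFinite 𝒞) (hadm : IsAdmissible 𝒞) :
    acyclicIn 𝒞 ≤ HomotopyCategory.subcategoryAcyclic 𝒜 := by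
  intro X hX
  obtain ⟨K, rfl⟩ := X.quotient_obj_surjective
  exact (HomotopyCategory.quotient_obj_mem_subcategoryAcyclic_iff_acyclic _).2
    (IsHomFromExact.acyclic hfin hadm hX)

/-- Relative quasi-isomorphisms are quasi-isomorphisms, so if `f` and `g` are equalised by one, they
agree on `H⁰`, and `H⁰` recovers a module from its complex. -/
lemma Db.single_faithful (hfin : IsContravariantlyFinite 𝒞) (hadm : IsAdmissible 𝒞) :
    (Db.single 𝒞).Faithful := by
  refine ⟨fun {M N f g} hfg => ?_⟩
  obtain ⟨Y, s, hs, hs'⟩ := (MorphismProperty.map_eq_iff_postcomp (Db.Q 𝒞)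
    (Kb.acyclic 𝒞).trW _ _).1 hfg
  rw [ObjectProperty.inverseImage_trW_iff] at hs
  replace hs := ObjectProperty.trW_monotone (acyclicIn_le hfin hadm) _ hs
  rw [← HomotopyCategory.quasiIso_eq_trW_subcategoryAcyclic] at hs
  have hs₀ : IsIso ((HomotopyCategory.homologyFunctor 𝒜 (ComplexShape.up ℤ) 0).map
    ((Kb.ι 𝒜).map s)) := hs 0
  have h₁ := congr_arg (HomotopyCategory.homologyFunctor 𝒜 (ComplexShape.up ℤ) 0).map
    (congr_arg (Kb.ι 𝒜).map hs')
  rw [Functor.map_comp, Functor.map_comp, Functor.map_comp, Functor.map_comp,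
    cancel_mono] at h₁
  let e : HomotopyCategory.singleFunctor 𝒜 0 ⋙
      HomotopyCategory.homologyFunctor 𝒜 (ComplexShape.up ℤ) 0 ≅ 𝟭 𝒜 :=
    Functor.isoWhiskerLeft (HomologicalComplex.single 𝒜 (ComplexShape.up ℤ) 0)
      (HomotopyCategory.homologyFunctorFactors 𝒜 (ComplexShape.up ℤ) 0) ≪≫
      HomologicalComplex.homologyFunctorSingleIso 𝒜 (ComplexShape.up ℤ) 0
  have : (HomotopyCategory.singleFunctor 𝒜 0 ⋙
      HomotopyCategory.homologyFunctor 𝒜 (ComplexShape.up ℤ) 0).Faithful :=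
    Functor.Faithful.of_iso e.symm
  exact Functor.map_injective (HomotopyCategory.singleFunctor 𝒜 0 ⋙
      HomotopyCategory.homologyFunctor 𝒜 (ComplexShape.up ℤ) 0) h₁

lemma isProper_of_isZero {S : ShortComplex 𝒜} (h₁ : IsZero S.X₁) (h₂ : IsZero S.X₂)
    (h₃ : IsZero S.X₃) : IsProper 𝒞 S :=
  isProper_of_splitting { r := 0, s := 0, f_r := h₁.eq_of_src _ _, s_g := h₃.eq_of_src _ _,
                          id := h₂.eq_of_src _ _ }

/-- Proper short exact sequences give distinguished triangles in `D^b_𝒞(𝒜)`. -/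
lemma IsProper.exists_distinguished (hfin : IsContravariantlyFinite 𝒞) (hadm : IsAdmissible 𝒞)
    {X Y Z : 𝒜} {i : X ⟶ Y} {p : Y ⟶ Z} {hip : i ≫ p = 0}
    (hS : IsProper 𝒞 (ShortComplex.mk i p hip)) :
    ∃ δ, Triangle.mk ((Db.single 𝒞).map i) ((Db.single 𝒞).map p) δ ∈ distTriang (Db 𝒞) := by
  refine exists_distinguished_of_isProper hfin hadm ((BoundedComplex.single 𝒜 0).map i)
    ((BoundedComplex.single 𝒜 0).map p) ?_ ?_
  · change (CochainComplex.singleFunctor 𝒜 0).map i ≫ (CochainComplex.singleFunctor 𝒜 0).map p = 0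
    rw [← Functor.map_comp, hip, Functor.map_zero]
  · intro j
    obtain rfl | hj := eq_or_ne j 0
    · exact hS.of_iso ((ShortComplex.mk i p hip).mapNatIso
        (HomologicalComplex.singleCompEvalIsoSelf 𝒜 (ComplexShape.up ℤ) 0)).symm
    · exact isProper_of_isZero (isConcentrated_single X 0 j (by lia))
        (isConcentrated_single Y 0 j (by lia)) (isConcentrated_single Z 0 j (by lia))

/-- The connecting morphism of a proper short exact sequence. -/
def Db.δ (hfin : IsContravariantlyFinite 𝒞) (hadm : IsAdmissible 𝒞)
    {X Y Z : 𝒜} {i : X ⟶ Y} {p : Y ⟶ Z} {hip : i ≫ p = 0}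
    (hS : IsProper 𝒞 (ShortComplex.mk i p hip)) :
    (Db.single 𝒞).obj Z ⟶ ((Db.single 𝒞).obj X)⟦(1 : ℤ)⟧ :=
  (hS.exists_distinguished hfin hadm).choose

lemma Db.distinguished (hfin : IsContravariantlyFinite 𝒞) (hadm : IsAdmissible 𝒞)
    {X Y Z : 𝒜} {i : X ⟶ Y} {p : Y ⟶ Z} {hip : i ≫ p = 0}
    (hS : IsProper 𝒞 (ShortComplex.mk i p hip)) :
    Triangle.mk ((Db.single 𝒞).map i) ((Db.single 𝒞).map p) (Db.δ hfin hadm hS) ∈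
      distTriang (Db 𝒞) :=
  (hS.exists_distinguished hfin hadm).choose_spec

/-- The triangle axioms provide some third map `c'`. It differs from that of `c` by a map factoring
through `X⟦1⟧ ⟶ Z'`, and those vanish. Hence the arbitrary choice in `Db.δ` is harmless. -/
lemma Db.δ_naturality (hfin : IsContravariantlyFinite 𝒞) (hadm : IsAdmissible 𝒞)
    {X Y Z : 𝒜} {i : X ⟶ Y} {p : Y ⟶ Z} {hip : i ≫ p = 0}
    (hS : IsProper 𝒞 (ShortComplex.mk i p hip))
    {X' Y' Z' : 𝒜} {i' : X' ⟶ Y'} {p' : Y' ⟶ Z'} {hip' : i' ≫ p' = 0}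
    (hS' : IsProper 𝒞 (ShortComplex.mk i' p' hip')) (a : X ⟶ X') (b : Y ⟶ Y') (c : Z ⟶ Z')
    (h₁ : i ≫ b = a ≫ i') (h₂ : p ≫ c = b ≫ p') :
    (Db.single 𝒞).map c ≫ Db.δ hfin hadm hS' =
      Db.δ hfin hadm hS ≫ ((Db.single 𝒞).map a)⟦(1 : ℤ)⟧' := by
  obtain ⟨c', hc₁, hc₂⟩ := exists_hom₃_of_distTriang
    (Db.distinguished hfin hadm hS) (Db.distinguished hfin hadm hS')
    ((Db.single 𝒞).map a) ((Db.single 𝒞).map b)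
    (by rw [← Functor.map_comp, h₁, Functor.map_comp])
  obtain ⟨ψ, hψ⟩ := exists_desc₃_of_distTriang (Db.distinguished hfin hadm hS)
    (c' - (Db.single 𝒞).map c)
    (by rw [Preadditive.comp_sub, ← Functor.map_comp, h₂, Functor.map_comp, hc₁, sub_self])
  obtain rfl : c' = (Db.single 𝒞).map c := by
    rw [← sub_eq_zero, hψ, Db.hom_shift_eq_zero _ _ ψ, comp_zero]
  exact hc₂.symm

end DerivedHoms


/-! ### Full faithfulness on modules, and vanishing of extensions by `𝒞` -/

section Orthogonality

variable {𝒜 : Type u} [Category.{v} 𝒜] [Abelian 𝒜] {𝒞 : ObjectProperty 𝒜}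

instance : (Kb.single 𝒜).Additive where
  map_add {_ _ f g} := (Kb.ι 𝒜).map_injective
    ((HomotopyCategory.singleFunctor 𝒜 0).map_add (f := f) (g := g))

/-- Bounded complexes over `𝒞` are left orthogonal to the `𝒞`-acyclic ones, so maps out of them need
no fractions. -/
lemma Db.map_bijective {K : BoundedComplex 𝒜} (hK : ∀ i, 𝒞 (K.obj.X i)) (L : BoundedComplex 𝒜) :
    Function.Bijective ((Db.Q 𝒞).map :
      ((BoundedComplex.toKb 𝒜).obj K ⟶ (BoundedComplex.toKb 𝒜).obj L) → _) :=
  (Kb.sub_le_leftOrthogonal 𝒞 _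
    ⟨(HomotopyCategory.quotient _ _).obj K.obj, ⟨K.property, hK⟩, ⟨Iso.refl _⟩⟩).map_bijective_of_isTriangulated (Db.Q 𝒞) _

lemma BoundedComplex.toDb_map_surjective {K L : BoundedComplex 𝒜} (hK : ∀ i, 𝒞 (K.obj.X i))
    (f : (toDb 𝒞).obj K ⟶ (toDb 𝒞).obj L) : ∃ g : K ⟶ L, (toDb 𝒞).map g = f := by
  obtain ⟨g, rfl⟩ := (Db.map_bijective hK L).2 f
  obtain ⟨g, rfl⟩ := toKb_map_surjective g
  exact ⟨g, rfl⟩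

lemma BoundedComplex.toDb_map_eq_zero {K L : BoundedComplex 𝒜} (hK : ∀ i, 𝒞 (K.obj.X i))
    (h : ∀ i, IsZero (K.obj.X i) ∨ IsZero (L.obj.X i))
    (f : (toDb 𝒞).obj K ⟶ (toDb 𝒞).obj L) : f = 0 := by
  obtain ⟨g, rfl⟩ := (Db.map_bijective hK L).2 f
  rw [toKb_map_eq_zero h g, Functor.map_zero]

lemma prop_single_X [𝒞.ContainsZero] [𝒞.IsClosedUnderIsomorphisms] {C : 𝒜} (hC : 𝒞 C) (n i : ℤ) :
    𝒞 (((BoundedComplex.single 𝒜 n).obj C).obj.X i) := by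
  obtain rfl | hi := eq_or_ne i n
  · exact 𝒞.prop_of_iso (HomologicalComplex.singleObjXSelf (ComplexShape.up ℤ) i C).symm hC
  · exact 𝒞.prop_of_isZero (isConcentrated_single C n i (by lia))

/-- Restrict `φ` along a proper cover `p : C ⟶ M`: the result is a genuine map, kills the kernel by
faithfulness, and descends to some `g`. Then `g - φ` factors through `K⟦1⟧ ⟶ N`, which is zero. -/
lemma Db.single_full [𝒞.ContainsZero] [𝒞.IsClosedUnderIsomorphisms]
    (hfin : IsContravariantlyFinite 𝒞) (hadm : IsAdmissible 𝒞) :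
    (Db.single 𝒞).Full where
  map_surjective {M N} φ := by
    have := Db.single_faithful hfin hadm
    obtain ⟨K, C, i, p, h, hC, hS⟩ := exists_isProper hfin hadm M
    have hT := Db.distinguished hfin hadm hS
    obtain ⟨f, hf⟩ := BoundedComplex.toDb_map_surjective (L := (BoundedComplex.single 𝒜 0).obj N)
      (prop_single_X hC 0) ((Db.single 𝒞).map p ≫ φ)
    obtain ⟨f, rfl⟩ : ∃ f', (BoundedComplex.single 𝒜 0).map f' = f := by
      obtain ⟨f', hf'⟩ := (HomologicalComplex.single 𝒜 (ComplexShape.up ℤ) 0).map_surjective f.hom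
      exact ⟨f', by ext : 1; exact hf'⟩
    replace hf : (Db.single 𝒞).map f = (Db.single 𝒞).map p ≫ φ := hf
    obtain ⟨g, rfl⟩ := hS.exists_desc f ((Db.single 𝒞).map_injective (by
      rw [Functor.map_comp, hf, ← Functor.map_comp_assoc, h, Functor.map_zero, Functor.map_zero,
        zero_comp]))
    refine ⟨g, ?_⟩
    obtain ⟨ψ, hψ⟩ := exists_desc₃_of_distTriang hT ((Db.single 𝒞).map g - φ)
      (by rw [Preadditive.comp_sub, ← Functor.map_comp, hf, sub_self])
    rw [← sub_eq_zero, hψ, Db.hom_shift_eq_zero _ _ ψ, comp_zero]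

/-- There are no higher extensions from Gorenstein objects to objects of `𝒞`. -/
lemma Db.hom_single_shift_eq_zero [𝒞.ContainsZero] [𝒞.IsClosedUnderIsomorphisms]
    (hfin : IsContravariantlyFinite 𝒞) (hadm : IsAdmissible 𝒞) {C : 𝒜} (hC : 𝒞 C) (n : ℕ) (m : ℤ)
    (hm : m = n + 1) {M : 𝒜} (hM : gorenstein 𝒞 M)
    (φ : (Db.single 𝒞).obj M ⟶ ((Db.single 𝒞).obj C)⟦m⟧) : φ = 0 := by
  induction n generalizing m M with
  | zero =>
    obtain rfl : m = 1 := by simpa using hm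
    have := Db.single_full hfin hadm
    obtain ⟨K, P, i, p, h, hK, hP, hS, hS'⟩ := gorenstein_exists_syzygy hfin hadm hM
    have hT := Db.distinguished hfin hadm hS
    obtain ⟨ψ, rfl⟩ := exists_desc₃_of_distTriang hT φ (by
      rw [← cancel_mono (Db.singleIso 𝒞 C 1 (-1) (by lia)).inv, zero_comp]
      exact BoundedComplex.toDb_map_eq_zero (K := (BoundedComplex.single 𝒜 0).obj P)
        (prop_single_X hP 0) (fun i => by
          by_cases hi : i = 0
          · exact Or.inr (isConcentrated_single C (-1) i (by lia))
          · exact Or.inl (isConcentrated_single P 0 i (by lia))) _)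
    obtain ⟨ψ, rfl⟩ := (shiftFunctor (Db 𝒞) (1 : ℤ)).map_surjective ψ
    obtain ⟨g, rfl⟩ := (Db.single 𝒞).map_surjective ψ
    -- Coproperness extends `g : K ⟶ C` over `P`, and the connecting morphism followed by `i⟦1⟧` is
    -- zero.
    obtain ⟨g', hg'⟩ := hS' hC g
    obtain rfl : i ≫ g' = g := hg'
    have h₁ : Db.δ hfin hadm hS ≫ ((Db.single 𝒞).map i)⟦(1 : ℤ)⟧' = 0 :=
      comp_distTriang_mor_zero₃₁ _ hT
    rw [Functor.map_comp, Functor.map_comp, ← Category.assoc, h₁, zero_comp]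
  | succ n ih =>
    obtain ⟨K, P, i, p, h, hK, hP, hS, hS'⟩ := gorenstein_exists_syzygy hfin hadm hM
    have hT := Db.distinguished hfin hadm hS
    obtain ⟨ψ, rfl⟩ := exists_desc₃_of_distTriang hT φ (by
      rw [← cancel_mono (Db.singleIso 𝒞 C m (-m) (by lia)).inv, zero_comp]
      exact BoundedComplex.toDb_map_eq_zero (K := (BoundedComplex.single 𝒜 0).obj P)
        (prop_single_X hP 0) (fun i => by
          by_cases hi : i = 0
          · exact Or.inr (isConcentrated_single C (-m) i (by lia))
          · exact Or.inl (isConcentrated_single P 0 i (by lia))) _)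
    -- Dimension shifting: `φ` comes from a map `K⟦1⟧ ⟶ C⟦m⟧`, that is, from `K ⟶ C⟦m - 1⟧`.
    obtain ⟨ψ', hψ'⟩ := (shiftFunctor (Db 𝒞) (1 : ℤ)).map_surjective
      (ψ ≫ (shiftFunctorAdd' (Db 𝒞) (m - 1) 1 m (by lia)).hom.app _)
    rw [ih (m - 1) (by push_cast at hm; lia) hK ψ', Functor.map_zero] at hψ'
    rw [← cancel_mono ((shiftFunctorAdd' (Db 𝒞) (m - 1) 1 m (by lia)).hom.app _),
      Category.assoc, ← hψ', comp_zero, zero_comp]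

end Orthogonality


/-! ### Dévissage by degree, and passage to the singularity category -/

section Peeling

variable {𝒜 : Type u} [Category.{v} 𝒜] [Abelian 𝒜] {𝒞 : ObjectProperty 𝒜}

/-- The component of a complex in its top degree is a subcomplex. -/
lemma exists_shortExact_single (K : CochainComplex 𝒜 ℤ) {a b : ℤ} (hK : IsConcentrated K a b) :
    ∃ (K' : CochainComplex 𝒜 ℤ) (f : (CochainComplex.singleFunctor 𝒜 b).obj (K.X b) ⟶ K)
      (g : K ⟶ K') (w : f ≫ g = 0), (ShortComplex.mk f g w).ShortExact ∧ IsIso (f.f b) := by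
  let f : (CochainComplex.singleFunctor 𝒜 b).obj (K.X b) ⟶ K :=
    HomologicalComplex.mkHomFromSingle (𝟙 _) (fun j hj => (hK j (by
      have : b + 1 = j := hj
      lia)).eq_of_tgt _ _)
  have hfb : IsIso (f.f b) := by
    dsimp only [f]
    rw [HomologicalComplex.mkHomFromSingle_f, Category.comp_id]
    exact Iso.isIso_hom _
  have hf : Mono f := by
    have (i : ℤ) : Mono (f.f i) := by
      obtain rfl | hi := eq_or_ne i b
      · infer_instance
      · exact (isConcentrated_single (K.X b) b i (by lia)).mono _
    exact HomologicalComplex.mono_of_mono_f _ this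
  exact ⟨_, f, cokernel.π f, cokernel.condition f,
    ⟨ShortComplex.exact_cokernel f⟩, hfb⟩

/-- Splitting off the top degree of a complex. -/
lemma exists_distinguished_single (hfin : IsContravariantlyFinite 𝒞) (hadm : IsAdmissible 𝒞)
    (K : BoundedComplex 𝒜) {a b : ℤ} (hK : IsConcentrated K.obj a b) :
    ∃ (K' : BoundedComplex 𝒜)
      (f : (BoundedComplex.toDb 𝒞).obj ((BoundedComplex.single 𝒜 b).obj (K.obj.X b)) ⟶
        (BoundedComplex.toDb 𝒞).obj K)
      (g : (BoundedComplex.toDb 𝒞).obj K ⟶ (BoundedComplex.toDb 𝒞).obj K')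
      (h : (BoundedComplex.toDb 𝒞).obj K' ⟶ _), Triangle.mk f g h ∈ distTriang (Db 𝒞) ∧
      IsConcentrated K'.obj a (b - 1) ∧
      ∀ i, IsZero (K'.obj.X i) ∨ Nonempty (K.obj.X i ≅ K'.obj.X i) := by
  obtain ⟨K', f, g, w, hS, hf⟩ := exists_shortExact_single K.obj hK
  have hSi (i : ℤ) := hS.map_of_exact (HomologicalComplex.eval 𝒜 (ComplexShape.up ℤ) i)
  have hb : IsZero (K'.X b) := by
    have : Epi (g.f b) := (hSi b).epi_g
    have h0 : f.f b ≫ g.f b = 0 := by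
      rw [← HomologicalComplex.comp_f, w, HomologicalComplex.zero_f]
    rw [IsZero.iff_id_eq_zero, ← cancel_epi (g.f b), ← cancel_epi (f.f b), reassoc_of% h0]
    simp
  have hi (i : ℤ) (hi : i ≠ b) : IsIso (g.f i) :=
    (hSi i).isIso_g_iff.2 (isConcentrated_single (K.obj.X b) b i (by lia))
  have hi' (i : ℤ) : IsZero (K'.X i) ∨ Nonempty (K.obj.X i ≅ K'.X i) := by
    obtain rfl | h := eq_or_ne i b
    · exact Or.inl hb
    · have := hi i h
      exact Or.inr ⟨asIso (g.f i)⟩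
  have hK' : IsConcentrated K' a (b - 1) := by
    intro i h
    obtain rfl | h' := eq_or_ne i b
    · exact hb
    · have := hi i h'
      exact (hK i (by lia)).of_iso (asIso (g.f i)).symm
  obtain ⟨δ, hδ⟩ := exists_distinguished_of_isProper hfin hadm
    (K := (BoundedComplex.single 𝒜 b).obj (K.obj.X b)) (L := K) (M := ⟨K', a, b - 1, hK'⟩)
    -- In degree `b` the quotient vanishes and in every other degree `g` is invertible, so lifting
    -- is trivial degreewise.
    (ObjectProperty.homMk f) (ObjectProperty.homMk g) w (fun i => ⟨hSi i, fun C _ y => by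
      obtain rfl | h := eq_or_ne i b
      · exact ⟨0, hb.eq_of_tgt _ _⟩
      · have := hi i h
        exact ⟨y ≫ inv (g.f i), by simp⟩⟩)
  exact ⟨⟨K', a, b - 1, hK'⟩, _, _, δ, hδ, hK', hi'⟩

lemma BoundedComplex.isZero_toDb {K : BoundedComplex 𝒜} (hK : ∀ i, IsZero (K.obj.X i)) :
    IsZero ((toDb 𝒞).obj K) := by
  refine (Db.Q 𝒞).map_isZero ?_
  rw [IsZero.iff_id_eq_zero]
  exact toKb_map_eq_zero (fun i => Or.inl (hK i)) _

variable [𝒞.ContainsZero] [𝒞.IsClosedUnderIsomorphisms]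

/-- There are no nonzero maps from Gorenstein objects to complexes in `𝒞` concentrated in
negative degrees. -/
lemma Db.hom_eq_zero_of_gorenstein (hfin : IsContravariantlyFinite 𝒞) (hadm : IsAdmissible 𝒞)
    (n : ℕ) {M : 𝒜} (hM : gorenstein 𝒞 M) (P : BoundedComplex 𝒜) (hP : ∀ i, 𝒞 (P.obj.X i))
    {a b : ℤ} (hb : b < 0) (hab : b < a + n) (hP' : IsConcentrated P.obj a b)
    (φ : (Db.single 𝒞).obj M ⟶ (BoundedComplex.toDb 𝒞).obj P) : φ = 0 := by
  induction n generalizing b P with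
  | zero =>
    exact (BoundedComplex.isZero_toDb (fun i => hP' i (by lia))).eq_of_tgt _ _
  | succ n ih =>
    obtain ⟨P', f, g, h, hT, h₁, h₂⟩ := exists_distinguished_single hfin hadm P hP'
    have := ih P' (fun i => by
      obtain h | ⟨⟨e⟩⟩ := h₂ i
      · exact 𝒞.prop_of_isZero h
      · exact 𝒞.prop_of_iso e (hP i)) (b := b - 1) (by lia) (by push_cast at hab; lia) h₁ (φ ≫ g)
    obtain ⟨ψ, rfl⟩ := exists_lift₂_of_distTriang hT φ this
    -- The top term sits in degree `b < 0`, so it is `C⟦-b⟧` with `-b ≥ 1`, a positive extension.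
    have hψ : ψ ≫ (Db.singleIso 𝒞 (P.obj.X b) (-b) b (by lia)).hom = 0 :=
      Db.hom_single_shift_eq_zero hfin hadm (hP b) (-b - 1).toNat (-b) (by lia) hM _
    rw [(cancel_mono _).1 (hψ.trans zero_comp.symm), zero_comp]

/-- Maps from complexes in `𝒞` to complexes in degree `-1` factor through complexes in `𝒞`
concentrated in negative degrees. -/
lemma Db.exists_factorization_of_complex (hfin : IsContravariantlyFinite 𝒞)
    (hadm : IsAdmissible 𝒞)
    (n : ℕ) (N : 𝒜) (P : BoundedComplex 𝒜) (hP : ∀ i, 𝒞 (P.obj.X i))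
    {a b : ℤ} (hb : b < n) (hP' : IsConcentrated P.obj a b)
    (φ : (BoundedComplex.toDb 𝒞).obj P ⟶ ((Db.single 𝒞).obj N)⟦(1 : ℤ)⟧) :
    ∃ (P' : BoundedComplex 𝒜) (_ : ∀ i, 𝒞 (P'.obj.X i))
      (_ : ∃ a b : ℤ, b < 0 ∧ IsConcentrated P'.obj a b)
      (q : (BoundedComplex.toDb 𝒞).obj P ⟶ (BoundedComplex.toDb 𝒞).obj P')
      (ψ : (BoundedComplex.toDb 𝒞).obj P' ⟶ ((Db.single 𝒞).obj N)⟦(1 : ℤ)⟧), φ = q ≫ ψ := by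
  induction n generalizing b P with
  | zero => exact ⟨P, hP, ⟨a, b, by lia, hP'⟩, 𝟙 _, φ, (Category.id_comp φ).symm⟩
  | succ n ih =>
    by_cases hb0 : b < 0
    · exact ⟨P, hP, ⟨a, b, hb0, hP'⟩, 𝟙 _, φ, (Category.id_comp φ).symm⟩
    obtain ⟨P₁, f, g, h, hT, h₁, h₂⟩ := exists_distinguished_single hfin hadm P hP'
    -- Here `b ≥ 0` while `N⟦1⟧` lives in degree `-1`: the top term maps to it by zero, so `φ`
    -- factors through the quotient.
    have hf : f ≫ φ = 0 := by
      have : (f ≫ φ) ≫ (Db.singleIso 𝒞 N 1 (-1) (by lia)).inv = 0 :=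
        BoundedComplex.toDb_map_eq_zero (prop_single_X (hP b) b) (fun i => by
          by_cases hi : i = b
          · exact Or.inr (isConcentrated_single N (-1) i (by lia))
          · exact Or.inl (isConcentrated_single _ b i (by lia))) _
      exact (cancel_mono _).1 (this.trans zero_comp.symm)
    obtain ⟨φ', rfl⟩ := exists_desc₂_of_distTriang hT φ hf
    obtain ⟨P', h₃, h₄, q, ψ, rfl⟩ := ih P₁ (fun i => by
      obtain h | ⟨⟨e⟩⟩ := h₂ i
      · exact 𝒞.prop_of_isZero h
      · exact 𝒞.prop_of_iso e (hP i)) (b := b - 1) (by push_cast at hb; lia) h₁ φ'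
    exact ⟨P', h₃, h₄, g ≫ q, ψ, (Category.assoc _ _ _).symm⟩

variable [𝒞.IsClosedUnderBinaryProducts]

lemma Db.sub_toDb {P : BoundedComplex 𝒜} (hP : ∀ i, 𝒞 (P.obj.X i)) :
    Db.sub 𝒞 ((BoundedComplex.toDb 𝒞).obj P) :=
  ⟨⟨(BoundedComplex.toKb 𝒜).obj P, (HomotopyCategory.quotient _ _).obj P.obj, ⟨P.property, hP⟩,
    ⟨Iso.refl _⟩⟩, ⟨Iso.refl _⟩⟩

lemma Db.sub_exists_iso {X : Db 𝒞} (hX : Db.sub 𝒞 X) :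
    ∃ (P : BoundedComplex 𝒜) (_ : ∀ i, 𝒞 (P.obj.X i)),
      Nonempty (X ≅ (BoundedComplex.toDb 𝒞).obj P) := by
  obtain ⟨⟨Y, Z, ⟨h₁, h₂⟩, ⟨e⟩⟩, ⟨e'⟩⟩ := hX
  exact ⟨⟨Z.as, h₁⟩, h₂, ⟨e'.symm ≪≫ (Db.Q 𝒞).mapIso ((Kb.ι 𝒜).preimageIso e)⟩⟩

/-- The common source of faithfulness and fullness: the intermediate `Y` stays in `K^b(𝒞)` but
receives no maps from Gorenstein objects. -/
lemma Db.exists_factorization (hfin : IsContravariantlyFinite 𝒞) (hadm : IsAdmissible 𝒞)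
    (N : 𝒜) {X : Db 𝒞} (hX : Db.sub 𝒞 X) (φ : X ⟶ ((Db.single 𝒞).obj N)⟦(1 : ℤ)⟧) :
    ∃ (Y : Db 𝒞) (q : X ⟶ Y) (ψ : Y ⟶ ((Db.single 𝒞).obj N)⟦(1 : ℤ)⟧), Db.sub 𝒞 Y ∧ φ = q ≫ ψ ∧
      ∀ (M : 𝒜) (_ : gorenstein 𝒞 M) (χ : (Db.single 𝒞).obj M ⟶ Y), χ = 0 := by
  obtain ⟨P, hP, ⟨e⟩⟩ := Db.sub_exists_iso hX
  obtain ⟨a, b, hab⟩ := P.property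
  obtain ⟨P', h₁, ⟨a', b', hb', hab'⟩, q, ψ, h⟩ := Db.exists_factorization_of_complex hfin hadm
    (b + 1).toNat N P hP (by lia) hab (e.inv ≫ φ)
  refine ⟨_, e.hom ≫ q, ψ, Db.sub_toDb h₁, ?_, fun M hM χ =>
    Db.hom_eq_zero_of_gorenstein hfin hadm (b' - a' + 1).toNat hM P' h₁ hb' (by lia) hab' χ⟩
  rw [Category.assoc, ← h, Iso.hom_inv_id_assoc]

lemma Db.comp_eq_zero_of_sub (hfin : IsContravariantlyFinite 𝒞) (hadm : IsAdmissible 𝒞)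
    {M N : 𝒜} (hM : gorenstein 𝒞 M) {X : Db 𝒞} (hX : Db.sub 𝒞 X)
    (φ : (Db.single 𝒞).obj M ⟶ X) (ψ : X ⟶ ((Db.single 𝒞).obj N)⟦(1 : ℤ)⟧) : φ ≫ ψ = 0 := by
  obtain ⟨Y, q, ψ, hY, rfl, h⟩ := Db.exists_factorization hfin hadm N hX ψ
  rw [← Category.assoc, h M hM (φ ≫ q), zero_comp]

/-- First extensions of Gorenstein objects embed into the singularity category. -/
lemma Dsg.eq_zero_of_map_eq_zero (hfin : IsContravariantlyFinite 𝒞) (hadm : IsAdmissible 𝒞)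
    {M N : 𝒜} (hM : gorenstein 𝒞 M)
    (φ : (Db.single 𝒞).obj M ⟶ ((Db.single 𝒞).obj N)⟦(1 : ℤ)⟧) (hφ : (Dsg.Q 𝒞).map φ = 0) :
    φ = 0 := by
  obtain ⟨X, s, hs, hs'⟩ := (MorphismProperty.map_eq_iff_precomp (Dsg.Q 𝒞) (Db.sub 𝒞).trW φ 0).1
    (by rw [hφ, Functor.map_zero])
  rw [ObjectProperty.trW_iff] at hs
  obtain ⟨P, g, h, hT, hP⟩ := hs
  obtain ⟨ψ, rfl⟩ := exists_desc₂_of_distTriang hT φ (by rw [hs', comp_zero])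
  exact Db.comp_eq_zero_of_sub hfin hadm hM hP g ψ

/-- Maps in the singularity category between Gorenstein objects come from `D^b_𝒞(𝒜)`. -/
lemma Dsg.map_surjective (hfin : IsContravariantlyFinite 𝒞) (hadm : IsAdmissible 𝒞)
    {M N : 𝒜} (hM : gorenstein 𝒞 M)
    (φ : (Dsg.Q 𝒞).obj ((Db.single 𝒞).obj M) ⟶ (Dsg.Q 𝒞).obj ((Db.single 𝒞).obj N)) :
    ∃ ψ, (Dsg.Q 𝒞).map ψ = φ := by
  obtain ⟨⟨f, s, hs⟩, rfl⟩ := Localization.exists_leftFraction (Dsg.Q 𝒞) (Db.sub 𝒞).trW φ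
  rename_i Y
  have hs₀ := hs
  rw [ObjectProperty.trW_iff] at hs₀
  obtain ⟨P, g, h, hT, hP⟩ := hs₀
  -- With `N ⟶ Y ⟶ P ⟶ N⟦1⟧` the triangle of the denominator, factor the last map through `P'` and
  -- let `Y'` complete `P' ⟶ N⟦1⟧` to a triangle. The denominator is replaced by `s' : N ⟶ Y'`, and
  -- `M ⟶ Y'` lifts to `N` because `M ⟶ P'` is zero.
  obtain ⟨P', q, h', hP', rfl, hzero⟩ := Db.exists_factorization hfin hadm N hP h
  obtain ⟨Y', s', g', hT'⟩ := distinguished_cocone_triangle₂ h'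
  have hs' : (Db.sub 𝒞).trW s' := by
    rw [ObjectProperty.trW_iff]
    exact ⟨_, _, _, hT', hP'⟩
  obtain ⟨y, hy, hy'⟩ : ∃ y : Y ⟶ Y', s ≫ y = 𝟙 _ ≫ s' ∧ g ≫ q = y ≫ g' :=
    exists_hom₂_of_distTriang hT hT' (𝟙 _) q (by rw [CategoryTheory.Functor.map_id, Category.comp_id])
  obtain ⟨k, hk⟩ := exists_lift₂_of_distTriang hT' (f ≫ y)
    (hzero M hM _)
  rw [Category.id_comp] at hy
  have i₁ := Localization.inverts (Dsg.Q 𝒞) _ _ hs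
  have i₂ := Localization.inverts (Dsg.Q 𝒞) _ _ hs'
  have i₃ : IsIso ((Dsg.Q 𝒞).map y) := by
    rw [← hy, Functor.map_comp] at i₂
    exact IsIso.of_isIso_comp_left ((Dsg.Q 𝒞).map s) _
  refine ⟨k, ?_⟩
  rw [← cancel_mono ((Dsg.Q 𝒞).map s), ← cancel_mono ((Dsg.Q 𝒞).map y)]
  rw [show MorphismProperty.LeftFraction.map _ _ _ ≫ (Dsg.Q 𝒞).map s = (Dsg.Q 𝒞).map f from
    MorphismProperty.LeftFraction.map_comp_map_s _ _ _, Category.assoc, ← Functor.map_comp, hy, ← Functor.map_comp, ← hk, Functor.map_comp]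

end Peeling


/-! ### The functor from modules to the singularity category -/

lemma VerdierQuotient.isZero_obj {T : Type u} [Category.{v} T] [HasZeroObject T] [HasShift T ℤ]
    [Preadditive T] [∀ n : ℤ, (shiftFunctor T n).Additive] [Pretriangulated T] [IsTriangulated T]
    (P : ObjectProperty T) [P.IsTriangulated] {X : T} (hX : P X) :
    IsZero ((VerdierQuotient.Q P).obj X) := by
  have h : P.trW (0 : 0 ⟶ X) := ⟨_, _, _, contractible_distinguished₁ X, hX⟩
  have := Localization.inverts (VerdierQuotient.Q P) _ _ h
  exact ((VerdierQuotient.Q P).map_isZero (isZero_zero T)).of_iso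
    (asIso ((VerdierQuotient.Q P).map (0 : 0 ⟶ X))).symm

section Singularity

variable {𝒜 : Type u} [Category.{v} 𝒜] [Abelian 𝒜] {𝒞 : ObjectProperty 𝒜}
  [𝒞.ContainsZero] [𝒞.IsClosedUnderIsomorphisms] [𝒞.IsClosedUnderBinaryProducts]

variable (𝒞) in
/-- The functor `𝒜 ⥤ D_{𝒞-sg}(𝒜)`. -/
abbrev Dsg.single : 𝒜 ⥤ Dsg 𝒞 := Db.single 𝒞 ⋙ Dsg.Q 𝒞

instance : (theta 𝒞).Additive where
  map_add {_ _ f g} := (Dsg.single 𝒞).map_add (f := f.hom) (g := g.hom)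

lemma Dsg.isZero_single {C : 𝒜} (hC : 𝒞 C) : IsZero ((Dsg.single 𝒞).obj C) :=
  VerdierQuotient.isZero_obj (Db.sub 𝒞)
    (Db.sub_toDb (P := (BoundedComplex.single 𝒜 0).obj C) (prop_single_X hC 0))

/-- The connecting morphism in the singularity category. -/
def Dsg.δ (hfin : IsContravariantlyFinite 𝒞) (hadm : IsAdmissible 𝒞)
    {X Y Z : 𝒜} {i : X ⟶ Y} {p : Y ⟶ Z} {hip : i ≫ p = 0}
    (hS : IsProper 𝒞 (ShortComplex.mk i p hip)) :
    (Dsg.single 𝒞).obj Z ⟶ ((Dsg.single 𝒞).obj X)⟦(1 : ℤ)⟧ :=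
  (Dsg.Q 𝒞).map (Db.δ hfin hadm hS) ≫ ((Dsg.Q 𝒞).commShiftIso (1 : ℤ)).hom.app _

lemma Dsg.distinguished (hfin : IsContravariantlyFinite 𝒞) (hadm : IsAdmissible 𝒞)
    {X Y Z : 𝒜} {i : X ⟶ Y} {p : Y ⟶ Z} {hip : i ≫ p = 0}
    (hS : IsProper 𝒞 (ShortComplex.mk i p hip)) :
    Triangle.mk ((Dsg.single 𝒞).map i) ((Dsg.single 𝒞).map p) (Dsg.δ hfin hadm hS) ∈
      distTriang (Dsg 𝒞) :=
  (Dsg.Q 𝒞).map_distinguished _ (Db.distinguished hfin hadm hS)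

lemma Dsg.δ_naturality (hfin : IsContravariantlyFinite 𝒞) (hadm : IsAdmissible 𝒞)
    {X Y Z : 𝒜} {i : X ⟶ Y} {p : Y ⟶ Z} {hip : i ≫ p = 0}
    (hS : IsProper 𝒞 (ShortComplex.mk i p hip))
    {X' Y' Z' : 𝒜} {i' : X' ⟶ Y'} {p' : Y' ⟶ Z'} {hip' : i' ≫ p' = 0}
    (hS' : IsProper 𝒞 (ShortComplex.mk i' p' hip')) (a : X ⟶ X') (b : Y ⟶ Y') (c : Z ⟶ Z')
    (h₁ : i ≫ b = a ≫ i') (h₂ : p ≫ c = b ≫ p') :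
    (Dsg.single 𝒞).map c ≫ Dsg.δ hfin hadm hS' =
      Dsg.δ hfin hadm hS ≫ ((Dsg.single 𝒞).map a)⟦(1 : ℤ)⟧' := by
  have h := congr_arg (Dsg.Q 𝒞).map (Db.δ_naturality hfin hadm hS hS' a b c h₁ h₂)
  rw [Functor.map_comp, Functor.map_comp] at h
  have h' := ((Dsg.Q 𝒞).commShiftIso (1 : ℤ)).hom.naturality ((Db.single 𝒞).map a)
  refine (Category.assoc _ _ _).symm.trans ?_
  refine (congr_arg (fun φ => φ ≫ ((Dsg.Q 𝒞).commShiftIso (1 : ℤ)).hom.app _) h).trans ?_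
  refine (Category.assoc _ _ _).trans ?_
  exact (congr_arg (fun φ => (Dsg.Q 𝒞).map (Db.δ hfin hadm hS) ≫ φ) h').trans
    (Category.assoc _ _ _).symm

lemma Dsg.isIso_δ (hfin : IsContravariantlyFinite 𝒞) (hadm : IsAdmissible 𝒞)
    {X Y Z : 𝒜} {i : X ⟶ Y} {p : Y ⟶ Z} {hip : i ≫ p = 0}
    (hS : IsProper 𝒞 (ShortComplex.mk i p hip)) (hY : 𝒞 Y) : IsIso (Dsg.δ hfin hadm hS) :=
  (Triangle.isZero₂_iff_isIso₃ _ (Dsg.distinguished hfin hadm hS)).1 (Dsg.isZero_single hY)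

lemma Dsg.isIso_neg_δ (hfin : IsContravariantlyFinite 𝒞) (hadm : IsAdmissible 𝒞)
    {X Y Z : 𝒜} {i : X ⟶ Y} {p : Y ⟶ Z} {hip : i ≫ p = 0}
    (hS : IsProper 𝒞 (ShortComplex.mk i p hip)) (hY : 𝒞 Y) : IsIso (-Dsg.δ hfin hadm hS) := by
  have := Dsg.isIso_δ hfin hadm hS hY
  exact ⟨-inv (Dsg.δ hfin hadm hS), by simp, by simp⟩

/-- The standard triangle of a push-out is distinguished in the singularity category. -/
lemma Dsg.distinguished_pushout (hfin : IsContravariantlyFinite 𝒞) (hadm : IsAdmissible 𝒞)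
    {X I Y M Z : 𝒜} {i : X ⟶ I} {p : I ⟶ Y} {hip : i ≫ p = 0}
    (hS : IsProper 𝒞 (ShortComplex.mk i p hip)) (hI : 𝒞 I) {u : X ⟶ M} {b : I ⟶ Z} {v : M ⟶ Z}
    (sq : IsPushout i u b v) {w : Z ⟶ Y} (hb : b ≫ w = p) (hv : v ≫ w = 0) :
    Triangle.mk ((Dsg.single 𝒞).map u) ((Dsg.single 𝒞).map v)
      ((Dsg.single 𝒞).map w ≫ (-Dsg.δ hfin hadm hS)) ∈ distTriang (Dsg 𝒞) := by
  have hT := hS.pushout_biprod sq hb hv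
    (by rw [biprod.lift_desc, Preadditive.neg_comp, sq.w, neg_add_cancel])
  -- This morphism of sequences is the identity on `X`; the sign in `lift (-i) u` forces `-w` on the
  -- quotients, whence the sign in front of the connecting morphism.
  have h := Dsg.δ_naturality hfin hadm hT hS (𝟙 X) (-biprod.fst) (-w)
    (by rw [Preadditive.comp_neg, biprod.lift_fst, neg_neg, Category.id_comp])
    (by ext <;> simp [hb, hv])
  rw [Functor.map_neg, CategoryTheory.Functor.map_id, CategoryTheory.Functor.map_id,
    Category.comp_id, Preadditive.neg_comp] at h
  have hz : (Dsg.single 𝒞).map (biprod.inl : I ⟶ I ⊞ M) = 0 :=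
    (Dsg.isZero_single hI).eq_of_src _ _
  -- The summand `I` vanishes in the singularity category.
  let e : (Dsg.single 𝒞).obj M ≅ (Dsg.single 𝒞).obj (I ⊞ M) :=
    { hom := (Dsg.single 𝒞).map biprod.inr
      inv := (Dsg.single 𝒞).map biprod.snd
      hom_inv_id := by rw [← Functor.map_comp, biprod.inr_snd, CategoryTheory.Functor.map_id]
      inv_hom_id := by
        have : 𝟙 (I ⊞ M) = biprod.fst ≫ biprod.inl + biprod.snd ≫ biprod.inr := biprod.total.symm
        rw [← CategoryTheory.Functor.map_id, this, Functor.map_add, Functor.map_comp,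
          Functor.map_comp, hz, comp_zero, zero_add] }
  refine mem_distTriang_of_iso (Dsg.distinguished hfin hadm hT) (Iso.refl _) e (Iso.refl _) ?_ ?_ ?_
  · have : biprod.lift (-i) u = (-i) ≫ biprod.inl + u ≫ biprod.inr := by ext <;> simp
    rw [Iso.refl_hom, Category.id_comp, this, Functor.map_add, Functor.map_comp, hz, comp_zero,
      zero_add, Functor.map_comp]
  · rw [Iso.refl_hom, Category.comp_id, ← Functor.map_comp, biprod.inr_desc]
  · rw [Iso.refl_hom, Iso.refl_hom, CategoryTheory.Functor.map_id, Category.comp_id,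
      Category.id_comp, Preadditive.comp_neg, h]

lemma theta_full (hfin : IsContravariantlyFinite 𝒞) (hadm : IsAdmissible 𝒞) :
    (theta 𝒞).Full where
  map_surjective {X Y} φ := by
    have := Db.single_full hfin hadm
    obtain ⟨ψ, rfl⟩ := Dsg.map_surjective hfin hadm X.property φ
    obtain ⟨f, rfl⟩ := (Db.single 𝒞).map_surjective ψ
    exact ⟨ObjectProperty.homMk f, rfl⟩

/-- Morphisms that vanish in the singularity category factor through an object of `𝒞`. -/
lemma exists_factorization_of_map_eq_zero (hfin : IsContravariantlyFinite 𝒞)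
    (hadm : IsAdmissible 𝒞) {X Y : 𝒜} (hX : gorenstein 𝒞 X) (f : X ⟶ Y)
    (hf : (Dsg.single 𝒞).map f = 0) : ∃ (C : 𝒜) (a : X ⟶ C) (b : C ⟶ Y), 𝒞 C ∧ a ≫ b = f := by
  have := Db.single_full hfin hadm
  have := Db.single_faithful hfin hadm
  obtain ⟨Q, N, i, p, h, hQ, hN, hS, -⟩ := gorenstein_exists_cosyzygy hfin hadm hX
  -- The class of the push-out extension along `f` dies in the singularity category, and first
  -- extensions of the Gorenstein object `N` embed there.
  have hδ : Db.δ hfin hadm hS ≫ ((Db.single 𝒞).map f)⟦(1 : ℤ)⟧' = 0 := by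
    refine Dsg.eq_zero_of_map_eq_zero hfin hadm hN _ ?_
    rw [Functor.map_comp]
    have h' := ((Dsg.Q 𝒞).commShiftIso (1 : ℤ)).hom.naturality ((Db.single 𝒞).map f)
    have h'' : (Dsg.Q 𝒞).map (((Db.single 𝒞).map f)⟦(1 : ℤ)⟧') = 0 := by
      rw [← cancel_mono (((Dsg.Q 𝒞).commShiftIso (1 : ℤ)).hom.app _), zero_comp]
      refine h'.trans ?_
      refine (congr_arg (fun φ => _ ≫ φ⟦(1 : ℤ)⟧') hf).trans ?_
      rw [Functor.map_zero, comp_zero]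
    rw [h'', comp_zero]
  -- Mapping to the contractible triangle on `Y` extends `f` along `i` to the object `Q` of `𝒞`.
  obtain ⟨b, hb, -⟩ := exists_hom₂_of_distTriang (Db.distinguished hfin hadm hS)
    (contractible_distinguished ((Db.single 𝒞).obj Y)) ((Db.single 𝒞).map f) 0
    (hδ.trans zero_comp.symm)
  obtain ⟨b, rfl⟩ := (Db.single 𝒞).map_surjective b
  refine ⟨Q, i, b, hQ, (Db.single 𝒞).map_injective ?_⟩
  rw [Functor.map_comp, hb, Category.comp_id]

end Singularity

/-! ### The kernel of `θ` -/

section Stable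

variable {𝒜 : Type u} [Category.{v} 𝒜] [Abelian 𝒜] {𝒞 : ObjectProperty 𝒜}
  [𝒞.ContainsZero] [𝒞.IsStableUnderRetracts] [𝒞.IsClosedUnderBinaryProducts]

lemma theta_map_eq_iff (hfin : IsContravariantlyFinite 𝒞)
    (hadm : IsAdmissible 𝒞) {X Y : (gorenstein 𝒞).FullSubcategory} (f g : X ⟶ Y) :
    (theta 𝒞).map f = (theta 𝒞).map g ↔ stableRel (gorensteinConflations 𝒞) f g := by
  constructor
  · intro h
    have h₀ : (theta 𝒞).map (f - g) = 0 := by rw [Functor.map_sub, h, sub_self]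
    obtain ⟨C, a, b, hC, hab⟩ := exists_factorization_of_map_eq_zero hfin hadm X.property
      (f - g).hom h₀
    exact ⟨⟨C, le_gorenstein_self hfin hadm _ hC⟩, ObjectProperty.homMk a, ObjectProperty.homMk b,
      (isRelProjective_iff hfin hadm _).2 hC, by ext; exact hab.symm⟩
  · rintro ⟨P, a, b, hP, h⟩
    rw [isRelProjective_iff hfin hadm] at hP
    have hz : (theta 𝒞).map a = 0 := (Dsg.isZero_single hP).eq_of_tgt _ _
    rw [← sub_eq_zero, ← Functor.map_sub, h, Functor.map_comp, hz, zero_comp]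

end Stable


/-! ### Essential surjectivity -/

lemma exists_hasProperResolutionOfLength {𝒜 : Type u} [Category.{v} 𝒜] [Abelian 𝒜]
    {𝒞 𝒟 : ObjectProperty 𝒜}
    (hdim : properGlobalDim 𝒞 𝒟 < ⊤) (M : 𝒜) : ∃ n, HasProperResolutionOfLength 𝒞 𝒟 M n := by
  by_contra! hM
  have h : properDim 𝒞 𝒟 M ≤ properGlobalDim 𝒞 𝒟 := le_iSup (properDim 𝒞 𝒟) M
  -- An infimum over the empty family is `⊤`.
  have h' : properDim 𝒞 𝒟 M = ⊤ := by simp [properDim, hM]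
  exact (lt_of_le_of_lt h hdim).ne h'

section EssSurj

variable {𝒜 : Type u} [Category.{v} 𝒜] [Abelian 𝒜] {𝒞 : ObjectProperty 𝒜}
  [𝒞.ContainsZero] [𝒞.IsClosedUnderIsomorphisms] [𝒞.IsClosedUnderBinaryProducts]

/-- In a cosyzygy sequence the middle term becomes zero, so the connecting morphism identifies the
cosyzygy with the shift; syzygies give the inverse shift. -/
lemma theta_essImage_shift (hfin : IsContravariantlyFinite 𝒞) (hadm : IsAdmissible 𝒞)
    {X : Dsg 𝒞} (hX : (theta 𝒞).essImage X) : (theta 𝒞).essImage (X⟦(1 : ℤ)⟧) := by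
  obtain ⟨M, ⟨e⟩⟩ := hX
  obtain ⟨Q, N, i, p, h, hQ, hN, hS, -⟩ := gorenstein_exists_cosyzygy hfin hadm M.property
  have := Dsg.isIso_δ hfin hadm hS hQ
  exact ⟨⟨N, hN⟩, ⟨(@asIso _ _ _ _ (Dsg.δ hfin hadm hS) this) ≪≫ (shiftFunctor (Dsg 𝒞) (1 : ℤ)).mapIso e⟩⟩

lemma theta_essImage_shift_neg (hfin : IsContravariantlyFinite 𝒞) (hadm : IsAdmissible 𝒞)
    {X : Dsg 𝒞} (hX : (theta 𝒞).essImage X) : (theta 𝒞).essImage (X⟦(-1 : ℤ)⟧) := by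
  obtain ⟨M, ⟨e⟩⟩ := hX
  obtain ⟨K, P, i, p, h, hK, hP, hS, -⟩ := gorenstein_exists_syzygy hfin hadm M.property
  have := Dsg.isIso_δ hfin hadm hS hP
  exact ⟨⟨K, hK⟩, ⟨(shiftShiftNeg ((Dsg.single 𝒞).obj K) (1 : ℤ)).symm ≪≫
    (shiftFunctor (Dsg 𝒞) (-1 : ℤ)).mapIso ((asIso (Dsg.δ hfin hadm hS)).symm ≪≫ e)⟩⟩

/-- Since `θ` is full, a map between objects of the image comes from a map of Gorenstein objects;
its cone is the push-out along a cosyzygy sequence, Gorenstein by closure under extensions. -/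
lemma isTriangulated_essImage_theta (hfin : IsContravariantlyFinite 𝒞) (hadm : IsAdmissible 𝒞) :
    (theta 𝒞).essImage.IsTriangulated := by
  have : (theta 𝒞).essImage.IsStableUnderShift ℤ :=
    { isStableUnderShiftBy n := ⟨by
        intro X hX
        rw [ObjectProperty.prop_shift_iff]
        induction n using Int.induction_on with
        | zero => exact (theta 𝒞).essImage.prop_of_iso ((shiftFunctorZero (Dsg 𝒞) ℤ).symm.app X) hX
        | succ n ih =>
          exact (theta 𝒞).essImage.prop_of_iso ((shiftFunctorAdd' (Dsg 𝒞) (n : ℤ) 1 _ rfl).symm.app X)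
            (theta_essImage_shift hfin hadm ih)
        | pred n ih =>
          exact (theta 𝒞).essImage.prop_of_iso
            ((shiftFunctorAdd' (Dsg 𝒞) (-n : ℤ) (-1) _ rfl).symm.app X)
            (theta_essImage_shift_neg hfin hadm ih)⟩ }
  have : (theta 𝒞).essImage.IsTriangulatedClosed₃ := .mk' (by
    rintro T hT ⟨X, ⟨e₁⟩⟩ ⟨M, ⟨e₂⟩⟩
    have := theta_full hfin hadm
    obtain ⟨u, hu⟩ := (theta 𝒞).map_surjective (e₁.hom ≫ T.mor₁ ≫ e₂.inv)
    obtain ⟨I, Y, i, p, h, hI, hY, hS, -⟩ := gorenstein_exists_cosyzygy hfin hadm X.property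
    have sq := IsPushout.of_hasPushout i u.hom
    have hZ := gorenstein_of_isProper hfin hadm
      (hS.pushout sq (w := pushout.desc p 0 (by rw [h, comp_zero])) (pushout.inl_desc _ _ _)
      (pushout.inr_desc _ _ _)) M.property hY
    have hT' := Dsg.distinguished_pushout hfin hadm hS hI sq
      (w := pushout.desc p 0 (by rw [h, comp_zero])) (pushout.inl_desc _ _ _)
      (pushout.inr_desc _ _ _)
    exact ⟨⟨_, hZ⟩, ⟨Triangle.π₃.mapIso (isoTriangleOfIso₁₂ _ _ hT' hT e₁ e₂ (by
      refine (congr_arg (fun φ => φ ≫ e₂.hom) hu).trans ?_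
      exact (Category.assoc _ _ _).trans (congr_arg (fun φ => e₁.hom ≫ φ)
        ((Category.assoc _ _ _).trans ((congr_arg (fun φ => T.mor₁ ≫ φ) e₂.inv_hom_id).trans
          (Category.comp_id _))))))⟩⟩)
  exact
    { exists_zero := ⟨_, Dsg.isZero_single (𝒞.prop_of_isZero (isZero_zero 𝒜)),
        ⟨⟨0, le_gorenstein_self hfin hadm _ (𝒞.prop_of_isZero (isZero_zero 𝒜))⟩,
          ⟨Iso.refl _⟩⟩⟩
      toIsTriangulatedClosed₂ := .of_isTriangulatedClosed₃ }

/-- The image in the singularity category of a complex concentrated in one degree. -/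
def Dsg.singleIso (X : 𝒜) (n : ℤ) :
    (Dsg.Q 𝒞).obj ((BoundedComplex.toDb 𝒞).obj ((BoundedComplex.single 𝒜 n).obj X)) ≅
      ((Dsg.single 𝒞).obj X)⟦-n⟧ :=
  (Dsg.Q 𝒞).mapIso (Db.singleIso 𝒞 X (-n) n (by lia)) ≪≫ ((Dsg.Q 𝒞).commShiftIso (-n)).app _

/-- Induction on the width of the complex, splitting off its top term, which is a shifted module. -/
lemma Dsg.prop_toDb_of_forall (hfin : IsContravariantlyFinite 𝒞) (hadm : IsAdmissible 𝒞)
    (E : ObjectProperty (Dsg 𝒞)) [E.IsTriangulated] [E.IsClosedUnderIsomorphisms] (n : ℕ)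
    (K : BoundedComplex 𝒜) {a b : ℤ} (hab : b < a + n) (hK : IsConcentrated K.obj a b)
    (h : ∀ i, E ((Dsg.single 𝒞).obj (K.obj.X i))) :
    E ((Dsg.Q 𝒞).obj ((BoundedComplex.toDb 𝒞).obj K)) := by
  induction n generalizing K b with
  | zero =>
    exact E.prop_of_isZero ((Dsg.Q 𝒞).map_isZero
      (BoundedComplex.isZero_toDb (fun i => hK i (by lia))))
  | succ n ih =>
    obtain ⟨K', f, g, δ, hT, h₁, h₂⟩ := exists_distinguished_single hfin hadm K hK
    have h₃ := ih K' (b := b - 1) (by push_cast at hab; lia) h₁ (fun i => by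
      obtain h' | ⟨⟨e⟩⟩ := h₂ i
      · exact E.prop_of_isZero ((Dsg.single 𝒞).map_isZero h')
      · exact E.prop_of_iso ((Dsg.single 𝒞).mapIso e) (h i))
    exact E.ext_of_isTriangulatedClosed₂ _ ((Dsg.Q 𝒞).map_distinguished _ hT)
      (E.prop_of_iso (Dsg.singleIso _ b).symm (E.le_shift (-b) _ (h b))) h₃

/-- The augmented resolution is `𝒞`-acyclic, hence zero in `D^b_𝒞`. Splitting off `M` from its top
degree `1` leaves a complex with Gorenstein terms, so `M⟦-1⟧`, and then `M`, lies in the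
triangulated image. -/
lemma theta_essImage_single (hfin : IsContravariantlyFinite 𝒞) (hadm : IsAdmissible 𝒞)
    (hdim : properGlobalDim 𝒞 (gorenstein 𝒞) < ⊤) (M : 𝒜) :
    (theta 𝒞).essImage ((Dsg.single 𝒞).obj M) := by
  have := isTriangulated_essImage_theta hfin hadm
  obtain ⟨n, K, hK, ⟨e⟩, hKG, hK0⟩ := exists_hasProperResolutionOfLength hdim M
  let K' : BoundedComplex 𝒜 := ⟨K, -n, 1, hK0⟩
  have hzero : IsZero ((BoundedComplex.toDb 𝒞).obj K') :=
    VerdierQuotient.isZero_obj (Kb.acyclic 𝒞) (X := (BoundedComplex.toKb 𝒜).obj K') hK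
  obtain ⟨L, f, g, δ, hT, h₁, h₂⟩ := exists_distinguished_single hfin hadm K' hK0
  have hG {Z : 𝒜} (hZ : IsZero Z) : (theta 𝒞).essImage ((Dsg.single 𝒞).obj Z) :=
    (theta 𝒞).essImage.prop_of_isZero ((Dsg.single 𝒞).map_isZero hZ)
  have h₃ := Dsg.prop_toDb_of_forall hfin hadm (theta 𝒞).essImage (n + 1) L
    (a := -n) (b := 1 - 1) (by lia) h₁ (fun i => by
      obtain h' | ⟨⟨e'⟩⟩ := h₂ i
      · exact hG h'
      · by_cases hi : -(n : ℤ) ≤ i ∧ i ≤ 0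
        · exact (theta 𝒞).essImage.prop_of_iso ((Dsg.single 𝒞).mapIso e')
            ⟨⟨_, hKG i hi.1 hi.2⟩, ⟨Iso.refl _⟩⟩
        · exact hG (h₁ i (by lia)))
  have h₄ := (theta 𝒞).essImage.ext_of_isTriangulatedClosed₁ _
    ((Dsg.Q 𝒞).map_distinguished _ hT)
    ((theta 𝒞).essImage.prop_of_isZero ((Dsg.Q 𝒞).map_isZero hzero)) h₃
  have h₅ := ((theta 𝒞).essImage.prop_shift_iff_of_isStableUnderShift _ _).1
    ((theta 𝒞).essImage.prop_of_iso (Dsg.singleIso (K.X 1) 1) h₄)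
  exact (theta 𝒞).essImage.prop_of_iso ((Dsg.single 𝒞).mapIso e) h₅

lemma theta_essSurj (hfin : IsContravariantlyFinite 𝒞) (hadm : IsAdmissible 𝒞)
    (hdim : properGlobalDim 𝒞 (gorenstein 𝒞) < ⊤) : (theta 𝒞).EssSurj where
  mem_essImage X := by
    have := isTriangulated_essImage_theta hfin hadm
    have := Localization.essSurj (Dsg.Q 𝒞) (Db.sub 𝒞).trW
    have := Localization.essSurj (Db.Q 𝒞) (Kb.acyclic 𝒞).trW
    obtain ⟨K, hK⟩ := BoundedComplex.toKb_obj_surjective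
      ((Db.Q 𝒞).objPreimage ((Dsg.Q 𝒞).objPreimage X))
    obtain ⟨a, b, hab⟩ := K.property
    refine (theta 𝒞).essImage.prop_of_iso ?_ (Dsg.prop_toDb_of_forall hfin hadm (theta 𝒞).essImage
      (b - a + 1).toNat K (by lia) hab (fun i => theta_essImage_single hfin hadm hdim _))
    exact (Dsg.Q 𝒞).mapIso ((Db.Q 𝒞).mapIso (eqToIso hK) ≪≫ (Db.Q 𝒞).objObjPreimageIso _) ≪≫
      (Dsg.Q 𝒞).objObjPreimageIso X

end EssSurj


/-! ### Transport of a triangulated structure along an equivalence -/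

section Transport

variable {C D : Type*} [Category* C] [Category* D] [HasZeroObject C] [HasZeroObject D]
  [Preadditive C] [Preadditive D] [HasShift D ℤ] [∀ n : ℤ, (shiftFunctor D n).Additive]
  [Pretriangulated D]

variable (D) in
/-- The zero objects of a pretriangulated category. -/
def zeroObjects : ObjectProperty D := fun X => IsZero X

instance : (zeroObjects D).IsClosedUnderIsomorphisms where
  of_iso e h := h.of_iso e.symm

instance : (zeroObjects D).IsTriangulated where
  exists_zero := ⟨0, isZero_zero D, isZero_zero D⟩
  isStableUnderShiftBy n := ⟨fun _ hX => (shiftFunctor D n).map_isZero hX⟩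
  toIsTriangulatedClosed₂ := .mk' fun T hT h₁ h₃ => by
    rw [zeroObjects, IsZero.iff_id_eq_zero]
    obtain ⟨ψ, hψ⟩ := Triangle.yoneda_exact₂ T hT (𝟙 _) (h₁.eq_of_src _ _)
    rw [hψ, h₃.eq_of_src ψ 0, comp_zero]

lemma trW_zeroObjects_le : (zeroObjects D).trW ≤ MorphismProperty.isomorphisms D := by
  rintro X Y f ⟨Z, g, h, hT, hZ⟩
  exact (Triangle.isZero₃_iff_isIso₁ _ hT).1 hZ

/-- A triangulated structure can be transported along an equivalence. -/
lemma exists_isTriangulated_of_equivalence [IsTriangulated D] (E : C ≌ D) [E.functor.Additive] :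
    ∃ (_ : HasShift C ℤ) (_ : ∀ n : ℤ, (shiftFunctor C n).Additive) (_ : Pretriangulated C)
      (_ : E.functor.CommShift ℤ), IsTriangulated C ∧ E.functor.IsTriangulated := by
  -- The inverse equivalence is a localization at morphisms with zero cone, all of them
  -- isomorphisms, so the triangulation of a Verdier localization supplies the structure on `C`.
  let W := (zeroObjects D).trW
  have : E.inverse.IsLocalization W := .of_isEquivalence _ _ trW_zeroObjects_le
  let : HasShift C ℤ := HasShift.localized E.inverse W ℤ
  let : E.inverse.CommShift ℤ := Functor.CommShift.localized E.inverse W ℤ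
  have (n : ℤ) : (shiftFunctor C n).Additive := by
    rw [Localization.functor_additive_iff E.inverse W]
    exact Functor.additive_of_iso (E.inverse.commShiftIso n)
  let : Pretriangulated C := Triangulated.Localization.pretriangulated E.inverse W
  have h : E.inverse.IsTriangulated :=
    Triangulated.Localization.isTriangulated_functor E.inverse W
  let : E.functor.CommShift ℤ := E.commShiftFunctor ℤ
  have := E.commShift_of_inverse ℤ
  have h' := Equivalence.IsTriangulated.mk'' E h
  exact ⟨inferInstance, inferInstance, inferInstance, inferInstance,
    Triangulated.Localization.isTriangulated E.inverse W, h'.leftAdjoint_isTriangulated⟩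

/-- A triangulated structure can be transported along a functor which is an equivalence. -/
lemma exists_isTriangulated_of_isEquivalence [IsTriangulated D] (F : C ⥤ D) [F.IsEquivalence]
    [h : F.Additive] :
    ∃ (_ : HasShift C ℤ) (_ : ∀ n : ℤ, (shiftFunctor C n).Additive) (_ : Pretriangulated C)
      (_ : F.CommShift ℤ), IsTriangulated C ∧ F.IsTriangulated :=
  @exists_isTriangulated_of_equivalence C D _ _ _ _ _ _ _ _ _ _ F.asEquivalence h

end Transport


/-! ### Recognition of Happel's triangulation -/

section PreimageShiftIso

variable {C D : Type*} [Category* C] [Category* D] [HasShift C ℤ] [HasShift D ℤ]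
  (F : C ⥤ D) [F.Full] [F.Faithful] [F.CommShift ℤ] {X Y : C} (e : F.obj X ≅ (F.obj Y)⟦(1 : ℤ)⟧)

/-- An isomorphism to a shift, described through a fully faithful functor commuting with shifts. -/
def preimageShiftIso : X ≅ Y⟦(1 : ℤ)⟧ :=
  F.preimageIso (e ≪≫ ((F.commShiftIso (1 : ℤ)).app Y).symm)

lemma map_preimageShiftIso_hom :
    F.map (preimageShiftIso F e).hom ≫ (F.commShiftIso (1 : ℤ)).hom.app Y = e.hom := by
  simp [preimageShiftIso]

end PreimageShiftIso

section Happel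

variable {B : Type u} [Category.{v} B] [Preadditive B] {ε : ObjectProperty (ShortComplex B)}
  [HasZeroObject B] [HasBinaryBiproducts B] [HasShift (StableCategory ε) ℤ]
  [∀ n : ℤ, (shiftFunctor (StableCategory ε) n).Additive] [Pretriangulated (StableCategory ε)]
  {D : Type*} [Category* D] [HasZeroObject D] [Preadditive D] [HasShift D ℤ]
  [∀ n : ℤ, (shiftFunctor D n).Additive] [Pretriangulated D]

/-- A fully faithful triangulated functor detects Happel's triangulation. -/
def happelTriangulation (hε : IsFrobenius ε) (F : StableCategory ε ⥤ D) [F.Full] [F.Faithful]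
    [F.CommShift ℤ] [F.IsTriangulated]
    (σ : ∀ (S : ShortComplex B) (_ : ε S) (_ : IsRelInjective ε S.X₂),
      F.obj ((stableQuotient ε).obj S.X₃) ≅ (F.obj ((stableQuotient ε).obj S.X₁))⟦(1 : ℤ)⟧)
    (naturality : ∀ (S S' : ShortComplex B) (hS : ε S) (hI : IsRelInjective ε S.X₂)
      (hS' : ε S') (hI' : IsRelInjective ε S'.X₂) (φ : S ⟶ S'),
      F.map ((stableQuotient ε).map φ.τ₃) ≫ (σ S' hS' hI').hom =
        (σ S hS hI).hom ≫ (F.map ((stableQuotient ε).map φ.τ₁))⟦(1 : ℤ)⟧')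
    (distinguished : ∀ (S : ShortComplex B) (hS : ε S) (hI : IsRelInjective ε S.X₂) (M Z : B)
      (u : S.X₁ ⟶ M) (v : M ⟶ Z) (b : S.X₂ ⟶ Z) (w : Z ⟶ S.X₃),
      IsPushout S.f u b v → b ≫ w = S.g → v ≫ w = 0 →
        Triangle.mk (F.map ((stableQuotient ε).map u)) (F.map ((stableQuotient ε).map v))
          (F.map ((stableQuotient ε).map w) ≫ (σ S hS hI).hom) ∈ distTriang D) :
    HappelTriangulation ε :=
  have standard : ∀ (S : ShortComplex B) (hS : ε S) (hI : IsRelInjective ε S.X₂) (M Z : B)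
      (u : S.X₁ ⟶ M) (v : M ⟶ Z) (b : S.X₂ ⟶ Z) (w : Z ⟶ S.X₃),
      IsPushout S.f u b v → b ≫ w = S.g → v ≫ w = 0 →
        Triangle.mk ((stableQuotient ε).map u) ((stableQuotient ε).map v)
          ((stableQuotient ε).map w ≫ (preimageShiftIso F (σ S hS hI)).hom) ∈
            distTriang (StableCategory ε) := by
    intro S hS hI M Z u v b w sq hb hv
    have h := distinguished S hS hI M Z u v b w sq hb hv
    rw [← map_preimageShiftIso_hom F (σ S hS hI), ← Functor.map_comp_assoc] at h
    exact (F.map_distinguished_iff _).1 h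
  { suspIso S hS hI := preimageShiftIso F (σ S hS hI)
    suspIso_naturality S S' hS hI hS' hI' φ := by
      apply F.map_injective
      rw [← cancel_mono ((F.commShiftIso (1 : ℤ)).hom.app _), Functor.map_comp, Functor.map_comp,
        Category.assoc, Category.assoc, map_preimageShiftIso_hom F (σ S' hS' hI'),
        naturality S S' hS hI hS' hI' φ, ← map_preimageShiftIso_hom F (σ S hS hI),
        Category.assoc]
      congr 1
      exact ((F.commShiftIso (1 : ℤ)).hom.naturality _).symm
    distinguished_iff T := by
      constructor
      · intro hT
        obtain ⟨u, hu⟩ := (stableQuotient ε).map_surjective (X := T.obj₁.as) (Y := T.obj₂.as)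
          T.mor₁
        -- A distinguished triangle is determined up to isomorphism by its first map, so it suffices
        -- to build one standard triangle on a representative `u`.
        obtain ⟨I, i, hI, Y, p, h, hS⟩ := hε.enough_injectives T.obj₁.as
        obtain ⟨Z, b, v, sq, -⟩ := hε.exact.pushout_inflation i u ⟨Y, p, h, hS⟩
        have hb : b ≫ sq.desc p 0 (by rw [h, comp_zero]) = p := sq.inl_desc _ _ _
        have hv : v ≫ sq.desc p 0 (by rw [h, comp_zero]) = 0 := sq.inr_desc _ _ _
        refine ⟨_, hS, hI, T.obj₂.as, Z, u, v, b, _, sq, hb, hv, ⟨?_⟩⟩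
        refine isoTriangleOfIso₁₂ _ _ hT (standard _ hS hI _ _ u v b _ sq hb hv) (Iso.refl _)
          (Iso.refl _) ?_
        exact (Category.comp_id _).trans (hu.symm.trans (Category.id_comp _).symm)
      · rintro ⟨S, hS, hI, M, Z, u, v, b, w, sq, hb, hv, ⟨e⟩⟩
        exact isomorphic_distinguished _ (standard S hS hI M Z u v b w sq hb hv) _ e }

end Happel

/-! ### Push-outs inside the Gorenstein category -/

section Pushout

variable {𝒜 : Type u} [Category.{v} 𝒜] [Abelian 𝒜] {𝒞 : ObjectProperty 𝒜}
  [𝒞.IsClosedUnderBinaryProducts]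

/-- Push-outs of conflations of Gorenstein objects are push-outs in the ambient category. -/
lemma isPushout_hom_of_conflation (hfin : IsContravariantlyFinite 𝒞) (hadm : IsAdmissible 𝒞)
    {X I Y M Z : (gorenstein 𝒞).FullSubcategory} {i : X ⟶ I} {p : I ⟶ Y} {h : i ≫ p = 0}
    (hS : gorensteinConflations 𝒞 (ShortComplex.mk i p h)) {u : X ⟶ M} {b : I ⟶ Z} {v : M ⟶ Z}
    (sq : IsPushout i u b v) : IsPushout i.hom u.hom b.hom v.hom := by
  have hp := (gorensteinConflations_iff hfin hadm _).1 hS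
  have h' : i.hom ≫ p.hom = 0 := congr_arg InducedCategory.Hom.hom h
  replace hp : IsProper 𝒞 (ShortComplex.mk i.hom p.hom h') := hp
  have sq₀ := IsPushout.of_hasPushout i.hom u.hom
  have hZ := gorenstein_of_isProper hfin hadm
      (hp.pushout sq₀ (w := pushout.desc p.hom 0 (by rw [h', comp_zero])) (pushout.inl_desc _ _ _)
      (pushout.inr_desc _ _ _)) M.property Y.property
  let Z' : (gorenstein 𝒞).FullSubcategory := ⟨_, hZ⟩
  let b' : I ⟶ Z' := ObjectProperty.homMk (pushout.inl i.hom u.hom)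
  let v' : M ⟶ Z' := ObjectProperty.homMk (pushout.inr i.hom u.hom)
  have sq₁ : IsPushout i u b' v' := IsPushout.of_map (gorenstein 𝒞).ι (by ext; exact sq₀.w) sq₀
  -- The ambient push-out is Gorenstein by closure under extensions, so it is also a push-out in the
  -- subcategory and is isomorphic to the given one.
  let e := sq₁.isoIsPushout _ _ sq
  exact sq₀.of_iso (Iso.refl _) (Iso.refl _) (Iso.refl _) ((gorenstein 𝒞).ι.mapIso e)
    (by simp) (by simp)
    (((congr_arg InducedCategory.Hom.hom (sq₁.inl_isoIsPushout_hom _ _ sq)).trans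
      (Category.id_comp _).symm))
    (((congr_arg InducedCategory.Hom.hom (sq₁.inr_isoIsPushout_hom _ _ sq)).trans
      (Category.id_comp _).symm))

end Pushout

/-! ### The triangle equivalence -/

section Main

variable {𝒜 : Type u} [Category.{v} 𝒜] [Abelian 𝒜] {𝒞 : ObjectProperty 𝒜}
  [𝒞.ContainsZero] [𝒞.IsStableUnderRetracts] [𝒞.IsClosedUnderBinaryProducts]

variable (hθ : ∀ (X Y : (gorenstein 𝒞).FullSubcategory) (f g : X ⟶ Y),
  stableRel (gorensteinConflations 𝒞) f g → (theta 𝒞).map f = (theta 𝒞).map g)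

/-- The functor induced by `θ` on the stable category. -/
abbrev stableTheta : StableCategory (gorensteinConflations 𝒞) ⥤ Dsg 𝒞 :=
  CategoryTheory.Quotient.lift (stableRel (gorensteinConflations 𝒞)) (theta 𝒞) hθ

lemma stableTheta_isEquivalence (hfin : IsContravariantlyFinite 𝒞) (hadm : IsAdmissible 𝒞)
    (hdim : properGlobalDim 𝒞 (gorenstein 𝒞) < ⊤) : (stableTheta hθ).IsEquivalence where
  faithful := ⟨by
    intro X Y f g hfg
    obtain ⟨f, rfl⟩ := (stableQuotient (gorensteinConflations 𝒞)).map_surjective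
      (X := X.as) (Y := Y.as) f
    obtain ⟨g, rfl⟩ := (stableQuotient (gorensteinConflations 𝒞)).map_surjective
      (X := X.as) (Y := Y.as) g
    exact CategoryTheory.Quotient.sound _ ((theta_map_eq_iff hfin hadm f g).1 hfg)⟩
  full := ⟨by
    intro X Y φ
    have := theta_full hfin hadm
    obtain ⟨f, hf⟩ := (theta 𝒞).map_surjective (X := X.as) (Y := Y.as) φ
    exact ⟨(stableQuotient _).map f, hf⟩⟩
  essSurj := ⟨fun X => by
    have := theta_essSurj hfin hadm hdim
    exact ⟨(stableQuotient _).obj ((theta 𝒞).objPreimage X), ⟨(theta 𝒞).objObjPreimageIso X⟩⟩⟩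

lemma stableTheta_additive : (stableTheta hθ).Additive where
  map_add {X Y f g} := by
    obtain ⟨f, rfl⟩ := (stableQuotient (gorensteinConflations 𝒞)).map_surjective
      (X := X.as) (Y := Y.as) f
    obtain ⟨g, rfl⟩ := (stableQuotient (gorensteinConflations 𝒞)).map_surjective
      (X := X.as) (Y := Y.as) g
    rw [← Functor.map_add]
    exact (theta 𝒞).map_add

/-- The suspension of a conflation of Gorenstein objects in the singularity category. -/
def thetaSuspIso (hfin : IsContravariantlyFinite 𝒞) (hadm : IsAdmissible 𝒞)
    (S : ShortComplex (gorenstein 𝒞).FullSubcategory) (hS : gorensteinConflations 𝒞 S)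
    (hI : IsRelInjective (gorensteinConflations 𝒞) S.X₂) :
    (theta 𝒞).obj S.X₃ ≅ ((theta 𝒞).obj S.X₁)⟦(1 : ℤ)⟧ :=
  have hp := (gorensteinConflations_iff hfin hadm S).1 hS
  -- The sign makes the push-out triangles distinguished without altering their maps.
  @asIso _ _ _ _ (-Dsg.δ hfin hadm hp) 
    (Dsg.isIso_neg_δ hfin hadm hp ((isRelInjective_iff hfin hadm _).1 hI))

/-- The stable category of Gorenstein objects carries Happel's triangulation, and it is
triangle equivalent to the singularity category. -/
theorem stableTheta_isTriangleEquivalence (hfin : IsContravariantlyFinite 𝒞)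
    (hadm : IsAdmissible 𝒞) (hdim : properGlobalDim 𝒞 (gorenstein 𝒞) < ⊤) :
    ∃ (_ : HasShift (StableCategory (gorensteinConflations 𝒞)) ℤ)
      (_ : ∀ n : ℤ, (shiftFunctor (StableCategory (gorensteinConflations 𝒞)) n).Additive)
      (_ : Pretriangulated (StableCategory (gorensteinConflations 𝒞))),
      IsTriangulated (StableCategory (gorensteinConflations 𝒞)) ∧
      Nonempty (HappelTriangulation (gorensteinConflations 𝒞)) ∧
      IsTriangleEquivalence (stableTheta hθ) := by
  have h₁ := stableTheta_isEquivalence hθ hfin hadm hdim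
  have h₂ := stableTheta_additive hθ
  obtain ⟨i₁, i₂, i₃, i₄, h₃, h₄⟩ := exists_isTriangulated_of_isEquivalence (stableTheta hθ)
  refine ⟨i₁, i₂, i₃, h₃, ⟨?_⟩, h₁, i₄, h₄⟩
  refine happelTriangulation (isFrobenius_gorensteinConflations hfin hadm) (stableTheta hθ)
    (thetaSuspIso hfin hadm) ?_ ?_
  · intro S S' hS hI hS' hI' φ
    have h := Dsg.δ_naturality hfin hadm ((gorensteinConflations_iff hfin hadm S).1 hS)
      ((gorensteinConflations_iff hfin hadm S').1 hS') φ.τ₁.hom φ.τ₂.hom φ.τ₃.hom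
      (congr_arg InducedCategory.Hom.hom φ.comm₁₂.symm)
      (congr_arg InducedCategory.Hom.hom φ.comm₂₃.symm)
    refine (Preadditive.comp_neg _ _).trans ?_
    refine (congr_arg Neg.neg h).trans ?_
    exact (Preadditive.neg_comp _ _).symm
  · intro S hS hI M Z u v b w sq hb hv
    exact Dsg.distinguished_pushout hfin hadm ((gorensteinConflations_iff hfin hadm S).1 hS)
      ((isRelInjective_iff hfin hadm _).1 hI)
      (isPushout_hom_of_conflation hfin hadm (h := S.zero) hS sq)
      (congr_arg InducedCategory.Hom.hom hb) (congr_arg InducedCategory.Hom.hom hv)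

end Main

end RelSing

end

theorem theorem4p12 {k : Type w} {A : Type u} [Field k] [Ring A] [Algebra k A]
    [FiniteDimensional k A] (𝒞 : ObjectProperty (FDModuleCat k A))
    [𝒞.ContainsZero] [𝒞.IsClosedUnderBinaryProducts] [𝒞.IsStableUnderRetracts]
    (hfin : IsContravariantlyFinite 𝒞) (hadm : IsAdmissible 𝒞)
    (hdim : properGlobalDim 𝒞 (gorenstein 𝒞) < ⊤) :
    IsFrobenius (gorensteinConflations 𝒞) ∧
    ∃ hθ : ∀ (X Y : (gorenstein 𝒞).FullSubcategory) (f g : X ⟶ Y),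
        stableRel (gorensteinConflations 𝒞) f g →
          (theta 𝒞).map f = (theta 𝒞).map g,
      ∃ (_ : HasShift (StableCategory (gorensteinConflations 𝒞)) ℤ)
        (_ : ∀ n : ℤ, (shiftFunctor
          (StableCategory (gorensteinConflations 𝒞)) n).Additive)
        (_ : Pretriangulated (StableCategory (gorensteinConflations 𝒞))),
        IsTriangulated (StableCategory (gorensteinConflations 𝒞)) ∧
        Nonempty (HappelTriangulation (gorensteinConflations 𝒞)) ∧
        IsTriangleEquivalence
          (CategoryTheory.Quotient.lift (stableRel (gorensteinConflations 𝒞))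
            (theta 𝒞) hθ) := by
  exact ⟨isFrobenius_gorensteinConflations hfin hadm,
    fun _ _ f g h => (theta_map_eq_iff hfin hadm f g).2 h,
    stableTheta_isTriangleEquivalence _ hfin hadm hdim⟩
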